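/- Let $\mathbb K=\mathbb R$ or $\mathbb C$, let $N\ge 3$ be an integer and let $t_0\in\mathbb K$ be a constant. Write $(x,y,t)=(t_1,t_2,t_N)$. All functions below are smooth $\mathbb K$-valued functions on open sets $U\subset\mathbb R^3$, and pseudodifferential operators are formal series $\sum_{i\le M}a_i\partial^i$ in $\partial=\partial_x$ with such coefficients; $(\cdot)_-$ denotes the part with negative powers of $\partial$. A solution of the $N$-th KP equation $KP_N$ is an operator $K=1+\sum_{j\ge1}K_j(x,y,t)\partial^{-j}$ with $\partial_{t_k}K=-(K\partial^kK^{-1})_-K$ for $k=2,N$ (all other times are frozen at $0$); put $w=-2K_1$. Let $\hat x=x+2y\,\partial+Nt\,\partial^{N-1}+t_0\partial^{-1}$ and, for $m,n\in\mathbb Z$, let $\partial_{mn}w$ be the flow of $w$ given by the vector field $V_{mn}K=-(K\hat x^{\,n}\partial^mK^{-1})_-K$ of $P_\infty$. The flows with $n\ge 0$ form $W_\infty\oplus H$ (those with $n=0$ form $H$), and those with $n<0$ form $I_\infty$. For $n<0$ one works on $t\ne0$, and $\hat x^{-1}$ is the inverse $(Nt)^{-1}\partial^{1-N}(1+O(\partial^{-1}))$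 of $\hat x$, which is an operator of order $1-N$ (convention (i)). A vector field $v_1\partial_x+v_2\partial_y+v_N\partial_t+p\,\partial_w$ with coefficients depending on $x,y,t,w$ defines the evolution $w_z=v_1w_x+v_2w_y+v_Nw_t-p$; it is a Lie point symmetry of $KP_N$ if for every solution $K$ there is a solution $\Lambda=\sum_{j\ge1}\Lambda_j\partial^{-j}$ of the equations linearized at $K$ with $-2\Lambda_1=w_z$. The Lie point symmetries considered are $T(f)+Y(g)+X(h)+W(k)+U(\ell)$, where $f,g,h,k,\ell$ (also denoted $h_N,h_2,h_1,h_0,h_{-1}$) are functions of $t$ and the field corresponds to $$w_z=f w_t+\Big(\tfrac{2}{N}yf'+g\Big)w_y+\Big(\tfrac1N xf'+h\Big)w_x+\tfrac1N wf'+2\ell+R_N,$$ $$R_3=\Big(\tfrac29y^2f''+\tfrac23yg'\Big)w_x+\tfrac19(x^2+4yt_0)f''+\tfrac4{27}xy^2f'''+\tfrac4{243}y^4f''''+\tfrac23t_0g'+\tfrac49xyg''+\tfrac8{81}y^3g'''+\tfrac23xh'+\tfrac49y^2h''+\tfrac43yk',$$ $$R_4=\tfrac14xyf''+\tfrac12xg'+yh',\qquad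 R_5=\tfrac4{25}y^2f''+\tfrac45yg',\qquad R_N=0\ (N\ge6).$$ For $\alpha\in\{N,2,1,0,-1\}$ let $V^N(\alpha,\varphi)$ be the field with $h_\alpha=\varphi$ and the other functions zero; for other $\alpha$ put $V^N(\alpha,\varphi)=0$. For $I\subset\mathbb Z$, the $I$-part consists of the fields all of whose functions $f,g,h,k,\ell$ are finite linear combinations of the powers $t^j$, $j\in I$. The positive part is the case $I=\{j\ge0\}$ and the negative part is the case $I=\{j<0\}$. Consider the flows $\partial_{mn}w$ with $n\in I$ and $m-n\le N(1-n)$, that is, $\alpha:=m-n+Nn\le N$. Then, for $I=\{n\ge0\}$ (the $W_\infty\oplus H$ part, on all of $\mathbb R^3$) and for $I=\{n<0\}$ and $I=\{n\le0\}$ (the $I_\infty$ part, without and with $n=0$, on $t\ne0$, with convention (i)), the following hold. (a) If not $2<\alpha<N$, then on all solutions $\partial_{mn}w$ is given by the field $V^N(\alpha,(Nt)^n)+V^N(\alpha-N,c\,t^{n-1})$ with a constant $c=c(m,n,N,t_0)\in\mathbb K$ which can be taken to be zero if $n-1\notin I$. If $2<\alpha<N$, then on all solutions $\partial_{mn}w$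 equals $(Nt)^n\,\partial_{t_\alpha}w$, a derivative with respect to a frozen time, $\partial_{t_\alpha}w$ being the variation of $w$ under $-(K\partial^\alpha K^{-1})_-K$, plus the evolution given by some vector field in $x,y,t,w$. (b) A vector field in $x,y,t,w$ is given on all solutions by a finite linear combination of these flows if and only if it belongs to the $I$-part. So the positive part is exactly what $W_\infty\oplus H$ reduces to, and the negative part is exactly what $I_\infty$ reduces to. (c) Every field in the $I$-part is a Lie point symmetry of $KP_N$. Moreover, on $t\neq 0$ the operator $\hat x$ is invertible and its inverse has the form stated in convention (i). -/

import Mathlib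

set_option linter.unusedSectionVars false

/-- Two-sided sequences `(a i)` of coefficients that vanish for all large `i`. -/
def boundedOrder (R : Type*) [CommRing R] : AddSubgroup (ℤ → R) where
  carrier := {a | ∃ M : ℤ, ∀ i, M < i → a i = 0}
  zero_mem' := ⟨0, fun _ _ => rfl⟩
  add_mem' := by
    rintro a b ⟨M, hM⟩ ⟨M', hM'⟩
    exact ⟨max M M', fun i hi => by
      simp [hM i (lt_of_le_of_lt (le_max_left _ _) hi),
        hM' i (lt_of_le_of_lt (le_max_right _ _) hi)]⟩
  neg_mem' := by
    rintro a ⟨M, hM⟩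
    exact ⟨M, fun i hi => by simp [hM i hi]⟩

/-- Formal pseudodifferential operators `∑ i, a i * ∂ ^ i`: finite order, arbitrarily many
negative powers of `∂`. -/
def PDO (R : Type*) [CommRing R] : Type _ := boundedOrder R

namespace PDO

section Ring

open Finset.HasAntidiagonal (antidiagonal mem_antidiagonal)

variable {R : Type*} [CommRing R]

instance : AddCommGroup (PDO R) := inferInstanceAs (AddCommGroup (boundedOrder R))

/-- The coefficient of `∂ ^ i`. -/
def coeff (P : PDO R) (i : ℤ) : R := P.1 i

@[ext] theorem ext {P Q : PDO R} (h : ∀ i, P.coeff i = Q.coeff i) : P = Q :=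
  Subtype.ext (funext h)

@[simp] theorem coeff_zero (i : ℤ) : (0 : PDO R).coeff i = 0 := rfl
@[simp] theorem coeff_add (P Q : PDO R) (i : ℤ) : (P + Q).coeff i = P.coeff i + Q.coeff i := rfl
@[simp] theorem coeff_neg (P : PDO R) (i : ℤ) : (-P).coeff i = -P.coeff i := rfl
@[simp] theorem coeff_sub (P Q : PDO R) (i : ℤ) : (P - Q).coeff i = P.coeff i - Q.coeff i :=
  rfl

/-- The operator `a * ∂ ^ m`. -/
def single (m : ℤ) (a : R) : PDO R :=
  ⟨fun i => if i = m then a else 0, m, fun _ hi => if_neg hi.ne'⟩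

theorem exists_bound (P : PDO R) : ∃ M : ℤ, ∀ i, M < i → P.coeff i = 0 := P.2

theorem coeff_single (m : ℤ) (a : R) (i : ℤ) : (single m a).coeff i = if i = m then a else 0 :=
  rfl

variable [Differential R]

/-- The coefficient of `∂ ^ p` in `(∑ a i * ∂ ^ i) * (∑ b j * ∂ ^ j)`, by the Leibniz rule
`∂ ^ i * b = ∑ k, (i choose k) * b^(k) * ∂ ^ (i - k)`, valid for all integers `i`. Only finitely
many terms are nonzero. -/
noncomputable def mulCoeff (a b : ℤ → R) (p : ℤ) : R :=
  ∑ᶠ q : ℤ × ℕ, Ring.choose q.1 q.2 •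
    (a q.1 * (Differential.deriv (R := R))^[q.2] (b (p - q.1 + q.2)))

theorem iter_zero (k : ℕ) : (Differential.deriv (R := R))^[k] 0 = 0 := by
  induction k with
  | zero => rfl
  | succ k ih => rw [Function.iterate_succ_apply', ih, map_zero]

theorem mulCoeff_of_lt {a b : ℤ → R} {A B : ℤ} (ha : ∀ i, A < i → a i = 0)
    (hb : ∀ i, B < i → b i = 0) {p : ℤ} (hp : A + B < p) : mulCoeff a b p = 0 := by
  refine finsum_eq_zero_of_forall_eq_zero fun q => ?_
  by_cases h : A < q.1
  · simp [ha _ h]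
  · rw [hb _ (by omega), iter_zero]; simp

theorem mulCoeff_eq {a b : ℤ → R} {A B : ℤ} (ha : ∀ i, A < i → a i = 0)
    (hb : ∀ i, B < i → b i = 0) (n : ℕ) :
    mulCoeff a b (A + B - n) = ∑ x ∈ antidiagonal n, ∑ y ∈ antidiagonal x.2,
      Ring.choose (A - x.1) y.2 •
        (a (A - x.1) * (Differential.deriv (R := R))^[y.2] (b (B - y.1))) := by
  classical
  rw [Finset.sum_sigma']
  let g : (Σ _ : ℕ × ℕ, ℕ × ℕ) → ℤ × ℕ := fun z => (A - z.1.1, z.2.2)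
  have hg : Set.InjOn g ((antidiagonal n).sigma fun x => antidiagonal x.2) := by
    rintro ⟨⟨i, r⟩, j, k⟩ h ⟨⟨i', r'⟩, j', k'⟩ h' e
    simp only [Finset.coe_sigma, Set.mem_sigma_iff, Finset.mem_coe, mem_antidiagonal,
      g, Prod.mk.injEq] at h h' e
    obtain ⟨rfl⟩ : i = i' := by omega
    obtain ⟨rfl⟩ : r = r' := by omega
    obtain ⟨rfl⟩ : k = k' := by omega
    obtain ⟨rfl⟩ : j = j' := by omega
    rfl
  unfold mulCoeff
  rw [finsum_eq_sum_of_support_subset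
    (s := ((antidiagonal n).sigma fun x => antidiagonal x.2).image g),
    Finset.sum_image hg]
  · refine Finset.sum_congr rfl ?_
    rintro ⟨⟨i, r⟩, j, k⟩ h
    simp only [Finset.mem_sigma, mem_antidiagonal] at h
    simp only [g]
    rw [show A + B - (n : ℤ) - (A - i) + k = B - j by omega]
  · rintro ⟨l, k⟩ h
    have h1 : l ≤ A := by
      by_contra hl
      exact h (by simp [ha l (by omega)])
    have h2 : A + B - n - l + k ≤ B := by
      by_contra hl
      exact h (by simp only [hb _ (not_le.mp hl), iter_zero]; simp)
    simp only [Finset.coe_image, Set.mem_image, Finset.mem_coe, Finset.mem_sigma,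
      mem_antidiagonal, g]
    exact ⟨⟨((A - l).toNat, (n - (A - l)).toNat), ((n - (A - l)).toNat - k, k)⟩,
      ⟨by dsimp only; omega, by dsimp only; omega⟩, by
        simp only [Prod.mk.injEq, and_true]; omega⟩

noncomputable instance : Mul (PDO R) := ⟨fun P Q => ⟨mulCoeff P.1 Q.1, by
  obtain ⟨A, hA⟩ := P.2
  obtain ⟨B, hB⟩ := Q.2
  exact ⟨A + B, fun _ hi => mulCoeff_of_lt hA hB hi⟩⟩⟩

instance : One (PDO R) := ⟨single 0 1⟩

theorem coeff_mul (P Q : PDO R) (p : ℤ) : (P * Q).coeff p = ∑ᶠ q : ℤ × ℕ,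
    Ring.choose q.1 q.2 • (P.coeff q.1 * (Differential.deriv (R := R))^[q.2] (Q.coeff (p - q.1 + q.2))) := rfl

theorem mul_coeff_eq {P Q : PDO R} {A B : ℤ} (ha : ∀ i, A < i → P.coeff i = 0)
    (hb : ∀ i, B < i → Q.coeff i = 0) (n : ℕ) :
    (P * Q).coeff (A + B - n) = ∑ x ∈ antidiagonal n, ∑ y ∈ antidiagonal x.2,
      Ring.choose (A - x.1) y.2 •
        (P.coeff (A - x.1) * (Differential.deriv (R := R))^[y.2] (Q.coeff (B - y.1))) :=
  mulCoeff_eq ha hb n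

theorem mul_coeff_lt {P Q : PDO R} {A B : ℤ} (ha : ∀ i, A < i → P.coeff i = 0)
    (hb : ∀ i, B < i → Q.coeff i = 0) {p : ℤ} (hp : A + B < p) : (P * Q).coeff p = 0 :=
  mulCoeff_of_lt ha hb hp

theorem iter_add (k : ℕ) (a b : R) : (Differential.deriv (R := R))^[k] (a + b) =
    (Differential.deriv (R := R))^[k] a + (Differential.deriv (R := R))^[k] b := by
  induction k with
  | zero => rfl
  | succ k ih => simp only [Function.iterate_succ_apply', ih, map_add]

/-- The `k`-fold derivative as an additive map. -/
def iterHom (k : ℕ) : R →+ R where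
  toFun := (Differential.deriv (R := R))^[k]
  map_zero' := iter_zero k
  map_add' := iter_add k

theorem iter_mul (k : ℕ) (a b : R) : (Differential.deriv (R := R))^[k] (a * b) =
    ∑ x ∈ antidiagonal k, (k.choose x.1) • ((Differential.deriv (R := R))^[x.1] a *
      (Differential.deriv (R := R))^[x.2] b) := by
  induction k with
  | zero => simp
  | succ k ih =>
    rw [Function.iterate_succ_apply', ih, map_sum, Finset.sum_antidiagonal_choose_succ_nsmul
      (fun i j => (Differential.deriv (R := R))^[i] a * (Differential.deriv (R := R))^[j] b) k,
      ← Finset.sum_add_distrib]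
    refine Finset.sum_congr rfl fun x hx => ?_
    rw [mem_antidiagonal] at hx
    rw [map_nsmul, Derivation.leibniz, ← Function.iterate_succ_apply' (f := Differential.deriv),
      ← Function.iterate_succ_apply' (f := Differential.deriv), smul_add, smul_eq_mul, smul_eq_mul,
      ← hx, Nat.choose_symm_add]
    ring

protected theorem left_distrib (P Q S : PDO R) : P * (Q + S) = P * Q + P * S := by
  obtain ⟨A, hA⟩ := P.exists_bound
  obtain ⟨B, hB⟩ := Q.exists_bound
  obtain ⟨C, hC⟩ := S.exists_bound
  have hB' : ∀ i, max B C < i → Q.coeff i = 0 := fun i hi => hB i (by omega)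
  have hC' : ∀ i, max B C < i → S.coeff i = 0 := fun i hi => hC i (by omega)
  have hBC : ∀ i, max B C < i → (Q + S).coeff i = 0 := fun i hi => by simp [hB' i hi, hC' i hi]
  ext p
  rw [coeff_add]
  rcases lt_or_ge (A + max B C) p with h | h
  · rw [mul_coeff_lt hA hBC h, mul_coeff_lt hA hB' h, mul_coeff_lt hA hC' h, add_zero]
  · obtain ⟨n, hn⟩ := Int.le.dest h
    obtain rfl : p = A + max B C - n := by omega
    rw [mul_coeff_eq hA hBC, mul_coeff_eq hA hB', mul_coeff_eq hA hC']
    simp only [coeff_add, iter_add, mul_add, smul_add, Finset.sum_add_distrib]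

protected theorem right_distrib (P Q S : PDO R) : (P + Q) * S = P * S + Q * S := by
  obtain ⟨A, hA⟩ := P.exists_bound
  obtain ⟨B, hB⟩ := Q.exists_bound
  obtain ⟨C, hC⟩ := S.exists_bound
  have hA' : ∀ i, max A B < i → P.coeff i = 0 := fun i hi => hA i (by omega)
  have hB' : ∀ i, max A B < i → Q.coeff i = 0 := fun i hi => hB i (by omega)
  have hAB : ∀ i, max A B < i → (P + Q).coeff i = 0 := fun i hi => by simp [hA' i hi, hB' i hi]
  ext p
  rw [coeff_add]
  rcases lt_or_ge (max A B + C) p with h | h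
  · rw [mul_coeff_lt hAB hC h, mul_coeff_lt hA' hC h, mul_coeff_lt hB' hC h, add_zero]
  · obtain ⟨n, hn⟩ := Int.le.dest h
    obtain rfl : p = max A B + C - n := by omega
    rw [mul_coeff_eq hAB hC, mul_coeff_eq hA' hC, mul_coeff_eq hB' hC]
    simp only [coeff_add, add_mul, smul_add, Finset.sum_add_distrib]

theorem coeff_one (i : ℤ) : (1 : PDO R).coeff i = if i = 0 then 1 else 0 := coeff_single 0 1 i

theorem iter_one (k : ℕ) : (Differential.deriv (R := R))^[k + 1] 1 = 0 := by
  rw [Function.iterate_succ_apply, Derivation.map_one_eq_zero, iter_zero]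

protected theorem one_mul (P : PDO R) : 1 * P = P := by
  ext p
  rw [coeff_mul, finsum_eq_single _ ((0 : ℤ), 0)]
  · simp [coeff_one]
  · rintro ⟨i, k⟩ h
    by_cases hi : i = 0
    · subst hi
      cases k with
      | zero => exact absurd rfl h
      | succ k => simp [Ring.choose_zero_succ]
    · simp [coeff_one, hi]

protected theorem mul_one (P : PDO R) : P * 1 = P := by
  ext p
  rw [coeff_mul, finsum_eq_single _ (p, 0)]
  · simp [coeff_one]
  · rintro ⟨i, k⟩ h
    simp only [coeff_one]
    cases k with
    | zero =>
      have : p - i ≠ 0 := fun e => h (by simp; omega)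
      simp [this]
    | succ k =>
      split_ifs
      · rw [iter_one]; simp
      · rw [iter_zero]; simp


theorem kernel (A B : ℤ) (T : ℕ) (b c : R) :
    ∑ x ∈ antidiagonal T, (Ring.choose (A + B - x.1) x.2 * Ring.choose A x.1) • ((Differential.deriv (R := R))^[x.1] b * (Differential.deriv (R := R))^[x.2] c) =
    ∑ x ∈ antidiagonal T, ∑ y ∈ antidiagonal x.1, (Ring.choose A x.1 * Ring.choose B x.2) •
      (x.1.choose y.1 • ((Differential.deriv (R := R))^[y.1] b * (Differential.deriv (R := R))^[y.2 + x.2] c)) := by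
  have h1 : ∀ x ∈ antidiagonal T, (Ring.choose (A + B - (x.1 : ℤ)) x.2 * Ring.choose A x.1) •
      ((Differential.deriv (R := R))^[x.1] b * (Differential.deriv (R := R))^[x.2] c) = ∑ y ∈ antidiagonal x.2,
      (Ring.choose (A - (x.1 : ℤ)) y.1 * Ring.choose B y.2 * Ring.choose A x.1) •
      ((Differential.deriv (R := R))^[x.1] b * (Differential.deriv (R := R))^[x.2] c) := by
    intro x _
    rw [← Finset.sum_smul, ← Finset.sum_mul,
      show A + B - (x.1 : ℤ) = (A - x.1) + B by ring,
      Ring.add_choose_eq x.2 (Commute.all (A - (x.1 : ℤ)) B)]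
  rw [Finset.sum_congr rfl h1, Finset.sum_sigma', Finset.sum_sigma']
  refine Finset.sum_nbij' (fun z => ⟨(z.1.1 + z.2.1, z.2.2), (z.1.1, z.2.1)⟩)
    (fun z => ⟨(z.2.1, z.2.2 + z.1.2), (z.2.2, z.1.2)⟩) ?_ ?_ ?_ ?_ ?_
  · rintro ⟨⟨k, q⟩, e, s⟩ h
    simp only [Finset.mem_sigma, mem_antidiagonal, and_true] at h ⊢
    omega
  · rintro ⟨⟨k, q⟩, e, s⟩ h
    simp only [Finset.mem_sigma, mem_antidiagonal, and_true] at h ⊢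
    omega
  · rintro ⟨⟨k, q⟩, e, s⟩ h
    simp only [Finset.mem_sigma, mem_antidiagonal] at h
    obtain ⟨rfl, rfl⟩ := h
    rfl
  · rintro ⟨⟨k, q⟩, e, s⟩ h
    simp only [Finset.mem_sigma, mem_antidiagonal] at h
    obtain ⟨rfl, rfl⟩ := h
    rfl
  · rintro ⟨⟨k, q⟩, e, s⟩ h
    simp only [Finset.mem_sigma, mem_antidiagonal] at h
    obtain ⟨rfl, rfl⟩ := h
    have h2 := Ring.choose_smul_choose A (Nat.le_add_right k e)
    rw [Nat.add_sub_cancel_left, nsmul_eq_mul] at h2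
    simp only
    rw [← Nat.cast_smul_eq_nsmul ℤ ((k + e).choose k), smul_smul]
    congr 1
    linear_combination (-Ring.choose B s) * h2

theorem iter_sum {ι : Type*} (k : ℕ) (s : Finset ι) (f : ι → R) :
    (Differential.deriv (R := R))^[k] (∑ i ∈ s, f i) = ∑ i ∈ s, (Differential.deriv (R := R))^[k] (f i) := map_sum (iterHom k) f s

theorem iter_zsmul (k : ℕ) (z : ℤ) (a : R) : (Differential.deriv (R := R))^[k] (z • a) = z • (Differential.deriv (R := R))^[k] a :=
  map_zsmul (iterHom k) z a

theorem assoc_left (n : ℕ) (F : ℕ → ℕ → ℕ → ℕ → ℕ → R) :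
    ∑ x ∈ antidiagonal n, ∑ y ∈ antidiagonal x.2, ∑ z ∈ antidiagonal x.1, ∑ w ∈ antidiagonal z.2, F z.1 w.1 y.1 w.2 y.2 =
    ∑ x ∈ antidiagonal n, ∑ y ∈ antidiagonal x.2, ∑ z ∈ antidiagonal y.2, ∑ w ∈ antidiagonal z.2, F x.1 y.1 z.1 w.1 w.2 := by
  simp only [Finset.sum_sigma']
  refine Finset.sum_nbij'
    (fun p => ⟨(p.2.2.1.1, p.2.2.2.1 + (p.2.1.1 + (p.2.2.2.2 + p.2.1.2))),
      (p.2.2.2.1, p.2.1.1 + (p.2.2.2.2 + p.2.1.2)), (p.2.1.1, p.2.2.2.2 + p.2.1.2),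
      (p.2.2.2.2, p.2.1.2)⟩)
    (fun p => ⟨(p.1.1 + (p.2.1.1 + p.2.2.2.1), p.2.2.1.1 + p.2.2.2.2),
      (p.2.2.1.1, p.2.2.2.2), (p.1.1, p.2.1.1 + p.2.2.2.1), (p.2.1.1, p.2.2.2.1)⟩) ?_ ?_ ?_ ?_ ?_
  · rintro ⟨⟨l, r⟩, ⟨h, q⟩, ⟨i, r2⟩, ⟨j, k⟩⟩ H
    simp only [Finset.mem_sigma, mem_antidiagonal, and_true] at H ⊢
    omega
  · rintro ⟨⟨l, r⟩, ⟨h, q⟩, ⟨i, r2⟩, ⟨j, k⟩⟩ H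
    simp only [Finset.mem_sigma, mem_antidiagonal, and_true] at H ⊢
    omega
  · rintro ⟨⟨l, r⟩, ⟨h, q⟩, ⟨i, r2⟩, ⟨j, k⟩⟩ H
    simp only [Finset.mem_sigma, mem_antidiagonal] at H
    simp only [Sigma.mk.injEq, Prod.mk.injEq, heq_eq_eq, true_and, and_true]
    omega
  · rintro ⟨⟨l, r⟩, ⟨h, q⟩, ⟨i, r2⟩, ⟨j, k⟩⟩ H
    simp only [Finset.mem_sigma, mem_antidiagonal] at H
    simp only [Sigma.mk.injEq, Prod.mk.injEq, heq_eq_eq, true_and, and_true]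
    omega
  · rintro ⟨⟨l, r⟩, ⟨h, q⟩, ⟨i, r2⟩, ⟨j, k⟩⟩ H
    rfl

theorem assoc_right (n : ℕ) (F : ℕ → ℕ → ℕ → ℕ → ℕ → R) :
    ∑ x ∈ antidiagonal n, ∑ y ∈ antidiagonal x.2, ∑ z ∈ antidiagonal y.1, ∑ w ∈ antidiagonal z.2, F x.1 z.1 w.1 y.2 w.2 =
    ∑ x ∈ antidiagonal n, ∑ y ∈ antidiagonal x.2, ∑ z ∈ antidiagonal y.2, ∑ w ∈ antidiagonal z.2, F x.1 y.1 z.1 w.1 w.2 := by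
  refine Finset.sum_congr rfl fun x _ => ?_
  simp only [Finset.sum_sigma']
  refine Finset.sum_nbij'
    (fun p => ⟨(p.2.1.1, p.2.2.1 + (p.1.2 + p.2.2.2)), (p.2.2.1, p.1.2 + p.2.2.2),
      (p.1.2, p.2.2.2)⟩)
    (fun p => ⟨(p.1.1 + (p.2.1.1 + p.2.2.2), p.2.2.1), (p.1.1, p.2.1.1 + p.2.2.2),
      (p.2.1.1, p.2.2.2)⟩) ?_ ?_ ?_ ?_ ?_
  · rintro ⟨⟨g, e⟩, ⟨j, r⟩, ⟨h, s⟩⟩ H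
    simp only [Finset.mem_sigma, mem_antidiagonal, and_true] at H ⊢
    omega
  · rintro ⟨⟨g, e⟩, ⟨j, r⟩, ⟨h, s⟩⟩ H
    simp only [Finset.mem_sigma, mem_antidiagonal, and_true] at H ⊢
    omega
  · rintro ⟨⟨g, e⟩, ⟨j, r⟩, ⟨h, s⟩⟩ H
    simp only [Finset.mem_sigma, mem_antidiagonal] at H
    simp only [Sigma.mk.injEq, Prod.mk.injEq, heq_eq_eq, true_and, and_true]
    omega
  · rintro ⟨⟨g, e⟩, ⟨j, r⟩, ⟨h, s⟩⟩ H
    simp only [Finset.mem_sigma, mem_antidiagonal] at H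
    simp only [Sigma.mk.injEq, Prod.mk.injEq, heq_eq_eq, true_and, and_true]
    omega
  · rintro ⟨⟨g, e⟩, ⟨j, r⟩, ⟨h, s⟩⟩ H
    rfl

protected theorem mul_assoc (P Q S : PDO R) : P * Q * S = P * (Q * S) := by
  obtain ⟨A, hA⟩ := P.exists_bound
  obtain ⟨B, hB⟩ := Q.exists_bound
  obtain ⟨C, hC⟩ := S.exists_bound
  have hAB : ∀ i, A + B < i → (P * Q).coeff i = 0 := fun i hi => mul_coeff_lt hA hB hi
  have hBC : ∀ i, B + C < i → (Q * S).coeff i = 0 := fun i hi => mul_coeff_lt hB hC hi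
  ext p
  rcases lt_or_ge (A + B + C) p with h | h
  · rw [mul_coeff_lt hAB hC h, mul_coeff_lt hA hBC (by omega)]
  obtain ⟨n, hn⟩ := Int.le.dest h
  obtain rfl : p = A + B + C - n := by omega
  rw [mul_coeff_eq hAB hC, add_assoc A B C, mul_coeff_eq hA hBC]
  simp only [mul_coeff_eq hA hB, mul_coeff_eq hB hC, iter_sum, iter_zsmul, iter_mul,
    Finset.sum_mul, Finset.mul_sum, Finset.smul_sum, smul_mul_assoc, mul_smul_comm]
  have e1 := assoc_left n fun i j h k q => Ring.choose (A + B - ((i + (j + k) : ℕ) : ℤ)) q •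
    Ring.choose (A - (i : ℤ)) k • (P.coeff (A - i) * (Differential.deriv (R := R))^[k] (Q.coeff (B - j)) *
      (Differential.deriv (R := R))^[q] (S.coeff (C - h)))
  have e2 := assoc_right n fun i j h e s => ∑ u ∈ antidiagonal e, Ring.choose (A - (i : ℤ)) e •
    Ring.choose (B - (j : ℤ)) s • (e.choose u.1 • (P.coeff (A - i) * ((Differential.deriv (R := R))^[u.1] (Q.coeff (B - j)) *
      (Differential.deriv (R := R))^[u.2] ((Differential.deriv (R := R))^[s] (S.coeff (C - h))))))
  refine Eq.trans ?_ (e1.trans (Eq.trans ?_ (e2.symm.trans ?_)))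
  · refine Finset.sum_congr rfl fun x _ => Finset.sum_congr rfl fun y _ =>
      Finset.sum_congr rfl fun z hz => Finset.sum_congr rfl fun w hw => ?_
    rw [mem_antidiagonal] at hz hw
    rw [hw, hz]
  · refine Finset.sum_congr rfl fun x _ => Finset.sum_congr rfl fun y _ =>
      Finset.sum_congr rfl fun z _ => ?_
    have := congrArg (fun r => P.coeff (A - x.1) * r) (kernel (A - x.1) (B - y.1) z.2
      (Q.coeff (B - y.1)) (S.coeff (C - z.1)))
    simp only [Finset.mul_sum] at this
    convert this using 2 with w hw w hw
    · rw [smul_smul, mul_smul_comm, mul_assoc]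
      congr 3
      push_cast
      ring
    · refine Finset.sum_congr rfl fun u _ => ?_
      rw [smul_smul, mul_smul_comm, mul_smul_comm, ← Function.iterate_add_apply]
  · rfl

noncomputable instance : Ring (PDO R) where
  left_distrib := PDO.left_distrib
  right_distrib := PDO.right_distrib
  zero_mul P := by ext p; simp [coeff_mul]
  mul_zero P := by ext p; simp [coeff_mul]
  mul_assoc := PDO.mul_assoc
  one_mul := PDO.one_mul
  mul_one := PDO.mul_one
  neg_add_cancel := neg_add_cancel
  sub_eq_add_neg := sub_eq_add_neg
  zsmul := zsmulRec

/-- The integral part `P_-`: the negative powers of `∂`. -/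
def minus (P : PDO R) : PDO R :=
  ⟨fun i => if i < 0 then P.coeff i else 0, 0, fun _ hi => if_neg hi.not_gt⟩

/-- The power `∂ ^ m`, for an integer `m`. -/
def D (m : ℤ) : PDO R := single m 1

/-- A derivation of the coefficients, applied coefficientwise. -/
def mapDeriv {A : Type*} [CommRing A] [Algebra A R] (δ : Derivation A R R) (P : PDO R) : PDO R :=
  ⟨fun i => δ (P.coeff i), by
    obtain ⟨M, hM⟩ := P.exists_bound
    exact ⟨M, fun i hi => by simp [hM i hi]⟩⟩

/-- Integer powers; negative powers are powers of the inverse in the ring of formal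
pseudodifferential operators (used only for invertible `P`). -/
noncomputable def zpow (P : PDO R) : ℤ → PDO R
  | Int.ofNat n => P ^ n
  | Int.negSucc n => Ring.inverse P ^ (n + 1)

/-- Formal Zakharov-Shabat dressing operators `1 + ∑ j ≥ 1, K_j * ∂ ^ (-j)`. -/
def IsDressing (K : PDO R) : Prop := K.coeff 0 = 1 ∧ ∀ i, 0 < i → K.coeff i = 0

/-- The vector field `V_A K = -(K A K⁻¹)_- K` on dressing operators. -/
noncomputable def field (A K : PDO R) : PDO R := -minus (K * A * Ring.inverse K) * K

/-- The derivative of `K ↦ -(K A K⁻¹)_- K` at `K` in the direction `Λ`. -/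
noncomputable def linField (A K Λ : PDO R) : PDO R :=
  -minus (Λ * A * Ring.inverse K - K * A * Ring.inverse K * Λ * Ring.inverse K) * K
    - minus (K * A * Ring.inverse K) * Λ

/-- The function `w = -2 K_1`. -/
def wOf (K : PDO R) : R := -2 * K.coeff (-1)

/-- The variation of `w = -2 K_1` along the vector field `V_A`. -/
noncomputable def wFlow (A K : PDO R) : R := wOf (field A K)

/-- The extended variable `x̂ = t_0 ∂⁻¹ + ∑ k, k t_k ∂ ^ (k - 1)`, where `t_1 = x` and
`t_k = 0` for `k ≤ -1` and for `k > N`. -/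
noncomputable def xhat (N : ℕ) (t₀ : R) (t : ℕ → R) : PDO R :=
  single (-1) t₀ + ∑ k ∈ Finset.Icc 1 N, single ((k : ℤ) - 1) ((k : R) * t k)

end Ring
end PDO

section Functions

open scoped ContDiff

variable (𝕜 : Type*) [RCLike 𝕜] (U : TopologicalSpace.Opens (Fin 3 → ℝ))

theorem extend_coe {U : TopologicalSpace.Opens (Fin 3 → ℝ)} {𝕜 : Type*} [RCLike 𝕜]
    (f : U → 𝕜) {p : Fin 3 → ℝ} (hp : p ∈ U) :
    Function.extend ((↑) : U → Fin 3 → ℝ) f 0 p = f ⟨p, hp⟩ :=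
  Subtype.val_injective.extend_apply f 0 (⟨p, hp⟩ : U)

/-- The algebra of smooth functions on an open set `U` of `ℝ³`, whose points are written
`(x, y, t) = (p 0, p 1, p 2)`. -/
def SmoothFun : Subalgebra 𝕜 (U → 𝕜) where
  carrier := {f | ContDiffOn ℝ ∞ (Function.extend ((↑) : U → Fin 3 → ℝ) f 0) U}
  mul_mem' {f g} hf hg := (hf.mul hg).congr fun p hp => by simp [extend_coe _ hp]
  add_mem' {f g} hf hg := (hf.add hg).congr fun p hp => by simp [extend_coe _ hp]
  algebraMap_mem' c := (contDiffOn_const (c := c)).congr fun p hp => by simp [extend_coe _ hp]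

variable {𝕜 U}

/-- Extension by zero of a function on `U`. -/
noncomputable def extZero (f : SmoothFun 𝕜 U) : (Fin 3 → ℝ) → 𝕜 :=
  Function.extend ((↑) : U → Fin 3 → ℝ) f.1 0

theorem extZero_apply (f : SmoothFun 𝕜 U) {p : Fin 3 → ℝ} (hp : p ∈ U) :
    extZero f p = f.1 ⟨p, hp⟩ := extend_coe f.1 hp

theorem contDiffOn_extZero (f : SmoothFun 𝕜 U) : ContDiffOn ℝ ∞ (extZero f) U := f.2

theorem differentiableAt_extZero (f : SmoothFun 𝕜 U) {p : Fin 3 → ℝ} (hp : p ∈ U) :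
    DifferentiableAt ℝ (extZero f) p :=
  ((contDiffOn_extZero f).contDiffAt (U.isOpen.mem_nhds hp)).differentiableAt (by simp)

/-- The partial derivative in the `i`-th coordinate direction. -/
noncomputable def pderivFun (i : Fin 3) (f : SmoothFun 𝕜 U) : SmoothFun 𝕜 U :=
  ⟨fun p => fderiv ℝ (extZero f) p (Pi.single i 1), by
    have h := ((contDiffOn_extZero f).fderiv_of_isOpen (m := ∞) U.isOpen (by simp)).clm_apply
      (contDiffOn_const (c := (Pi.single i 1 : Fin 3 → ℝ)))
    exact h.congr fun p hp => extend_coe _ hp⟩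

theorem fderiv_extZero_congr (f : SmoothFun 𝕜 U) {g : (Fin 3 → ℝ) → 𝕜}
    (h : ∀ p ∈ U, extZero f p = g p) {p : Fin 3 → ℝ} (hp : p ∈ U) :
    fderiv ℝ (extZero f) p = fderiv ℝ g p :=
  Filter.EventuallyEq.fderiv_eq (Filter.eventually_of_mem (U.isOpen.mem_nhds hp) h)

variable (𝕜 U) in
/-- The partial derivatives, as derivations of the algebra of smooth functions. -/
noncomputable def pderiv (i : Fin 3) : Derivation 𝕜 (SmoothFun 𝕜 U) (SmoothFun 𝕜 U) :=
  Derivation.mk'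
    { toFun := pderivFun i
      map_add' := fun f g => by
        ext ⟨p, hp⟩
        have h := fderiv_extZero_congr (f + g) (g := extZero f + extZero g)
          (fun q hq => by simp [extZero_apply _ hq]) hp
        have h2 := fderiv_add (differentiableAt_extZero f hp) (differentiableAt_extZero g hp)
        simp [pderivFun, h, h2]
      map_smul' := fun c f => by
        ext ⟨p, hp⟩
        have h := fderiv_extZero_congr (c • f) (g := c • extZero f)
          (fun q hq => by simp [extZero_apply _ hq]) hp
        have h2 := fderiv_const_smul (differentiableAt_extZero f hp) c
        simp [pderivFun, h, h2] }
    (fun f g => by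
        ext ⟨p, hp⟩
        have h := fderiv_extZero_congr (f * g) (g := extZero f * extZero g)
          (fun q hq => by simp [extZero_apply _ hq]) hp
        have h2 := fderiv_mul (differentiableAt_extZero f hp) (differentiableAt_extZero g hp)
        simp [pderivFun, h, h2, extZero_apply _ hp])

/-- The operator `∂` of the ring of pseudodifferential operators differentiates in `x`. -/
noncomputable instance : Differential (SmoothFun 𝕜 U) :=
  ⟨(pderiv 𝕜 U 0).restrictScalars ℤ⟩

variable (𝕜 U) in
/-- The coordinate functions `x, y, t`. -/
noncomputable def coord (i : Fin 3) : SmoothFun 𝕜 U :=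
  ⟨fun p => ((p.1 i : ℝ) : 𝕜), by
    have h : ContDiffOn ℝ ∞ (fun p : Fin 3 → ℝ => ((p i : ℝ) : 𝕜)) U :=
      ((RCLike.ofRealCLM (K := 𝕜)).contDiff.comp (contDiff_apply ℝ ℝ i)).contDiffOn
    exact h.congr fun p hp => extend_coe _ hp⟩

end Functions


section KP

variable {𝕜 : Type*} [RCLike 𝕜]

/-- A solution on `U` of the `N`-th KP equation, in the variables `(x, y, t) = (t_1, t_2, t_N)`:
a dressing operator `K` subject to the flows `∂K/∂t_k = -(K ∂^k K⁻¹)_- K` of the KP hierarchy for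
`k = 2` and `k = N`, the other times being frozen. The KP function is `w = -2 K_1`. -/
structure IsKPSolution {U : TopologicalSpace.Opens (Fin 3 → ℝ)} (N : ℕ)
    (K : PDO (SmoothFun 𝕜 U)) : Prop where
  dressing : K.IsDressing
  flow_y : K.mapDeriv (pderiv 𝕜 U 1) = PDO.field (PDO.D 2) K
  flow_t : K.mapDeriv (pderiv 𝕜 U 2) = PDO.field (PDO.D N) K

/-- The times at the frozen point: `t_1 = x`, `t_2 = y`, `t_N = t`, all others zero. -/
noncomputable def frozenTimes (𝕜 : Type*) [RCLike 𝕜] (U : TopologicalSpace.Opens (Fin 3 → ℝ))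
    (N : ℕ) (k : ℕ) : SmoothFun 𝕜 U :=
  if k = 1 then coord 𝕜 U 0 else if k = 2 then coord 𝕜 U 1 else if k = N then coord 𝕜 U 2 else 0

/-- The operator `x̂ = x + t_0 ∂⁻¹ + 2 y ∂ + N t ∂ ^ (N - 1)` at the frozen times. -/
noncomputable def frozenXhat (U : TopologicalSpace.Opens (Fin 3 → ℝ)) (N : ℕ) (t₀ : 𝕜) :
    PDO (SmoothFun 𝕜 U) :=
  PDO.xhat N (algebraMap 𝕜 (SmoothFun 𝕜 U) t₀) (frozenTimes 𝕜 U N)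

/-- The flow `∂w/∂t_{mn}` of `w = -2 K_1` given by `V_{mn} K = -(K x̂ ^ n ∂ ^ m K⁻¹)_- K`,
at the frozen times. -/
noncomputable def pFlow {U : TopologicalSpace.Opens (Fin 3 → ℝ)} (N : ℕ) (t₀ : 𝕜) (m n : ℤ)
    (K : PDO (SmoothFun 𝕜 U)) : SmoothFun 𝕜 U :=
  PDO.wFlow ((frozenXhat U N t₀).zpow n * PDO.D m) K

/-- A vector field `vx ∂_x + vy ∂_y + vt ∂_t + p ∂_w` with coefficients depending on
`(x, y, t)` and `w`. -/
structure PointField (𝕜 : Type*) where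
  vx : (Fin 3 → ℝ) → 𝕜 → 𝕜
  vy : (Fin 3 → ℝ) → 𝕜 → 𝕜
  vt : (Fin 3 → ℝ) → 𝕜 → 𝕜
  p : (Fin 3 → ℝ) → 𝕜 → 𝕜

/-- The right-hand side `vx w_x + vy w_y + vt w_t - p` of the evolution `∂w/∂z` defined by a
point vector field, at a point `q`. -/
noncomputable def PointField.char {U : TopologicalSpace.Opens (Fin 3 → ℝ)} (V : PointField 𝕜)
    (w : SmoothFun 𝕜 U) (q : U) : 𝕜 :=
  V.vx q (w.1 q) * (pderiv 𝕜 U 0 w).1 q + V.vy q (w.1 q) * (pderiv 𝕜 U 1 w).1 q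
    + V.vt q (w.1 q) * (pderiv 𝕜 U 2 w).1 q - V.p q (w.1 q)

/-- Equality of the coefficients over a set of points `(x, y, t)`. -/
def PointField.AgreeOn (Ω : Set (Fin 3 → ℝ)) (V V' : PointField 𝕜) : Prop :=
  ∀ q ∈ Ω, ∀ w : 𝕜, V.vx q w = V'.vx q w ∧ V.vy q w = V'.vy q w ∧ V.vt q w = V'.vt q w ∧
    V.p q w = V'.p q w

/-- `V` is an infinitesimal point symmetry of the `N`-th KP equation over `Ω`: for every solution
`K`, with `w = -2 K_1`, the variation `∂w/∂z` defined by `V` is the variation of `-2 K_1` for some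
solution `Λ` of the equation linearized at `K`. So `w + ε ∂w/∂z` is again a solution to first
order in `ε`. -/
def IsPointSymmetry (N : ℕ) (Ω : Set (Fin 3 → ℝ)) (V : PointField 𝕜) : Prop :=
  ∀ U : TopologicalSpace.Opens (Fin 3 → ℝ), (U : Set (Fin 3 → ℝ)) ⊆ Ω →
    ∀ K : PDO (SmoothFun 𝕜 U), IsKPSolution N K →
      ∃ Λ : PDO (SmoothFun 𝕜 U), (∀ i, 0 ≤ i → Λ.coeff i = 0) ∧
        Λ.mapDeriv (pderiv 𝕜 U 1) = PDO.linField (PDO.D 2) K Λ ∧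
        Λ.mapDeriv (pderiv 𝕜 U 2) = PDO.linField (PDO.D N) K Λ ∧
        ∀ q : U, (PDO.wOf Λ).1 q = V.char (PDO.wOf K) q

/-- The point vector field `∑ α, V^N(α, h_α)` determined by functions `h_α` of `t` (only
`α = N, 2, 1, 0, -1` matter). With `f, g, h, k, l` for `h_N, h_2, h_1, h_0, h_{-1}` it is
`T(f) + Y(g) + X(h) + W(k) + U(l)`. -/
noncomputable def liePointField (N : ℕ) (t₀ : 𝕜) (hh : ℤ → ℝ → 𝕜) : PointField 𝕜 :=
  let f : ℕ → (Fin 3 → ℝ) → 𝕜 := fun j q => iteratedDeriv j (hh N) (q 2)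
  let g : ℕ → (Fin 3 → ℝ) → 𝕜 := fun j q => iteratedDeriv j (hh 2) (q 2)
  let h : ℕ → (Fin 3 → ℝ) → 𝕜 := fun j q => iteratedDeriv j (hh 1) (q 2)
  let k : ℕ → (Fin 3 → ℝ) → 𝕜 := fun j q => iteratedDeriv j (hh 0) (q 2)
  let l : ℕ → (Fin 3 → ℝ) → 𝕜 := fun j q => iteratedDeriv j (hh (-1)) (q 2)
  let x : (Fin 3 → ℝ) → 𝕜 := fun q => ((q 0 : ℝ) : 𝕜)
  let y : (Fin 3 → ℝ) → 𝕜 := fun q => ((q 1 : ℝ) : 𝕜)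
  { vx := fun q _ => 1 / N * x q * f 1 q + h 0 q +
      (if N = 3 then 2 / 9 * y q ^ 2 * f 2 q + 2 / 3 * y q * g 1 q else 0)
    vy := fun q _ => 2 / N * y q * f 1 q + g 0 q
    vt := fun q _ => f 0 q
    p := fun q w => -(1 / N * w * f 1 q + 2 * l 0 q +
      (if N = 3 then
        1 / 9 * (x q ^ 2 + 4 * y q * t₀) * f 2 q + 4 / 27 * x q * y q ^ 2 * f 3 q
          + 4 / 243 * y q ^ 4 * f 4 q
          + 2 / 3 * t₀ * g 1 q + 4 / 9 * x q * y q * g 2 q + 8 / 81 * y q ^ 3 * g 3 q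
          + 2 / 3 * x q * h 1 q + 4 / 9 * y q ^ 2 * h 2 q
          + 4 / 3 * y q * k 1 q
      else if N = 4 then
        1 / 4 * x q * y q * f 2 q + 1 / 2 * x q * g 1 q + y q * h 1 q
      else if N = 5 then
        4 / 25 * y q ^ 2 * f 2 q + 4 / 5 * y q * g 1 q
      else 0)) }

/-- Finite linear combinations of the powers `t ^ j`, `j ∈ I`. -/
def IsLaurent (I : Set ℤ) (φ : ℝ → 𝕜) : Prop :=
  ∃ c : ℤ →₀ 𝕜, (∀ j ∈ c.support, j ∈ I) ∧ ∀ t : ℝ, φ t = c.sum fun j a => a * (t : 𝕜) ^ j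

/-- The flows `∂w/∂t_{mn}` with `n ∈ I` and `m - n ≤ N (1 - n)`, taken at the frozen times,
reduce to the part of the Lie point symmetries of the `N`-th KP equation in which the functions
`h_α` are linear combinations of the powers `t ^ j`, `j ∈ I`.
Throughout `α = m - n + N n`, so that `m - n ≤ N (1 - n)` is `α ≤ N`. -/
structure ReducesToPointSymmetries (N : ℕ) (t₀ : 𝕜) (I : Set ℤ) (Ω : Set (Fin 3 → ℝ)) : Prop where
  /-- Unless `2 < α < N`, the flow is the point symmetry `V^N(α, (N t) ^ n)`, up to a term of the
  same kind with `α - N` in place of `α`. -/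
  flow_eq : ∀ m n : ℤ, n ∈ I → m - n ≤ N * (1 - n) → ¬ (2 < m - n + N * n ∧ m - n + N * n < N) →
    ∃ c : 𝕜, (n - 1 ∉ I → c = 0) ∧
      ∀ U : TopologicalSpace.Opens (Fin 3 → ℝ), (U : Set (Fin 3 → ℝ)) ⊆ Ω →
      ∀ K : PDO (SmoothFun 𝕜 U), IsKPSolution N K → ∀ q : U,
        (pFlow N t₀ m n K).1 q = (liePointField N t₀
          (Pi.single (m - n + N * n) (fun t : ℝ => (N * (t : 𝕜)) ^ n) +
            Pi.single (m - n + N * n - N) (fun t : ℝ => c * (t : 𝕜) ^ (n - 1)))).char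
          (PDO.wOf K) q
  /-- If `2 < α < N`, the flow is a point vector field plus `(N t) ^ n ∂w/∂t_α`, a derivative
  with respect to a frozen time. -/
  flow_eq_frozen : ∀ m n : ℤ, n ∈ I → 2 < m - n + N * n → m - n + N * n < N →
    ∃ V : PointField 𝕜,
      ∀ U : TopologicalSpace.Opens (Fin 3 → ℝ), (U : Set (Fin 3 → ℝ)) ⊆ Ω →
      ∀ K : PDO (SmoothFun 𝕜 U), IsKPSolution N K → ∀ q : U,
        (pFlow N t₀ m n K).1 q = (N * ((q.1 2 : ℝ) : 𝕜)) ^ n *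
          (PDO.wFlow (PDO.D (m - n + N * n)) K).1 q + V.char (PDO.wOf K) q
  /-- The point vector fields that are linear combinations of these flows are exactly the fields
  `∑ α, V^N(α, h_α)` with all `h_α` in the span of the `t ^ j`, `j ∈ I`. -/
  span_iff : ∀ V : PointField 𝕜,
    (∃ c : ℤ × ℤ →₀ 𝕜, (∀ a ∈ c.support, a.2 ∈ I ∧ a.1 - a.2 ≤ N * (1 - a.2)) ∧
      ∀ U : TopologicalSpace.Opens (Fin 3 → ℝ), (U : Set (Fin 3 → ℝ)) ⊆ Ω →
      ∀ K : PDO (SmoothFun 𝕜 U), IsKPSolution N K → ∀ q : U,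
        (c.sum fun a z => z * (pFlow N t₀ a.1 a.2 K).1 q) = V.char (PDO.wOf K) q) ↔
    ∃ hh : ℤ → ℝ → 𝕜, (∀ α, IsLaurent I (hh α)) ∧ V.AgreeOn Ω (liePointField N t₀ hh)
  /-- All these fields are point symmetries of the `N`-th KP equation. -/
  symmetry : ∀ hh : ℤ → ℝ → 𝕜, (∀ α, IsLaurent I (hh α)) →
    IsPointSymmetry N Ω (liePointField N t₀ hh)

end KP

/-!
# Reduction of the additional symmetries of KP to Lie point symmetries

The variation of `w = -2 K_1` along `V_A K = -(K A K⁻¹)_- K` is twice the residue of `K A K⁻¹`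
(`PDO.wFlow_eq_residue`). Hence it is additive in `A`, it only sees the terms of `A` of order at
least `-1`, and it is explicit on monomials: `a ∂ ^ i` contributes `a ∂w/∂t_i` if `a` does not
depend on `x`, and for arbitrary `a` it contributes `(a w)_x` if `i = 1`, nothing if `i = 0`, and
`2 a` if `i = -1`. The flow `∂w/∂t_{mn}` is therefore read off from the leading terms of
`x̂ ^ n ∂ ^ m`, which has order `α = m - n + N n ≤ N`: one needs `x̂ ^ n` down to `N + 1` orders
below its top. These terms are given by closed formulas (`PDO.xpow`, `PDO.xpowThree`) in the functions
`(n choose k) (N t) ^ (n - k)`; Pascal's rule shows that they satisfy the recursion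
`x̂ x̂ ^ n = x̂ ^ (n + 1)` to the required precision, which proves them for all integers `n`,
upwards and downwards from `n = 0` (`PDO.zpow_sub_mem`). Since `(n choose k) (N t) ^ (n - k)` is, up to the
factor `N ^ k k!`, the `k`-th derivative of `(N t) ^ n`, the result is the evolution of
`V^N(α, (N t) ^ n)`, except that for `N = 3` the commutator `[∂, x] = 1` leaves a
secondary term, and that for `2 < α < N` the leading term is a derivative with respect to a frozen
time (`exists_flow_eq`, `exists_pointField_frozen`).

A point field is determined by its evolutions, and derivatives with respect to frozen times cannot
cancel, because there are solutions for which `w` and the derivatives `∂w/∂t_k`, `1 ≤ k ≤ N`, have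
arbitrary values at a point (`exists_solution`). They are the dressing operators
`(∂ - φ'/φ) ∂⁻¹ (1 + c ∂⁻¹)`, where `φ` is a combination of exponentials
`exp (a x + a ^ 2 y + a ^ N t)`. With the linear independence of the powers of `t` this shows that
the point fields among the combinations of flows lie in the `I`-part. Conversely every
`V^N(α, t ^ j)` is a combination of flows, because the secondary term of its flow is itself a field
`V^N(β, t ^ (j - 1))` whose flow has no secondary term (`isFlowCombination_liePointField`).

Finally `x̂` satisfies the Lax equations `∂x̂/∂t_k = [∂ ^ k, x̂]`, so the fields `V_{mn}` commute
with the flows of the hierarchy, that is, `V_{mn} K` solves the linearized equations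
(`PDO.mapDeriv_field`, `exists_isLinSolution`).
-/

open scoped Differential

/-! ### The order filtration and products of monomials -/

namespace PDO

section Order

variable {R : Type*} [CommRing R]

theorem coeff_sum {ι : Type*} (s : Finset ι) (f : ι → PDO R) (i : ℤ) :
    (∑ j ∈ s, f j).coeff i = ∑ j ∈ s, (f j).coeff i :=
  map_sum (⟨⟨fun P : PDO R => P.coeff i, rfl⟩, fun _ _ => rfl⟩ : PDO R →+ R) f s

variable (R) in
/-- The operators of order at most `M`. -/
def orderLE (M : ℤ) : Set (PDO R) := {P | ∀ i, M < i → P.coeff i = 0}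

theorem zero_mem_orderLE {M : ℤ} : (0 : PDO R) ∈ orderLE R M := fun _ _ => rfl

theorem add_mem_orderLE {P Q : PDO R} {M : ℤ} (hP : P ∈ orderLE R M) (hQ : Q ∈ orderLE R M) :
    P + Q ∈ orderLE R M := fun i hi => by rw [coeff_add, hP i hi, hQ i hi, add_zero]

theorem sub_mem_orderLE {P Q : PDO R} {M : ℤ} (hP : P ∈ orderLE R M) (hQ : Q ∈ orderLE R M) :
    P - Q ∈ orderLE R M := fun i hi => by rw [coeff_sub, hP i hi, hQ i hi, sub_zero]

theorem neg_mem_orderLE {P : PDO R} {M : ℤ} (hP : P ∈ orderLE R M) :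
    -P ∈ orderLE R M := fun i hi => by rw [coeff_neg, hP i hi, neg_zero]

theorem orderLE_mono {M M' : ℤ} (h : M ≤ M') {P : PDO R} (hP : P ∈ orderLE R M) :
    P ∈ orderLE R M' := fun i hi => hP i (by omega)

theorem single_mem_orderLE {i M : ℤ} (h : i ≤ M) (a : R) : single i a ∈ orderLE R M :=
  fun j hj => by rw [coeff_single, if_neg (by omega)]

theorem mem_orderLE_pred {P : PDO R} {M : ℤ} (hP : P ∈ orderLE R M) (h : P.coeff M = 0) :
    P ∈ orderLE R (M - 1) := fun i hi => by
  obtain rfl | hi' : i = M ∨ M < i := by omega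
  · exact h
  · exact hP i hi'

/-- An operator is determined by its coefficients modulo all orders. -/
theorem eq_of_sub_mem_orderLE {P Q : PDO R} (h : ∀ n : ℕ, P - Q ∈ orderLE R (-n)) : P = Q := by
  ext i
  have := h (i.natAbs + 1) i (by omega)
  exact sub_eq_zero.mp this

@[simp] theorem single_zero (i : ℤ) : single i (0 : R) = 0 := by
  ext j; simp [coeff_single]

theorem single_add (i : ℤ) (a b : R) : single i (a + b) = single i a + single i b := by
  ext j; simp only [coeff_add, coeff_single]; split_ifs <;> simp

theorem single_neg (i : ℤ) (a : R) : single i (-a) = -single i a := by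
  ext j; simp only [coeff_neg, coeff_single]; split_ifs <;> simp

theorem coeff_minus (P : PDO R) (i : ℤ) : (minus P).coeff i = if i < 0 then P.coeff i else 0 := rfl

theorem minus_add (P Q : PDO R) : minus (P + Q) = minus P + minus Q := by
  ext i; simp only [coeff_minus, coeff_add]; split_ifs <;> simp

variable [Differential R]

theorem mul_mem_orderLE {P Q : PDO R} {p q r : ℤ} (hP : P ∈ orderLE R p) (hQ : Q ∈ orderLE R q)
    (h : p + q ≤ r) : P * Q ∈ orderLE R r := fun _ hi => mul_coeff_lt hP hQ (by omega)

theorem coeff_mul_top {P Q : PDO R} {p q : ℤ} (hP : P ∈ orderLE R p) (hQ : Q ∈ orderLE R q) :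
    (P * Q).coeff (p + q) = P.coeff p * Q.coeff q := by
  simpa using mul_coeff_eq hP hQ 0

theorem coeff_mul_top_pred {P Q : PDO R} {p q : ℤ} (hP : P ∈ orderLE R p) (hQ : Q ∈ orderLE R q) :
    (P * Q).coeff (p + q - 1) = P.coeff p * Q.coeff (q - 1) + p • (P.coeff p * (Q.coeff q)′)
      + P.coeff (p - 1) * Q.coeff q := by
  have := mul_coeff_eq hP hQ 1
  simp only [Nat.cast_one] at this
  rw [this, show Finset.HasAntidiagonal.antidiagonal 1 = {((0 : ℕ), 1), (1, 0)} from rfl]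
  simp [show Finset.HasAntidiagonal.antidiagonal 1 = {((0 : ℕ), 1), (1, 0)} from rfl]
  ring

theorem one_mem_orderLE : (1 : PDO R) ∈ orderLE R 0 := single_mem_orderLE le_rfl 1

theorem coeff_single_mul_single (i j : ℤ) (a b : R) (p : ℤ) :
    (single i a * single j b).coeff p = if p ≤ i + j then
      Ring.choose i (i + j - p).toNat •
        (a * (Differential.deriv (R := R))^[(i + j - p).toNat] b) else 0 := by
  split_ifs with h
  · rw [coeff_mul, finsum_eq_single _ (i, (i + j - p).toNat)]
    · simp only [coeff_single]
      rw [if_pos trivial, if_pos (by omega)]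
    · rintro ⟨i', k⟩ hne
      simp only [coeff_single]
      by_cases hi : i' = i
      · subst hi
        have hk : ¬ p - i' + k = j := fun hk => hne (by simp; omega)
        rw [if_pos rfl, if_neg hk, iter_zero]; simp
      · rw [if_neg hi]; simp
  · exact mul_mem_orderLE (single_mem_orderLE le_rfl a) (single_mem_orderLE le_rfl b) le_rfl p
      (not_le.mp h)

theorem iter_eq_zero {b : R} {k l : ℕ} (hb : (Differential.deriv (R := R))^[k] b = 0) (h : k ≤ l) :
    (Differential.deriv (R := R))^[l] b = 0 := by
  obtain ⟨d, rfl⟩ := Nat.exists_eq_add_of_le h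
  rw [add_comm, Function.iterate_add_apply, hb, iter_zero]

/-- The Leibniz rule for a coefficient that is linear in the variable. -/
theorem single_mul_single_of_linear (i j : ℤ) (a : R) {b : R} (hb : b′′ = 0) :
    single i a * single j b = single (i + j) (a * b) + single (i + j - 1) (i * (a * b′)) := by
  ext p
  rw [coeff_single_mul_single, coeff_add, coeff_single, coeff_single]
  split_ifs with h1 h2 h3 h3
  · omega
  · subst h2; simp
  · subst h3; simp
  · rw [iter_eq_zero (k := 2) hb (by omega)]; simp
  all_goals first | omega | simp

theorem single_mul_single_of_const (i j : ℤ) (a : R) {b : R} (hb : b′ = 0) :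
    single i a * single j b = single (i + j) (a * b) := by
  rw [single_mul_single_of_linear i j a (by rw [hb, map_zero]), hb]; simp

theorem single_zero_mul_single (j : ℤ) (a b : R) :
    single 0 a * single j b = single j (a * b) := by
  ext p
  rw [coeff_single_mul_single, coeff_single]
  split_ifs with h1 h2 h3
  · subst h2; simp
  · obtain ⟨k, hk⟩ : ∃ k : ℕ, (0 + j - p).toNat = k + 1 := ⟨(j - p).toNat - 1, by omega⟩
    rw [hk, Ring.choose_zero_succ]; simp
  · omega
  · rfl

theorem single_mul_single_sub_mem (i j : ℤ) (a b : R) :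
    single i a * single j b - single (i + j) (a * b) ∈ orderLE R (i + j - 1) := by
  apply mem_orderLE_pred
  · exact sub_mem_orderLE (mul_mem_orderLE (single_mem_orderLE le_rfl a) (single_mem_orderLE le_rfl b)
      le_rfl) (single_mem_orderLE le_rfl _)
  · rw [coeff_sub, coeff_single_mul_single]; simp [coeff_single]

theorem one_eq_single : (1 : PDO R) = single 0 1 := rfl

@[simp] theorem D_zero : (D 0 : PDO R) = 1 := rfl

theorem single_mul_D (i m : ℤ) (a : R) : single i a * D m = single (i + m) a := by
  rw [D, single_mul_single_of_const _ _ _ (by simp), mul_one]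

theorem single_eq_mul_D (i : ℤ) (a : R) : single i a = single 0 a * D i := by
  rw [single_mul_D, zero_add]

theorem D_mul_D (i j : ℤ) : (D i * D j : PDO R) = D (i + j) := single_mul_D i j 1

theorem D_mem_orderLE (i : ℤ) : (D i : PDO R) ∈ orderLE R i := single_mem_orderLE le_rfl 1

theorem coeff_single_zero_mul (a : R) (P : PDO R) (p : ℤ) :
    (single 0 a * P).coeff p = a * P.coeff p := by
  rw [coeff_mul, finsum_eq_single _ ((0 : ℤ), 0)]
  · simp [coeff_single]
  · rintro ⟨i, k⟩ h
    by_cases hi : i = 0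
    · subst hi
      cases k with
      | zero => exact absurd rfl h
      | succ k => simp [Ring.choose_zero_succ]
    · simp [coeff_single, hi]

theorem coeff_mul_D (P : PDO R) (m p : ℤ) : (P * D m).coeff p = P.coeff (p - m) := by
  rw [coeff_mul, finsum_eq_single _ (p - m, 0)]
  · simp [D, coeff_single]
  · rintro ⟨i, k⟩ h
    simp only [D, coeff_single]
    cases k with
    | zero =>
      have : ¬ p - i + (0 : ℕ) = m := fun e => h (by simp at e ⊢; omega)
      rw [if_neg this]; simp
    | succ k =>
      split_ifs
      · rw [iter_one]; simp
      · rw [iter_zero]; simp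

/-- A function with zero derivative commutes with every operator. -/
theorem commute_single_zero {a : R} (ha : a′ = 0) (P : PDO R) : Commute (single 0 a) P := by
  ext p
  rw [coeff_single_zero_mul, coeff_mul, finsum_eq_single _ (p, 0)]
  · simp [coeff_single, mul_comm]
  · rintro ⟨i, k⟩ h
    simp only [coeff_single]
    cases k with
    | zero =>
      have : ¬ p - i + (0 : ℕ) = 0 := fun e => h (by simp at e ⊢; omega)
      rw [if_neg this]; simp
    | succ k =>
      split_ifs
      · rw [iter_eq_zero (k := 1) ha (by omega)]; simp
      · rw [iter_zero]; simp

/-- The commutator of an operator with a function drops the order by one, with leading coefficient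
given by the Leibniz rule. -/
theorem commutator_function_mem {P : PDO R} {M : ℤ} (hP : P ∈ orderLE R M) (a : R) :
    P * single 0 a - single 0 a * P ∈ orderLE R (M - 1) ∧
      (P * single 0 a - single 0 a * P).coeff (M - 1) = M * (P.coeff M * a′) := by
  have h0 : single 0 a ∈ orderLE R 0 := single_mem_orderLE le_rfl a
  refine ⟨mem_orderLE_pred (sub_mem_orderLE (mul_mem_orderLE hP h0 (by omega))
    (mul_mem_orderLE h0 hP (by omega))) ?_, ?_⟩
  · have := coeff_mul_top hP h0
    rw [add_zero] at this
    rw [coeff_sub, this, coeff_single_zero_mul, coeff_single, if_pos rfl]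
    ring
  · have := coeff_mul_top_pred hP h0
    rw [add_zero] at this
    rw [coeff_sub, this, coeff_single_zero_mul, coeff_single, coeff_single, if_pos rfl,
      if_neg (by omega)]
    rw [zsmul_eq_mul]; ring

/-! ### Inverses -/

theorem pow_mem_orderLE {L : PDO R} (hL : L ∈ orderLE R (-1)) (k : ℕ) :
    L ^ k ∈ orderLE R (-k) := by
  induction k with
  | zero => simpa using one_mem_orderLE
  | succ k ih => rw [pow_succ]; exact mul_mem_orderLE ih hL (by push_cast; omega)

/-- The geometric series: `1 - L` is invertible if `L` has negative order. -/
theorem exists_inverse_one_sub {L : PDO R} (hL : L ∈ orderLE R (-1)) :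
    ∃ G : PDO R, G ∈ orderLE R 0 ∧ G.coeff 0 = 1 ∧ (1 - L) * G = 1 ∧ G * (1 - L) = 1 := by
  have hvan : ∀ (k : ℕ) (i : ℤ), 0 < i + k → (L ^ k).coeff i = 0 := fun k i h =>
    pow_mem_orderLE hL k i (by omega)
  let G : PDO R := ⟨fun i => ∑ k ∈ Finset.range ((-i).toNat + 1), (L ^ k).coeff i, 0,
    fun i hi => Finset.sum_eq_zero fun k _ => hvan k i (by omega)⟩
  have hGc : ∀ i, G.coeff i = ∑ k ∈ Finset.range ((-i).toNat + 1), (L ^ k).coeff i := fun _ => rfl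
  have hG : ∀ n : ℕ, G - ∑ k ∈ Finset.range n, L ^ k ∈ orderLE R (-n) := by
    intro n i hi
    rw [coeff_sub, coeff_sum, hGc, sub_eq_zero]
    rcases le_total n ((-i).toNat + 1) with h | h
    · refine (Finset.sum_subset (by simpa using h) fun k hk hk' => hvan k i ?_).symm
      simp only [Finset.mem_range] at hk hk'
      omega
    · refine Finset.sum_subset (by simpa using h) fun k hk hk' => hvan k i ?_
      simp only [Finset.mem_range] at hk hk'
      omega
  have h1 : (1 - L : PDO R) ∈ orderLE R 0 := sub_mem_orderLE one_mem_orderLE (orderLE_mono (by omega) hL)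
  refine ⟨G, fun i hi => (hGc i).trans (Finset.sum_eq_zero fun k _ => hvan k i (by omega)),
    ?_, ?_, ?_⟩
  · rw [hGc]; simp [coeff_one]
  · refine eq_of_sub_mem_orderLE fun n => ?_
    have e : (1 - L) * G - 1 = (1 - L) * (G - ∑ k ∈ Finset.range n, L ^ k) - L ^ n := by
      have := mul_neg_geom_sum L n
      rw [mul_sub, this]; abel
    rw [e]
    exact sub_mem_orderLE (mul_mem_orderLE h1 (hG n) (by omega)) (pow_mem_orderLE hL n)
  · refine eq_of_sub_mem_orderLE fun n => ?_
    have e : G * (1 - L) - 1 = (G - ∑ k ∈ Finset.range n, L ^ k) * (1 - L) - L ^ n := by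
      have := geom_sum_mul_neg L n
      rw [sub_mul _ _ (1 - L), this]; abel
    rw [e]
    exact sub_mem_orderLE (mul_mem_orderLE (hG n) h1 (by omega)) (pow_mem_orderLE hL n)

theorem inverse_eq {P Q : PDO R} (h : P * Q = 1) (h' : Q * P = 1) :
    IsUnit P ∧ Ring.inverse P = Q :=
  ⟨⟨⟨P, Q, h, h'⟩, rfl⟩, Ring.inverse_unit (⟨P, Q, h, h'⟩ : (PDO R)ˣ)⟩

theorem IsDressing.sub_mem {K : PDO R} (hK : K.IsDressing) : 1 - K ∈ orderLE R (-1) := by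
  intro i hi
  rw [coeff_sub, coeff_one]
  split_ifs with h
  · rw [h, hK.1, sub_self]
  · rw [hK.2 i (by omega), sub_zero]

theorem IsDressing.mem {K : PDO R} (hK : K.IsDressing) : K ∈ orderLE R 0 := hK.2

theorem IsDressing.inverse {K : PDO R} (hK : K.IsDressing) :
    IsUnit K ∧ Ring.inverse K ∈ orderLE R 0 ∧ (Ring.inverse K).coeff 0 = 1 := by
  obtain ⟨G, hG, hG0, h1, h2⟩ := exists_inverse_one_sub hK.sub_mem
  rw [sub_sub_cancel] at h1 h2
  obtain ⟨hu, he⟩ := inverse_eq h1 h2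
  exact ⟨hu, he ▸ hG, he ▸ hG0⟩

theorem IsDressing.mul_inverse {K : PDO R} (hK : K.IsDressing) : K * Ring.inverse K = 1 :=
  Ring.mul_inverse_cancel K hK.inverse.1

theorem IsDressing.inverse_mul {K : PDO R} (hK : K.IsDressing) : Ring.inverse K * K = 1 :=
  Ring.inverse_mul_cancel K hK.inverse.1

end Order

end PDO

namespace PDO

section Flow

variable {R : Type*} [CommRing R] [Differential R]

/-! ### The flow of `w` as a residue -/

theorem minus_mem_orderLE (P : PDO R) : minus P ∈ orderLE R (-1) :=
  fun i hi => by rw [coeff_minus, if_neg (by omega)]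

/-- The variation of `w` is twice the residue (the coefficient of `∂ ^ (-1)`) of `K A K⁻¹`. -/
theorem wFlow_eq_residue {K : PDO R} (hK : K.IsDressing) (A : PDO R) :
    wFlow A K = 2 * (K * A * Ring.inverse K).coeff (-1) := by
  have h := coeff_mul_top (minus_mem_orderLE (K * A * Ring.inverse K)) hK.mem
  rw [add_zero, hK.1, coeff_minus, if_pos (by omega)] at h
  have e : field A K = -(minus (K * A * Ring.inverse K) * K) := neg_mul _ _
  rw [wFlow, wOf, e, coeff_neg, h]
  ring

theorem wFlow_add {K : PDO R} (hK : K.IsDressing) (A B : PDO R) :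
    wFlow (A + B) K = wFlow A K + wFlow B K := by
  simp only [wFlow_eq_residue hK, mul_add, add_mul, coeff_add]

theorem wFlow_eq_zero {K : PDO R} (hK : K.IsDressing) {A : PDO R} (hA : A ∈ orderLE R (-2)) :
    wFlow A K = 0 := by
  rw [wFlow_eq_residue hK, mul_mem_orderLE (mul_mem_orderLE hK.mem hA le_rfl) hK.inverse.2.1 le_rfl
    _ (by omega), mul_zero]

/-- Only the coefficients down to `∂ ^ (-1)` contribute to the variation of `w`. -/
theorem wFlow_congr {K : PDO R} (hK : K.IsDressing) {A B : PDO R} (h : A - B ∈ orderLE R (-2)) :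
    wFlow A K = wFlow B K := by
  have := wFlow_add hK (A - B) B
  rwa [sub_add_cancel, wFlow_eq_zero hK h, zero_add] at this

theorem wFlow_single_of_const {K : PDO R} (hK : K.IsDressing) (i : ℤ) {a : R} (ha : a′ = 0) :
    wFlow (single i a) K = a * wFlow (D i) K := by
  rw [wFlow_eq_residue hK, wFlow_eq_residue hK, single_eq_mul_D, ← mul_assoc,
    ← (commute_single_zero ha K).eq, mul_assoc (single 0 a), mul_assoc (single 0 a),
    coeff_single_zero_mul]
  ring

/-- Functions do not contribute to the flow of `w`: `K a K⁻¹` differs from `a` by an operator of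
order `-2`, since `K` is `1` up to terms of order `-1`. -/
theorem wFlow_single_zero {K : PDO R} (hK : K.IsDressing) (a : R) : wFlow (single 0 a) K = 0 := by
  obtain ⟨hE, -⟩ := commutator_function_mem hK.mem a
  obtain ⟨hE1, hE2⟩ := commutator_function_mem hK.sub_mem a
  have e : K * single 0 a * Ring.inverse K = single 0 a -
      ((1 - K) * single 0 a - single 0 a * (1 - K)) * Ring.inverse K := by
    have : ((1 - K) * single 0 a - single 0 a * (1 - K)) =
        single 0 a * K - K * single 0 a := by noncomm_ring
    rw [this, sub_mul, mul_assoc (single 0 a), hK.mul_inverse]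
    noncomm_ring
  rw [wFlow_eq_residue hK, e, coeff_sub,
    mul_mem_orderLE hE1 hK.inverse.2.1 le_rfl _ (by omega), coeff_single, if_neg (by omega)]
  simp

theorem wFlow_single_neg_one {K : PDO R} (hK : K.IsDressing) (a : R) :
    wFlow (single (-1) a) K = 2 * a := by
  have h1 := coeff_mul_top hK.mem (single_mem_orderLE (le_refl (-1)) a)
  have h2 := coeff_mul_top (mul_mem_orderLE hK.mem (single_mem_orderLE (le_refl (-1)) a) le_rfl)
    hK.inverse.2.1
  simp only [zero_add, add_zero] at h1 h2
  rw [wFlow_eq_residue hK, h2, h1, hK.inverse.2.2, hK.1, coeff_single, if_pos rfl]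
  ring

theorem mapDeriv_mem_orderLE {A : Type*} [CommRing A] [Algebra A R] (δ : Derivation A R R)
    {P : PDO R} {M : ℤ} (hP : P ∈ orderLE R M) : P.mapDeriv δ ∈ orderLE R M :=
  fun i hi => (congrArg δ (hP i hi)).trans (map_zero δ)

theorem coeff_mapDeriv {A : Type*} [CommRing A] [Algebra A R] (δ : Derivation A R R)
    (P : PDO R) (i : ℤ) : (P.mapDeriv δ).coeff i = δ (P.coeff i) := rfl

theorem D_one_mul (P : PDO R) : D 1 * P = P * D 1 + P.mapDeriv Differential.deriv := by
  ext p
  rw [coeff_add, coeff_mul_D, coeff_mapDeriv, coeff_mul,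
    finsum_eq_sum_of_support_subset (s := {((1 : ℤ), 0), ((1 : ℤ), 1)})]
  · simp [D, coeff_single]
  · rintro ⟨i, k⟩ h
    rw [Function.mem_support] at h
    by_cases hi : i = 1
    · subst hi
      have hk : k ≤ 1 := by
        by_contra hk
        refine h ?_
        rw [show (1 : ℤ) = ((1 : ℕ) : ℤ) from rfl, Ring.choose_natCast,
          Nat.choose_eq_zero_of_lt (by omega)]
        simp
      interval_cases k <;> simp
    · exact absurd (by simp [D, coeff_single, hi]) h

theorem IsDressing.mapDeriv_mem {A : Type*} [CommRing A] [Algebra A R] (δ : Derivation A R R)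
    {K : PDO R} (hK : K.IsDressing) : K.mapDeriv δ ∈ orderLE R (-1) := by
  refine mem_orderLE_pred (M := 0) (mapDeriv_mem_orderLE δ hK.mem) ?_
  rw [coeff_mapDeriv, hK.1, Derivation.map_one_eq_zero]

/-- The flow of `w` given by the vector field `a ∂` of the line, acting on `w` as a density:
`K a ∂ K⁻¹ = a ∂ - a K' K⁻¹ - [1 - K, a] ∂ K⁻¹`. -/
theorem wFlow_single_one {K : PDO R} (hK : K.IsDressing) (a : R) :
    wFlow (single 1 a) K = a * (wOf K)′ + a′ * wOf K := by
  obtain ⟨hE1, hE2⟩ := commutator_function_mem hK.sub_mem a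
  set E := (1 - K) * single 0 a - single 0 a * (1 - K) with hE
  have hED : E * D 1 ∈ orderLE R (-1) := mul_mem_orderLE hE1 (D_mem_orderLE 1) (by omega)
  have e : K * single 1 a * Ring.inverse K = single 1 a -
      single 0 a * (K.mapDeriv Differential.deriv * Ring.inverse K) -
        E * D 1 * Ring.inverse K := by
    have h1 : K * single 1 a = single 0 a * (K * D 1) - E * D 1 := by
      rw [single_eq_mul_D 1 a, hE]; noncomm_ring
    have h2 : K * D 1 = D 1 * K - K.mapDeriv Differential.deriv := by
      rw [D_one_mul]; abel
    rw [h1, h2, sub_mul, mul_assoc (single 0 a), sub_mul, mul_assoc (D 1), hK.mul_inverse,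
      mul_one, mul_sub, ← single_eq_mul_D]
  have c1 := coeff_mul_top (hK.mapDeriv_mem Differential.deriv) hK.inverse.2.1
  have c2 := coeff_mul_top hED hK.inverse.2.1
  have c3 : (E * D 1).coeff (-1) = a′ * K.coeff (-1) := by
    rw [coeff_mul_D, show (-1 : ℤ) - 1 = -1 - 1 from rfl, hE2, coeff_sub, coeff_one,
      if_neg (by omega)]
    push_cast; ring
  rw [add_zero] at c1 c2
  rw [wFlow_eq_residue hK, e, coeff_sub, coeff_sub, coeff_single_zero_mul, c1, c2, c3,
    hK.inverse.2.2, coeff_single, if_neg (by omega), coeff_mapDeriv, wOf, Derivation.leibniz]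
  have : ((-2 : R))′ = 0 := by
    rw [show (-2 : R) = ((-2 : ℤ) : R) by push_cast; ring]; exact Derivation.map_intCast _ _
  rw [this]; simp only [smul_eq_mul]
  ring

/-! ### Derivations of the ring of operators -/

variable {S : Type*} [CommRing S] [Algebra S R] {δ : Derivation S R R}

theorem mapDeriv_add (P Q : PDO R) : (P + Q).mapDeriv δ = P.mapDeriv δ + Q.mapDeriv δ := by
  ext i; simp [coeff_mapDeriv]

theorem mapDeriv_neg (P : PDO R) : (-P).mapDeriv δ = -P.mapDeriv δ := by
  ext i; simp [coeff_mapDeriv]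

theorem mapDeriv_minus (P : PDO R) : (minus P).mapDeriv δ = minus (P.mapDeriv δ) := by
  ext i; simp only [coeff_mapDeriv, coeff_minus]; split_ifs <;> simp

theorem mapDeriv_single (i : ℤ) (a : R) : (single i a).mapDeriv δ = single i (δ a) := by
  ext j; simp only [coeff_mapDeriv, coeff_single]; split_ifs <;> simp

theorem mapDeriv_D (i : ℤ) : (D i : PDO R).mapDeriv δ = 0 := by
  rw [D, mapDeriv_single, Derivation.map_one_eq_zero, single_zero]

theorem mapDeriv_one : (1 : PDO R).mapDeriv δ = 0 := mapDeriv_D 0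

/-- A derivation of the coefficients that commutes with `∂` acts as a derivation on operators. -/
theorem mapDeriv_mul (hδ : ∀ a : R, δ a′ = (δ a)′) (P Q : PDO R) :
    (P * Q).mapDeriv δ = P.mapDeriv δ * Q + P * Q.mapDeriv δ := by
  have hit : ∀ (k : ℕ) (a : R), δ ((Differential.deriv (R := R))^[k] a) =
      (Differential.deriv (R := R))^[k] (δ a) := by
    intro k
    induction k with
    | zero => exact fun a => rfl
    | succ k ih => intro a; rw [Function.iterate_succ_apply, ih, hδ, Function.iterate_succ_apply]
  obtain ⟨A, hA⟩ := P.exists_bound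
  obtain ⟨B, hB⟩ := Q.exists_bound
  have hA' : ∀ i, A < i → (P.mapDeriv δ).coeff i = 0 := mapDeriv_mem_orderLE δ hA
  have hB' : ∀ i, B < i → (Q.mapDeriv δ).coeff i = 0 := mapDeriv_mem_orderLE δ hB
  ext p
  rw [coeff_mapDeriv, coeff_add]
  rcases lt_or_ge (A + B) p with h | h
  · rw [mul_coeff_lt hA hB h, mul_coeff_lt hA' hB h, mul_coeff_lt hA hB' h, map_zero, add_zero]
  · obtain ⟨n, hn⟩ := Int.le.dest h
    obtain rfl : p = A + B - n := by omega
    rw [mul_coeff_eq hA hB, mul_coeff_eq hA' hB, mul_coeff_eq hA hB']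
    simp only [map_sum, map_zsmul, Derivation.leibniz, hit, coeff_mapDeriv, smul_eq_mul, smul_add,
      ← Finset.sum_add_distrib]
    refine Finset.sum_congr rfl fun x _ => Finset.sum_congr rfl fun y _ => ?_
    rw [add_comm, mul_comm (δ _)]

theorem mapDeriv_inverse (hδ : ∀ a : R, δ a′ = (δ a)′) {P Q : PDO R} (h : P * Q = 1)
    (h' : Q * P = 1) : Q.mapDeriv δ = -(Q * P.mapDeriv δ * Q) := by
  have e := mapDeriv_mul hδ P Q
  rw [h, mapDeriv_one] at e
  have : Q * (P.mapDeriv δ * Q + P * Q.mapDeriv δ) = 0 := by rw [← e, mul_zero]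
  rw [mul_add, ← mul_assoc Q P, h', one_mul, ← mul_assoc] at this
  exact eq_neg_of_add_eq_zero_right this

/-! ### Differential operators and integral operators -/

theorem minus_neg (P : PDO R) : minus (-P) = -minus P := by
  ext i; simp only [coeff_minus, coeff_neg]; split_ifs <;> simp

theorem minus_sub (P Q : PDO R) : minus (P - Q) = minus P - minus Q := by
  rw [sub_eq_add_neg, minus_add, minus_neg, sub_eq_add_neg]

theorem minus_eq_self {P : PDO R} (hP : P ∈ orderLE R (-1)) : minus P = P := by
  ext i; rw [coeff_minus]; split_ifs with h
  · rfl
  · exact (hP i (by omega)).symm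

/-- The product of two differential operators is a differential operator. -/
theorem minus_mul_eq_zero {P Q : PDO R} (hP : minus P = 0) (hQ : minus Q = 0) :
    minus (P * Q) = 0 := by
  have key : ∀ {P : PDO R}, minus P = 0 → ∀ i < 0, P.coeff i = 0 := fun {P} h i hi => by
    have := congrArg (fun P => coeff P i) h
    simpa [coeff_minus, hi] using this
  ext p
  rw [coeff_minus]
  split_ifs with hp
  · rw [coeff_mul]
    refine finsum_eq_zero_of_forall_eq_zero ?_
    rintro ⟨i, k⟩
    simp only
    rcases lt_or_ge i 0 with hi | hi
    · rw [key hP i hi]; simp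
    rcases lt_or_ge (p - i + k) 0 with hj | hj
    · rw [key hQ _ hj, iter_zero]; simp
    lift i to ℕ using hi
    rw [Ring.choose_natCast, Nat.choose_eq_zero_of_lt (by omega)]
    simp
  · rfl

theorem minus_sub_minus (P : PDO R) : minus (P - minus P) = 0 := by
  rw [minus_sub, minus_eq_self (minus_mem_orderLE P), sub_self]

theorem minus_single_of_nonneg {i : ℤ} (hi : 0 ≤ i) (a : R) : minus (single i a) = 0 := by
  ext j; rw [coeff_minus, coeff_single]; split_ifs <;> first | omega | rfl

/-! ### Commuting flows solve the linearized equation -/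

/-- If `A` evolves by `δ A = [E, A]`, then `K A K⁻¹` evolves by a Lax equation along the flow
`δ K = -(K E K⁻¹)_- K`, and the vector field `V_A K` solves the equation linearized at `K`. -/
theorem mapDeriv_field (hδ : ∀ a : R, δ a′ = (δ a)′) {K A E : PDO R} (hK : K.IsDressing)
    (hA : A.mapDeriv δ = E * A - A * E) (hKE : K.mapDeriv δ = field E K) :
    (field A K).mapDeriv δ = linField E K (field A K) := by
  have hKJ := hK.mul_inverse
  have hJK := hK.inverse_mul
  have hJ := mapDeriv_inverse hδ hKJ hJK
  unfold field linField at *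
  generalize Ring.inverse K = J at *
  generalize hB : K * A * J = B at *
  generalize hL : K * E * J = L at *
  have hδB : B.mapDeriv δ = (L - minus L) * B - B * (L - minus L) := by
    have e0 : B.mapDeriv δ = (K * A * J).mapDeriv δ := by rw [hB]
    rw [e0, mapDeriv_mul hδ, mapDeriv_mul hδ, hJ, hKE, hA]
    have e1 : K * (E * A - A * E) * J = L * B - B * L := by
      have e2 : L * B = K * E * (J * K) * A * J := by rw [← hL, ← hB]; noncomm_ring
      have e3 : B * L = K * A * (J * K) * E * J := by rw [← hL, ← hB]; noncomm_ring
      rw [e2, e3, hJK]; noncomm_ring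
    have e4 : K * A * -(J * (-minus L * K) * J) = B * minus L := by
      have : K * A * -(J * (-minus L * K) * J) = (K * A * J) * minus L * (K * J) := by noncomm_ring
      rw [this, hKJ, hB, mul_one]
    have e5 : -minus L * K * A * J = -minus L * B := by rw [← hB]; noncomm_ring
    rw [add_mul, e1, e4, e5]; noncomm_ring
  have e1 : -minus B * K * E * J = -(minus B * L) := by rw [← hL]; noncomm_ring
  have e2 : L * (-minus B * K) * J = -(L * minus B) := by
    have : L * (-minus B * K) * J = -(L * minus B * (K * J)) := by noncomm_ring
    rw [this, hKJ, mul_one]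
  rw [mapDeriv_mul hδ, mapDeriv_neg, mapDeriv_minus, hδB, hKE, e1, e2]
  -- split `B` and `L` into differential and integral parts
  have hBp := minus_sub_minus B
  have hLp := minus_sub_minus L
  have hmm : minus (minus L * minus B - minus B * minus L) =
      minus L * minus B - minus B * minus L :=
    minus_eq_self (sub_mem_orderLE
      (mul_mem_orderLE (minus_mem_orderLE _) (minus_mem_orderLE _) (by omega))
      (mul_mem_orderLE (minus_mem_orderLE _) (minus_mem_orderLE _) (by omega)))
  have hpp : minus ((L - minus L) * (B - minus B) - (B - minus B) * (L - minus L)) = 0 := by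
    rw [minus_sub, minus_mul_eq_zero hLp hBp, minus_mul_eq_zero hBp hLp, sub_zero]
  have h1 : minus ((L - minus L) * B - B * (L - minus L)) =
      minus ((L - minus L) * minus B - minus B * (L - minus L)) := by
    rw [← sub_eq_zero, ← minus_sub, ← hpp]; congr 1; noncomm_ring
  have h2 : minus (-(minus B * L) - -(L * minus B)) =
      minus ((L - minus L) * minus B - minus B * (L - minus L)) +
        (minus L * minus B - minus B * minus L) := by
    rw [← hmm, ← minus_add]; congr 1; noncomm_ring
  rw [h1, h2]; noncomm_ring

/-- The operator `A` satisfies the Lax equation `δ A = [E, A]`, where `δ` acts on the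
coefficients. -/
def EvolvesBy (δ : Derivation S R R) (E A : PDO R) : Prop := A.mapDeriv δ = E * A - A * E

theorem EvolvesBy.mul (hδ : ∀ a : R, δ a′ = (δ a)′) {E A B : PDO R} (hA : EvolvesBy δ E A)
    (hB : EvolvesBy δ E B) : EvolvesBy δ E (A * B) := by
  unfold EvolvesBy at *; rw [mapDeriv_mul hδ, hA, hB]; noncomm_ring

theorem EvolvesBy.D (k m : ℤ) : EvolvesBy δ (D k) (PDO.D m : PDO R) := by
  unfold EvolvesBy; rw [mapDeriv_D, D_mul_D, D_mul_D, add_comm, sub_self]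

theorem EvolvesBy.pow (hδ : ∀ a : R, δ a′ = (δ a)′) {k : ℤ} {A : PDO R}
    (hA : EvolvesBy δ (PDO.D k) A) (n : ℕ) : EvolvesBy δ (PDO.D k) (A ^ n) := by
  induction n with
  | zero => simpa using EvolvesBy.D (δ := δ) k 0
  | succ n ih => rw [pow_succ]; exact ih.mul hδ hA

theorem EvolvesBy.inverse (hδ : ∀ a : R, δ a′ = (δ a)′) {E A : PDO R} (hA : EvolvesBy δ E A)
    (hu : IsUnit A) : EvolvesBy δ E (Ring.inverse A) := by
  have h := Ring.mul_inverse_cancel A hu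
  have h' := Ring.inverse_mul_cancel A hu
  unfold EvolvesBy at *
  generalize Ring.inverse A = B at *
  rw [mapDeriv_inverse hδ h h', hA]
  have : -(B * (E * A - A * E) * B) = (B * A) * E * B - B * E * (A * B) := by noncomm_ring
  rw [this, h, h']; noncomm_ring

theorem EvolvesBy.zpow (hδ : ∀ a : R, δ a′ = (δ a)′) {k : ℤ} {A : PDO R}
    (hA : EvolvesBy δ (PDO.D k) A) (n : ℤ) (h : 0 ≤ n ∨ IsUnit A) :
    EvolvesBy δ (PDO.D k) (A.zpow n) := by
  cases n with
  | ofNat n => exact hA.pow hδ n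
  | negSucc n => exact (hA.inverse hδ (h.resolve_left (by omega))).pow hδ _

end Flow

end PDO

namespace PDO

section Expansion

variable {R : Type*} [CommRing R] [Differential R]

/-! ### Integer powers of an operator modulo lower order -/

theorem zpow_natCast (X : PDO R) (n : ℕ) : X.zpow n = X ^ n := rfl

theorem zpow_neg_natCast (X : PDO R) (n : ℕ) : X.zpow (-n) = Ring.inverse X ^ n := by
  cases n with
  | zero => exact (pow_zero X).trans (pow_zero _).symm
  | succ n => rfl

/-- A sequence `F n` with `X F n = F (n + 1)` up to terms `d` orders below the top agrees with
`X ^ n` to that precision. -/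
theorem zpow_sub_mem {X : PDO R} {a d : ℤ} (hX : X ∈ orderLE R a) (F : ℤ → PDO R) (h0 : F 0 = 1)
    (n : ℤ) (hn : 0 ≤ n ∨ (IsUnit X ∧ Ring.inverse X ∈ orderLE R (-a)))
    (hF : ∀ k : ℤ, 0 ≤ k ∨ n < 0 → X * F k - F (k + 1) ∈ orderLE R (a * (k + 1) - d)) :
    X.zpow n - F n ∈ orderLE R (a * n - d) := by
  obtain ⟨k, rfl | rfl⟩ := n.eq_nat_or_neg
  · rw [zpow_natCast]
    have hF' := fun k : ℕ => hF k (Or.inl (by positivity))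
    clear hF hn
    induction k with
    | zero => simpa [h0] using zero_mem_orderLE
    | succ k ih =>
      have e : X ^ (k + 1) - F ((k + 1 : ℕ) : ℤ) = X * (X ^ k - F k) + (X * F k - F (k + 1)) := by
        rw [pow_succ', mul_sub]; push_cast; abel
      rw [e]
      refine add_mem_orderLE (mul_mem_orderLE hX ih ?_) (by simpa using hF' k)
      push_cast; linarith
  · rw [zpow_neg_natCast]
    induction k with
    | zero => simpa [h0] using zero_mem_orderLE
    | succ k ih =>
      obtain ⟨hu, hi⟩ := hn.resolve_left (by push_cast; omega)
      have hF' := fun k : ℤ => hF k (Or.inr (by push_cast; omega))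
      have ih' := ih (Or.inr ⟨hu, hi⟩) fun k _ => hF' k
      have hk := hF' (-((k + 1 : ℕ) : ℤ))
      rw [show -((k + 1 : ℕ) : ℤ) + 1 = -k by push_cast; ring] at hk
      have e : Ring.inverse X ^ (k + 1) - F (-((k + 1 : ℕ) : ℤ)) =
          Ring.inverse X * (Ring.inverse X ^ k - F (-k)) -
            Ring.inverse X * (X * F (-((k + 1 : ℕ) : ℤ)) - F (-k)) := by
        rw [pow_succ', mul_sub, mul_sub, ← mul_assoc (Ring.inverse X) X,
          Ring.inverse_mul_cancel X hu, one_mul]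
        abel
      rw [e]
      refine sub_mem_orderLE (mul_mem_orderLE hi ih' ?_) (mul_mem_orderLE hi hk ?_) <;>
      · push_cast; linarith

/-! ### Expansion of the powers of `x̂` -/

variable {x y z t₀ : R}

/-- The operator `z ∂ ^ (N - 1) + 2 y ∂ + x + t₀ ∂⁻¹`. -/
noncomputable def xop (N : ℤ) (x y z t₀ : R) : PDO R :=
  single (N - 1) z + single 1 (2 * y) + single 0 x + single (-1) t₀

theorem xop_mem_orderLE {N : ℤ} (hN : 2 ≤ N) : xop N x y z t₀ ∈ orderLE R (N - 1) :=
  add_mem_orderLE (add_mem_orderLE (add_mem_orderLE (single_mem_orderLE le_rfl _)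
    (single_mem_orderLE (by omega) _)) (single_mem_orderLE (by omega) _))
    (single_mem_orderLE (by omega) _)

/-- The terms of `x̂ ^ n`, of order `p = (N - 1) n`, that are at most `N + 1` orders below the top,
for `N ≥ 4`; here `s k = (n choose k) z ^ (n - k)`. -/
noncomputable def xpow (N : ℤ) (x y z t₀ : R) (s : ℕ → R) (p : ℤ) : PDO R :=
  single p (s 0) + single (p - N + 2) (2 * y * s 1) + single (p - N + 1) (x * s 1)
    + single (p - N) (t₀ * s 1 + (N - 1) * z * s 2) + single (p - 2 * N + 4) (4 * y ^ 2 * s 2)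
    + single (p - 2 * N + 3) (4 * x * y * s 2)

/-- The terms of `x̂ ^ n`, of order `p = 2 n`, that are at most `4` orders below the top, for
`N = 3`; here `s k = (n choose k) z ^ (n - k)`. -/
noncomputable def xpowThree (x y z t₀ : R) (s : ℕ → R) (p : ℤ) : PDO R :=
  single p (s 0) + single (p - 1) (2 * y * s 1) + single (p - 2) (x * s 1 + 4 * y ^ 2 * s 2)
    + single (p - 3) (t₀ * s 1 + 2 * z * s 2 + 4 * x * y * s 2 + 8 * y ^ 3 * s 3)
    + single (p - 4) (x ^ 2 * s 2 + 4 * y * t₀ * s 2 + 12 * x * y ^ 2 * s 3 + 16 * y ^ 4 * s 4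
      + y * (12 * z * s 3 + 2 * s 2))

theorem deriv_ofNat (k : ℕ) [k.AtLeastTwo] : (OfNat.ofNat k : R)′ = 0 :=
  Derivation.map_natCast _ k

theorem single_mul_single_eq {i j l : ℤ} {a b c : R} (hb : b′ = 0) (hl : i + j = l)
    (hc : a * b = c) : single i a * single j b = single l c := by
  rw [single_mul_single_of_const _ _ _ hb, hl, hc]

theorem single_mul_single_eq_add {i j l l' : ℤ} {a b c c' : R} (hb : b′′ = 0) (hl : i + j = l)
    (hl' : i + j - 1 = l') (hc : a * b = c) (hc' : i * (a * b′) = c') :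
    single i a * single j b = single l c + single l' c' := by
  rw [single_mul_single_of_linear _ _ _ hb, hl', hl, hc, hc']

section

variable (hx : x′ = 1) (hy : y′ = 0) (hz : z′ = 0) (ht₀ : t₀′ = 0) {s s' : ℕ → R}
  (hs : ∀ k, (s k)′ = 0) (h0 : s' 0 = z * s 0) (hs' : ∀ k, s' (k + 1) = z * s (k + 1) + s k)

include hx hy hz ht₀ hs h0 hs'

/-- The recursion `x̂ x̂ ^ n = x̂ ^ (n + 1)` for the expansions with `N ≥ 4`. -/
theorem xop_mul_xpow {N : ℤ} (hN : 4 ≤ N) (p : ℤ) :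
    xop N x y z t₀ * xpow N x y z t₀ s p - xpow N x y z t₀ s' (p + (N - 1)) ∈
      orderLE R (p - 3) := by
  have h2 : (2 : R)′ = 0 := deriv_ofNat 2
  have h4 : (4 : R)′ = 0 := deriv_ofNat 4
  have hN' : (N : R)′ = 0 := Derivation.map_intCast _ N
  have hc : (t₀ * s 1 + (N - 1) * z * s 2)′ = 0 := by
    simp [Derivation.leibniz, hs, hz, hN', ht₀]
  have a0 : single (N - 1) z * single p (s 0) = single (p + (N - 1)) (z * s 0) :=
    single_mul_single_eq (hs 0) (by ring) rfl
  have a1 : single (N - 1) z * single (p - N + 2) (2 * y * s 1) = single (p + 1) (2 * y * z * s 1) :=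
    single_mul_single_eq (by simp [Derivation.leibniz, hs, hy, h2]) (by ring) (by ring)
  have a2 : single (N - 1) z * single (p - N + 1) (x * s 1) =
      single p (x * z * s 1) + single (p - 1) ((N - 1) * z * s 1) :=
    single_mul_single_eq_add (by simp [Derivation.leibniz, hs, hx]) (by ring) (by ring)
      (by ring) (by simp [Derivation.leibniz, hs, hx]; ring)
  have a3 : single (N - 1) z * single (p - N) (t₀ * s 1 + (N - 1) * z * s 2) =
      single (p - 1) (z * (t₀ * s 1 + (N - 1) * z * s 2)) :=
    single_mul_single_eq hc (by ring) (by ring)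
  have a4 : single (N - 1) z * single (p - 2 * N + 4) (4 * y ^ 2 * s 2) =
      single (p - N + 3) (4 * y ^ 2 * z * s 2) :=
    single_mul_single_eq (by simp [Derivation.leibniz, pow_two, hs, hy, h4]) (by ring) (by ring)
  have a5 : single (N - 1) z * single (p - 2 * N + 3) (4 * x * y * s 2) =
      single (p - N + 2) (4 * x * y * z * s 2) + single (p - N + 1) ((N - 1) * (z * 4 * y * s 2)) :=
    single_mul_single_eq_add (by simp [Derivation.leibniz, hs, hy, hx, h4]) (by ring) (by ring)
      (by ring) (by simp [Derivation.leibniz, hs, hx, hy, h4]; ring)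
  have b0 : single 1 (2 * y) * single p (s 0) = single (p + 1) (2 * y * s 0) :=
    single_mul_single_eq (hs 0) (by ring) rfl
  have b1 : single 1 (2 * y) * single (p - N + 2) (2 * y * s 1) =
      single (p - N + 3) (4 * y ^ 2 * s 1) :=
    single_mul_single_eq (by simp [Derivation.leibniz, hs, hy, h2]) (by ring) (by ring)
  have b2 : single 1 (2 * y) * single (p - N + 1) (x * s 1) =
      single (p - N + 2) (2 * x * y * s 1) + single (p - N + 1) (2 * y * s 1) :=
    single_mul_single_eq_add (by simp [Derivation.leibniz, hs, hx]) (by ring) (by ring)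
      (by ring) (by simp [Derivation.leibniz, hs, hx])
  have c0 : single 0 x * single p (s 0) = single p (x * s 0) :=
    single_mul_single_eq (hs 0) (by ring) rfl
  have c1 : single 0 x * single (p - N + 2) (2 * y * s 1) = single (p - N + 2) (2 * x * y * s 1) :=
    single_mul_single_eq (by simp [Derivation.leibniz, hs, hy, h2]) (by ring) (by ring)
  have d0 : single (-1) t₀ * single p (s 0) = single (p - 1) (t₀ * s 0) :=
    single_mul_single_eq (hs 0) (by ring) rfl
  have e : xop N x y z t₀ * xpow N x y z t₀ s p - xpow N x y z t₀ s' (p + (N - 1)) =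
      single 1 (2 * y) * (single (p - N) (t₀ * s 1 + (N - 1) * z * s 2)
        + single (p - 2 * N + 4) (4 * y ^ 2 * s 2) + single (p - 2 * N + 3) (4 * x * y * s 2))
      + single 0 x * (single (p - N + 1) (x * s 1)
        + single (p - N) (t₀ * s 1 + (N - 1) * z * s 2)
        + single (p - 2 * N + 4) (4 * y ^ 2 * s 2) + single (p - 2 * N + 3) (4 * x * y * s 2))
      + single (-1) t₀ * (single (p - N + 2) (2 * y * s 1) + single (p - N + 1) (x * s 1)
        + single (p - N) (t₀ * s 1 + (N - 1) * z * s 2)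
        + single (p - 2 * N + 4) (4 * y ^ 2 * s 2) + single (p - 2 * N + 3) (4 * x * y * s 2))
      + single (p - N + 1) ((N - 1) * (z * 4 * y * s 2)) + single (p - N + 1) (2 * y * s 1) := by
    have f0 : single (p + (N - 1)) (s' 0) = single (p + (N - 1)) (z * s 0) := by rw [h0]
    have f1 : single (p + (N - 1) - N + 2) (2 * y * s' 1) =
        single (p + 1) (2 * y * z * s 1) + single (p + 1) (2 * y * s 0) := by
      rw [← single_add, hs' 0]; congr 1 <;> ring
    have f2 : single (p + (N - 1) - N + 1) (x * s' 1) =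
        single p (x * z * s 1) + single p (x * s 0) := by
      rw [← single_add, hs' 0]; congr 1 <;> ring
    have f3 : single (p + (N - 1) - N) (t₀ * s' 1 + (N - 1) * z * s' 2) =
        single (p - 1) (z * (t₀ * s 1 + (N - 1) * z * s 2)) + single (p - 1) ((N - 1) * z * s 1)
          + single (p - 1) (t₀ * s 0) := by
      rw [← single_add, ← single_add, hs' 0, hs' 1]; congr 1 <;> ring
    have f4 : single (p + (N - 1) - 2 * N + 4) (4 * y ^ 2 * s' 2) =
        single (p - N + 3) (4 * y ^ 2 * z * s 2) + single (p - N + 3) (4 * y ^ 2 * s 1) := by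
      rw [← single_add, hs' 1]; congr 1 <;> ring
    have f5 : single (p + (N - 1) - 2 * N + 3) (4 * x * y * s' 2) =
        single (p - N + 2) (4 * x * y * z * s 2) + single (p - N + 2) (2 * x * y * s 1)
          + single (p - N + 2) (2 * x * y * s 1) := by
      rw [← single_add, ← single_add, hs' 1]; congr 1 <;> ring
    unfold xop xpow
    rw [f0, f1, f2, f3, f4, f5]
    simp only [add_mul, mul_add, a0, a1, a2, a3, a4, a5, b0, b1, b2, c0, c1, d0]
    abel
  rw [e]
  refine add_mem_orderLE (add_mem_orderLE (add_mem_orderLE (add_mem_orderLE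
    (mul_mem_orderLE (p := 1) (q := p - 4) (single_mem_orderLE le_rfl _) ?_ (by omega))
    (mul_mem_orderLE (p := 0) (q := p - 3) (single_mem_orderLE le_rfl _) ?_ (by omega)))
    (mul_mem_orderLE (p := -1) (q := p - 2) (single_mem_orderLE le_rfl _) ?_ (by omega)))
    (single_mem_orderLE (by omega) _)) (single_mem_orderLE (by omega) _) <;>
  repeat first
    | exact single_mem_orderLE (by omega) _
    | refine add_mem_orderLE ?_ (single_mem_orderLE (by omega) _)

/-- The recursion `x̂ x̂ ^ n = x̂ ^ (n + 1)` for the expansions with `N = 3`. -/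
theorem xop_mul_xpowThree (p : ℤ) :
    xop 3 x y z t₀ * xpowThree x y z t₀ s p - xpowThree x y z t₀ s' (p + 2) ∈
      orderLE R (p - 3) := by
  have h2 : (2 : R)′ = 0 := deriv_ofNat 2
  have h4 : (4 : R)′ = 0 := deriv_ofNat 4
  have h8 : (8 : R)′ = 0 := deriv_ofNat 8
  have hF2 : (x * s 1 + 4 * y ^ 2 * s 2)′ = s 1 := by
    simp [Derivation.leibniz, Derivation.leibniz_pow, hs, hx, hy, h4]
  have hF3 : (t₀ * s 1 + 2 * z * s 2 + 4 * x * y * s 2 + 8 * y ^ 3 * s 3)′ = 4 * y * s 2 := by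
    simp [Derivation.leibniz, Derivation.leibniz_pow, hs, hx, hy, hz, ht₀, h4, h2, h8]; ring
  set F2 := x * s 1 + 4 * y ^ 2 * s 2 with eF2
  set F3 := t₀ * s 1 + 2 * z * s 2 + 4 * x * y * s 2 + 8 * y ^ 3 * s 3 with eF3
  set F4 := x ^ 2 * s 2 + 4 * y * t₀ * s 2 + 12 * x * y ^ 2 * s 3 + 16 * y ^ 4 * s 4
      + y * (12 * z * s 3 + 2 * s 2) with eF4
  have hF3' : (4 * y * s 2)′ = 0 := by simp [Derivation.leibniz, hs, hy, h4]
  have a0 : single (3 - 1) z * single p (s 0) = single (p + 2) (z * s 0) :=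
    single_mul_single_eq (hs 0) (by ring) rfl
  have a1 : single (3 - 1) z * single (p - 1) (2 * y * s 1) = single (p + 1) (2 * y * z * s 1) :=
    single_mul_single_eq (by simp [Derivation.leibniz, hs, hy, h2]) (by ring) (by ring)
  have a2 : single (3 - 1) z * single (p - 2) F2 =
      single p (z * F2) + single (p - 1) (2 * z * s 1) :=
    single_mul_single_eq_add (by rw [hF2, hs]) (by ring) (by ring)
      (by ring) (by rw [hF2]; push_cast; ring)
  have a3 : single (3 - 1) z * single (p - 3) F3 =
      single (p - 1) (z * F3) + single (p - 2) (8 * y * z * s 2) :=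
    single_mul_single_eq_add (by rw [hF3, hF3']) (by ring) (by ring)
      (by ring) (by rw [hF3]; push_cast; ring)
  have b0 : single 1 (2 * y) * single p (s 0) = single (p + 1) (2 * y * s 0) :=
    single_mul_single_eq (hs 0) (by ring) rfl
  have b1 : single 1 (2 * y) * single (p - 1) (2 * y * s 1) = single p (4 * y ^ 2 * s 1) :=
    single_mul_single_eq (by simp [Derivation.leibniz, hs, hy, h2]) (by ring) (by ring)
  have b2 : single 1 (2 * y) * single (p - 2) F2 =
      single (p - 1) (2 * y * F2) + single (p - 2) (2 * y * s 1) :=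
    single_mul_single_eq_add (by rw [hF2, hs]) (by ring) (by ring)
      (by ring) (by rw [hF2]; push_cast; ring)
  have b3 : single 1 (2 * y) * single (p - 3) F3 =
      single (p - 2) (2 * y * F3) + single (p - 3) (8 * y ^ 2 * s 2) :=
    single_mul_single_eq_add (by rw [hF3, hF3']) (by ring) (by ring)
      (by ring) (by rw [hF3]; push_cast; ring)
  have c0 : single 0 x * single p (s 0) = single p (x * s 0) :=
    single_mul_single_eq (hs 0) (by ring) rfl
  have c1 : single 0 x * single (p - 1) (2 * y * s 1) = single (p - 1) (2 * x * y * s 1) :=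
    single_mul_single_eq (by simp [Derivation.leibniz, hs, hy, h2]) (by ring) (by ring)
  have c2 : single 0 x * single (p - 2) F2 = single (p - 2) (x * F2) :=
    single_zero_mul_single _ _ _
  have d0 : single (-1) t₀ * single p (s 0) = single (p - 1) (t₀ * s 0) :=
    single_mul_single_eq (hs 0) (by ring) rfl
  have d1 : single (-1) t₀ * single (p - 1) (2 * y * s 1) = single (p - 2) (2 * t₀ * y * s 1) :=
    single_mul_single_eq (by simp [Derivation.leibniz, hs, hy, h2]) (by ring) (by ring)
  have e : xop 3 x y z t₀ * xpowThree x y z t₀ s p - xpowThree x y z t₀ s' (p + 2) =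
      (single (3 - 1) z * single (p - 4) F4 - single (p - 2) (z * F4))
      + single 1 (2 * y) * single (p - 4) F4
      + single 0 x * (single (p - 3) F3 + single (p - 4) F4)
      + single (-1) t₀ * (single (p - 2) F2 + single (p - 3) F3 + single (p - 4) F4)
      + single (p - 3) (8 * y ^ 2 * s 2) := by
    have f0 : single (p + 2) (s' 0) = single (p + 2) (z * s 0) := by rw [h0]
    have f1 : single (p + 2 - 1) (2 * y * s' 1) =
        single (p + 1) (2 * y * z * s 1) + single (p + 1) (2 * y * s 0) := by
      rw [← single_add, hs' 0]; congr 1 <;> ring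
    have f2 : single (p + 2 - 2) (x * s' 1 + 4 * y ^ 2 * s' 2) =
        single p (z * F2) + single p (4 * y ^ 2 * s 1) + single p (x * s 0) := by
      rw [← single_add, ← single_add, hs' 0, hs' 1, eF2]; congr 1 <;> ring
    have f3 : single (p + 2 - 3) (t₀ * s' 1 + 2 * z * s' 2 + 4 * x * y * s' 2 + 8 * y ^ 3 * s' 3) =
        single (p - 1) (z * F3) + single (p - 1) (2 * z * s 1) + single (p - 1) (2 * y * F2)
          + single (p - 1) (2 * x * y * s 1) + single (p - 1) (t₀ * s 0) := by
      simp only [← single_add]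
      rw [hs' 0, hs' 1, hs' 2, eF2, eF3]; congr 1 <;> ring
    have f4 : single (p + 2 - 4) (x ^ 2 * s' 2 + 4 * y * t₀ * s' 2 + 12 * x * y ^ 2 * s' 3
        + 16 * y ^ 4 * s' 4 + y * (12 * z * s' 3 + 2 * s' 2)) =
        single (p - 2) (z * F4) + single (p - 2) (8 * y * z * s 2) + single (p - 2) (2 * y * F3)
          + single (p - 2) (2 * y * s 1) + single (p - 2) (x * F2)
          + single (p - 2) (2 * t₀ * y * s 1) := by
      simp only [← single_add]
      rw [hs' 1, hs' 2, hs' 3, eF2, eF3, eF4]; congr 1 <;> ring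
    unfold xop xpowThree
    rw [f0, f1, f2, f3, f4, ← eF2, ← eF3, ← eF4]
    simp only [add_mul, mul_add, a0, a1, a2, a3, b0, b1, b2, b3, c0, c1, c2, d0, d1]
    abel
  have g4 := single_mul_single_sub_mem (3 - 1) (p - 4) z F4
  rw [show (3 - 1 + (p - 4) : ℤ) = p - 2 by ring, show p - 2 - 1 = p - 3 by ring] at g4
  rw [e]
  refine add_mem_orderLE (add_mem_orderLE (add_mem_orderLE (add_mem_orderLE g4
    (mul_mem_orderLE (p := 1) (q := p - 4) (single_mem_orderLE le_rfl _) ?_ (by omega)))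
    (mul_mem_orderLE (p := 0) (q := p - 3) (single_mem_orderLE le_rfl _) ?_ (by omega)))
    (mul_mem_orderLE (p := -1) (q := p - 2) (single_mem_orderLE le_rfl _) ?_ (by omega)))
    (single_mem_orderLE le_rfl _) <;>
  repeat first
    | exact single_mem_orderLE (by omega) _
    | refine add_mem_orderLE ?_ (single_mem_orderLE (by omega) _)

end

/-- `x̂` is invertible where the coefficient `z` of its leading term is. -/
theorem xop_inverse {N : ℤ} (hN : 3 ≤ N) {u : R} (hzu : z * u = 1) (hz : z′ = 0) :
    IsUnit (xop N x y z t₀) ∧ Ring.inverse (xop N x y z t₀) ∈ orderLE R (1 - N) ∧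
      z * (Ring.inverse (xop N x y z t₀)).coeff (1 - N) = 1 := by
  have hu : u′ = 0 := by
    have h : (z * u)′ = 0 := by rw [hzu, Derivation.map_one_eq_zero]
    rw [Derivation.leibniz, hz, smul_zero, add_zero, smul_eq_mul] at h
    calc u′ = u * (z * u′) + (1 - z * u) * u′ := by ring
      _ = 0 := by rw [h, hzu]; ring
  have h1 : single (1 - N) u * single (N - 1) z = 1 :=
    (single_mul_single_eq hz (by ring) (by rw [mul_comm, hzu])).trans one_eq_single.symm
  have h2 : single (N - 1) z * single (1 - N) u = 1 :=
    (single_mul_single_eq hu (by ring) hzu).trans one_eq_single.symm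
  set M : PDO R := single 1 (2 * y) + single 0 x + single (-1) t₀ with hM
  have hM1 : M ∈ orderLE R 1 := add_mem_orderLE (add_mem_orderLE (single_mem_orderLE le_rfl _)
    (single_mem_orderLE (by omega) _)) (single_mem_orderLE (by omega) _)
  have hX : xop N x y z t₀ = single (N - 1) z * (1 - -(single (1 - N) u * M)) := by
    rw [mul_sub, mul_neg, ← mul_assoc, h2, xop, hM]; noncomm_ring
  obtain ⟨G, hG, hG0, hG1, hG2⟩ := exists_inverse_one_sub
    (L := -(single (1 - N) u * M)) (neg_mem_orderLE
      (mul_mem_orderLE (single_mem_orderLE le_rfl u) hM1 (by omega)))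
  obtain ⟨hunit, hinv⟩ := inverse_eq (P := xop N x y z t₀) (Q := G * single (1 - N) u)
    (by rw [hX, mul_assoc, ← mul_assoc _ G, hG1, one_mul, h2])
    (by rw [hX, mul_assoc, ← mul_assoc _ (single (N - 1) z), h1, one_mul, hG2])
  have hc := coeff_mul_top hG (single_mem_orderLE (le_refl (1 - N)) u)
  rw [zero_add, hG0, coeff_single, if_pos rfl, one_mul] at hc
  exact ⟨hunit, hinv ▸ mul_mem_orderLE hG (single_mem_orderLE le_rfl u) (by omega),
    by rw [hinv, hc, hzu]⟩

/-! ### Rank one solutions -/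

theorem minus_D_of_nonneg {i : ℤ} (hi : 0 ≤ i) : minus (D i : PDO R) = 0 :=
  minus_single_of_nonneg hi 1

/-- Division of `∂ ^ k φ` by `∂` on the right: the remainder is the `k`-th derivative of `φ`. -/
theorem D_mul_function (φ : R) (k : ℕ) :
    ∃ Q : PDO R, minus Q = 0 ∧
      D k * single 0 φ = Q * D 1 + single 0 ((Differential.deriv (R := R))^[k] φ) := by
  induction k with
  | zero => exact ⟨0, by ext i; simp [coeff_minus], by simp⟩
  | succ k ih =>
    obtain ⟨Q, hQ, h⟩ := ih
    refine ⟨D 1 * Q + single 0 ((Differential.deriv (R := R))^[k] φ), ?_, ?_⟩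
    · rw [minus_add, minus_mul_eq_zero (minus_D_of_nonneg zero_le_one) hQ,
        minus_single_of_nonneg le_rfl, add_zero]
    · rw [show ((k + 1 : ℕ) : ℤ) = 1 + k by push_cast; ring, ← D_mul_D, mul_assoc, h, mul_add,
        D_one_mul (single 0 _), mapDeriv_single, ← mul_assoc, add_mul,
        Function.iterate_succ_apply', add_assoc]

/-- The dressing operator `(∂ - φ'/φ) ∂⁻¹ (1 + c ∂⁻¹)`, with `v` the inverse of `φ`. -/
noncomputable def rankOne (φ v c : R) : PDO R :=
  (1 - single (-1) (φ′ * v)) * (1 + single (-1) c)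

section

variable {φ v c : R} (hv : φ * v = 1) (hc : c′ = 0)

include hv in
theorem deriv_inverse_mul : φ * v′ = -(φ′ * v) := by
  have h : (φ * v)′ = 0 := by rw [hv, Derivation.map_one_eq_zero]
  rw [Derivation.leibniz] at h
  simp only [smul_eq_mul] at h
  linear_combination h

include hv in
theorem rankOne_eq : rankOne φ v c =
    single 0 φ * D 1 * single 0 v * D (-1) * (1 + single (-1) c) := by
  have : single 0 φ * D 1 * single 0 v = D 1 - single 0 (φ′ * v) := by
    rw [mul_assoc, D_one_mul, mapDeriv_single, mul_add, ← mul_assoc, single_zero_mul_single, hv,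
      single_zero_mul_single, deriv_inverse_mul hv, single_neg, ← one_eq_single, one_mul]
    abel
  rw [this, sub_mul, D_mul_D, single_mul_D, rankOne]; simp

theorem coeff_one_add_single_mem : (1 + single (-1) c : PDO R) ∈ orderLE R 0 :=
  add_mem_orderLE one_mem_orderLE (single_mem_orderLE (by omega) _)

theorem rankOne_isDressing : (rankOne φ v c).IsDressing := by
  have h1 : (1 - single (-1) (φ′ * v) : PDO R) ∈ orderLE R 0 :=
    sub_mem_orderLE one_mem_orderLE (single_mem_orderLE (by omega) _)
  refine ⟨?_, mul_mem_orderLE h1 coeff_one_add_single_mem (by omega)⟩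
  have := coeff_mul_top h1 (coeff_one_add_single_mem (c := c))
  rw [add_zero] at this
  rw [rankOne, this]; simp [coeff_one, coeff_single]

theorem wOf_rankOne : wOf (rankOne φ v c) = 2 * (φ′ * v) - 2 * c := by
  have h2 : (single (-1) (φ′ * v) * single (-1) c).coeff (-1) = 0 :=
    mul_mem_orderLE (single_mem_orderLE (le_refl (-1)) _) (single_mem_orderLE (le_refl (-1)) _)
      le_rfl _ (by omega)
  have e : rankOne φ v c = 1 + single (-1) c - single (-1) (φ′ * v)
      - single (-1) (φ′ * v) * single (-1) c := by rw [rankOne]; noncomm_ring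
  rw [wOf, e, coeff_sub, h2]; simp [coeff_one, coeff_single]; ring

include hv hc in
/-- With `h = φ⁽ᵏ⁾/φ`, division by `∂` gives `(K ∂ ^ k K⁻¹)_- = φ h' ∂⁻¹ φ⁻¹`. -/
theorem field_rankOne (k : ℕ) : field (D k) (rankOne φ v c) =
    -(single (-1) ((v * (Differential.deriv (R := R))^[k] φ)′) * (1 + single (-1) c)) := by
  have hK := rankOne_isDressing (φ := φ) (v := v) (c := c)
  have hKJ := hK.mul_inverse
  have hvφ : single 0 v * single 0 φ = 1 := by
    rw [single_zero_mul_single, mul_comm, hv, one_eq_single]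
  have hφv : single 0 φ * single 0 v = 1 := by
    rw [single_zero_mul_single, hv, one_eq_single]
  have hDD : D (-1) * D 1 = (1 : PDO R) := by rw [D_mul_D]; rfl
  have hDD' : D 1 * D (-1) = (1 : PDO R) := by rw [D_mul_D]; rfl
  set C : PDO R := 1 + single (-1) c with hC
  set K := rankOne φ v c with hKdef
  have hKe : K = single 0 φ * D 1 * single 0 v * D (-1) * C := rankOne_eq hv
  have hCD : C * D k = D k * C := by
    rw [hC, add_mul, mul_add, single_mul_D, D, single_mul_single_of_const _ _ _ hc, add_comm (k : ℤ)]
    simp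
  set h := v * (Differential.deriv (R := R))^[k] φ with hh
  obtain ⟨Q, hQ, hQe⟩ := D_mul_function φ k
  have hDh : D 1 * single 0 h = single 0 h * D 1 + single 0 h′ := by
    rw [D_one_mul, mapDeriv_single]
  have key : K * D k * Ring.inverse K = single 0 φ * D 1 * single 0 v * Q * single 0 v
      + single 0 φ * single 0 h * single 0 v + single 0 φ * single 0 h′ * D (-1) * single 0 v := by
    -- both sides agree after multiplication by `K` on the right
    have e : K * D k = (single 0 φ * D 1 * single 0 v * Q * single 0 v
      + single 0 φ * single 0 h * single 0 v +
        single 0 φ * single 0 h′ * D (-1) * single 0 v) * K := by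
      have r : (single 0 φ * D 1 * single 0 v * Q * single 0 v
          + single 0 φ * single 0 h * single 0 v +
          single 0 φ * single 0 h′ * D (-1) * single 0 v) * K =
          single 0 φ * D 1 * single 0 v * (Q * D 1) * single 0 v * D (-1) * C
          + single 0 φ * (single 0 h * D 1 + single 0 h′) * single 0 v * D (-1) * C := by
        have r1 : single 0 v * K = D 1 * single 0 v * D (-1) * C := by
          rw [hKe]; simp only [← mul_assoc]; rw [hvφ, one_mul]
        have r2 : D (-1) * (single 0 v * K) = single 0 v * D (-1) * C := by
          rw [r1]; simp only [← mul_assoc]; rw [hDD, one_mul]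
        rw [add_mul, add_mul, mul_assoc _ (single 0 v) K, mul_assoc _ (single 0 v) K,
          mul_assoc _ (single 0 v) K, mul_assoc _ (D (-1)) (single 0 v * K), r2, r1]
        noncomm_ring
      rw [r, ← hDh, hKe, mul_assoc _ C, hCD]
      have e1 : single 0 φ * D 1 * single 0 v * D (-1) * (D k * C) =
          single 0 φ * D 1 * single 0 v * (D k * single 0 φ) * single 0 v * D (-1) * C := by
        have : D (-1) * (D k * C) = D k * D (-1) * C := by
          rw [← mul_assoc, D_mul_D, D_mul_D, add_comm]
        rw [mul_assoc _ (D (-1)), this]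
        simp only [mul_assoc]
        rw [← mul_assoc (single 0 φ) (single 0 v), hφv, one_mul]
      have e2 : single 0 h = single 0 v * single 0 ((Differential.deriv (R := R))^[k] φ) := by
        rw [single_zero_mul_single]
      rw [e1, hQe, e2]
      noncomm_ring
    rw [e, mul_assoc, hKJ, mul_one]
  have hd : ∀ a : R, minus (single 0 a) = 0 := fun a => minus_single_of_nonneg le_rfl a
  have hmin : minus (K * D k * Ring.inverse K) =
      single 0 φ * single 0 h′ * D (-1) * single 0 v := by
    rw [key, minus_add, minus_add]
    rw [minus_mul_eq_zero (minus_mul_eq_zero (minus_mul_eq_zero (minus_mul_eq_zero (hd _)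
      (minus_D_of_nonneg zero_le_one)) (hd _)) hQ) (hd _),
      minus_mul_eq_zero (minus_mul_eq_zero (hd _) (hd _)) (hd _), zero_add, zero_add]
    refine minus_eq_self ?_
    rw [single_zero_mul_single, single_mul_D]
    exact mul_mem_orderLE (single_mem_orderLE (le_refl (0 + -1)) _) (single_mem_orderLE le_rfl _)
      (by omega)
  rw [field, hmin, hKe]
  have f1 : single 0 φ * single 0 h′ * D (-1) * single 0 v * (single 0 φ * D 1 * single 0 v * D (-1) * C)
      = single 0 φ * single 0 h′ * single 0 v * D (-1) * C := by
    have : D (-1) * single 0 v * (single 0 φ * D 1 * single 0 v * D (-1) * C) =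
        single 0 v * D (-1) * C := by
      simp only [mul_assoc]
      rw [← mul_assoc (single 0 v) (single 0 φ), hvφ, one_mul, ← mul_assoc (D (-1)) (D 1), hDD,
        one_mul]
    simp only [mul_assoc] at this ⊢
    rw [this]
  rw [neg_mul, f1, single_zero_mul_single, single_zero_mul_single, single_mul_D]
  congr 3
  linear_combination h′ * hv

include hv hc in
theorem wFlow_rankOne (k : ℕ) : wFlow (D k) (rankOne φ v c) =
    2 * (v * (Differential.deriv (R := R))^[k] φ)′ := by
  have h2 : ∀ a : R, (single (-1) a * single (-1) c).coeff (-1) = 0 := fun a =>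
    mul_mem_orderLE (single_mem_orderLE (le_refl (-1)) _) (single_mem_orderLE (le_refl (-1)) _)
      le_rfl _ (by omega)
  rw [wFlow, field_rankOne hv hc, wOf, coeff_neg, mul_add, mul_one, coeff_add, h2, coeff_single,
    if_pos rfl]
  ring

include hv hc in
/-- If `φ` evolves by `δ φ = ∂ ^ k φ`, then `(∂ - φ'/φ) ∂⁻¹ (1 + c ∂⁻¹)` evolves by the `k`-th
flow of the hierarchy. -/
theorem mapDeriv_rankOne {S : Type*} [CommRing S] [Algebra S R] {δ : Derivation S R R}
    (hδ : ∀ a : R, δ a′ = (δ a)′) {k : ℕ} (hφ : δ φ = (Differential.deriv (R := R))^[k] φ)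
    (hδc : δ c = 0) : (rankOne φ v c).mapDeriv δ = field (D k) (rankOne φ v c) := by
  have hδv : φ * δ v = -(v * δ φ) := by
    have h : δ (φ * v) = 0 := by rw [hv, Derivation.map_one_eq_zero]
    rw [Derivation.leibniz] at h
    simp only [smul_eq_mul] at h
    linear_combination h
  have hu : δ (φ′ * v) = (v * δ φ)′ := by
    rw [Derivation.leibniz, Derivation.leibniz, hδ]
    simp only [smul_eq_mul]
    linear_combination (φ′ * v) * hδv - δ φ * v * deriv_inverse_mul hv
      - (φ′ * δ v - δ φ * v′) * hv
  rw [field_rankOne hv hc, ← hφ, ← hu, rankOne, mapDeriv_mul hδ, mapDeriv_add, sub_eq_add_neg,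
    mapDeriv_add, mapDeriv_neg, mapDeriv_one, mapDeriv_single, mapDeriv_single, hδc]
  simp

end

end Expansion

end PDO

namespace PDO

section Reduction

variable {R : Type*} [CommRing R] [Differential R]

/-! ### The flow of `w` given by an expansion of `x̂ ^ n ∂ ^ m` -/

theorem wFlow_single_of_le_one {K : PDO R} (hK : K.IsDressing) {i : ℤ} (hi : i ≤ 1) (a : R) :
    wFlow (single i a) K =
      if i = 1 then a * (wOf K)′ + a′ * wOf K else if i = -1 then 2 * a else 0 := by
  split_ifs with h1 h2
  · rw [h1, wFlow_single_one hK]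
  · rw [h2, wFlow_single_neg_one hK]
  · obtain rfl | h : i = 0 ∨ i ≤ -2 := by omega
    · exact wFlow_single_zero hK a
    · exact wFlow_eq_zero hK (single_mem_orderLE h a)

theorem wFlow_D_one {K : PDO R} (hK : K.IsDressing) : wFlow (D 1) K = (wOf K)′ := by
  rw [D, wFlow_single_one hK, Derivation.map_one_eq_zero]; ring

variable {x y z t₀ : R} {s : ℕ → R} {K : PDO R}

section

variable (hK : K.IsDressing) (hx : x′ = 1) (hy : y′ = 0) (hs : ∀ k, (s k)′ = 0)

include hK hx hy hs

/-- The flow with `α = N`, for `N ≥ 4`. The terms of the expansion of order `N` and `2` have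
coefficients independent of `x`; of the others only those of order `1` and `-1` contribute. -/
theorem wFlow_xpow_top {N : ℤ} (hN : 4 ≤ N) : wFlow (xpow N x y z t₀ s N) K =
    s 0 * wFlow (D N) K + 2 * y * s 1 * wFlow (D 2) K + (x * s 1 * (wOf K)′ + s 1 * wOf K)
      + (if N = 5 then 8 * y ^ 2 * s 2 else 0) + (if N = 4 then 8 * x * y * s 2 else 0) := by
  have h2 : (2 : R)′ = 0 := deriv_ofNat 2
  have hd : (x * s 1)′ = s 1 := by simp [Derivation.leibniz, hs, hx]
  unfold xpow
  simp only [wFlow_add hK]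
  rw [wFlow_single_of_const hK _ (hs 0), show N - N + 2 = 2 by ring,
    wFlow_single_of_const hK 2 (by simp [Derivation.leibniz, hs, hy, h2]),
    wFlow_single_of_le_one hK (i := N - N + 1) (by omega),
    wFlow_single_of_le_one hK (i := N - N) (by omega),
    wFlow_single_of_le_one hK (i := N - 2 * N + 4) (by omega),
    wFlow_single_of_le_one hK (i := N - 2 * N + 3) (by omega),
    if_pos (by omega : N - N + 1 = 1), if_neg (by omega), if_neg (by omega),
    if_neg (by omega : ¬ N - 2 * N + 4 = 1), if_neg (by omega : ¬ N - 2 * N + 3 = 1), hd,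
    if_congr (show N - 2 * N + 4 = -1 ↔ N = 5 by omega) rfl rfl,
    if_congr (show N - 2 * N + 3 = -1 ↔ N = 4 by omega) rfl rfl]
  split_ifs <;> ring

/-- The flows with `α < N`, for `N ≥ 4`. -/
theorem wFlow_xpow_of_lt {N α : ℤ} (hN : 4 ≤ N) (hα : α < N) : wFlow (xpow N x y z t₀ s α) K =
    s 0 * wFlow (D α) K + (if α = N - 1 then 2 * y * s 1 * (wOf K)′ else 0)
      + (if α = N - 3 then 4 * y * s 1 else 0) + (if α = N - 2 then 2 * (x * s 1) else 0)
      + (if α = N - 1 then 2 * (t₀ * s 1 + (N - 1) * z * s 2) else 0)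
      + (if α = 2 * N - 5 then 8 * y ^ 2 * s 2 else 0) := by
  have h2 : (2 : R)′ = 0 := deriv_ofNat 2
  have hd : (2 * y * s 1)′ = 0 := by simp [Derivation.leibniz, hs, hy, h2]
  unfold xpow
  simp only [wFlow_add hK]
  rw [wFlow_single_of_const hK _ (hs 0),
    wFlow_single_of_le_one hK (i := α - N + 2) (by omega),
    wFlow_single_of_le_one hK (i := α - N + 1) (by omega),
    wFlow_single_of_le_one hK (i := α - N) (by omega),
    wFlow_single_of_le_one hK (i := α - 2 * N + 4) (by omega),
    wFlow_single_of_le_one hK (i := α - 2 * N + 3) (by omega), hd,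
    if_neg (by omega : ¬ α - N + 1 = 1), if_neg (by omega : ¬ α - N = 1),
    if_neg (by omega : ¬ α - 2 * N + 4 = 1), if_neg (by omega : ¬ α - 2 * N + 3 = 1),
    if_neg (by omega : ¬ α - 2 * N + 3 = -1),
    if_congr (show α - N + 2 = 1 ↔ α = N - 1 by omega) rfl rfl,
    if_congr (show α - N + 2 = -1 ↔ α = N - 3 by omega) rfl rfl,
    if_congr (show α - N + 1 = -1 ↔ α = N - 2 by omega) rfl rfl,
    if_congr (show α - N = -1 ↔ α = N - 1 by omega) rfl rfl,
    if_congr (show α - 2 * N + 4 = -1 ↔ α = 2 * N - 5 by omega) rfl rfl]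
  split_ifs <;> first | omega | ring

/-- The flows with `α ≤ N`, for `N = 3`. -/
theorem wFlow_xpowThree {α : ℤ} (hα : α ≤ 3) : wFlow (xpowThree x y z t₀ s α) K =
    s 0 * wFlow (D α) K + 2 * y * s 1 * wFlow (D (α - 1)) K
      + (if α = 3 then (x * s 1 + 4 * y ^ 2 * s 2) * (wOf K)′ + s 1 * wOf K +
          2 * (x ^ 2 * s 2 + 4 * y * t₀ * s 2 + 12 * x * y ^ 2 * s 3 + 16 * y ^ 4 * s 4
            + y * (12 * z * s 3 + 2 * s 2)) else 0)
      + (if α = 2 then 2 * (t₀ * s 1 + 2 * z * s 2 + 4 * x * y * s 2 + 8 * y ^ 3 * s 3) else 0)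
      + (if α = 1 then 2 * (x * s 1 + 4 * y ^ 2 * s 2) else 0) := by
  have h2 : (2 : R)′ = 0 := deriv_ofNat 2
  have h4 : (4 : R)′ = 0 := deriv_ofNat 4
  have hd : (x * s 1 + 4 * y ^ 2 * s 2)′ = s 1 := by
    simp [Derivation.leibniz, Derivation.leibniz_pow, hs, hx, hy, h4]
  unfold xpowThree
  simp only [wFlow_add hK]
  rw [wFlow_single_of_const hK _ (hs 0),
    wFlow_single_of_const hK _ (by simp [Derivation.leibniz, hs, hy, h2]),
    wFlow_single_of_le_one hK (i := α - 2) (by omega),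
    wFlow_single_of_le_one hK (i := α - 3) (by omega),
    wFlow_single_of_le_one hK (i := α - 4) (by omega), hd,
    if_neg (by omega : ¬ α - 3 = 1), if_neg (by omega : ¬ α - 4 = 1),
    if_congr (show α - 2 = 1 ↔ α = 3 by omega) rfl rfl,
    if_congr (show α - 2 = -1 ↔ α = 1 by omega) rfl rfl,
    if_congr (show α - 3 = -1 ↔ α = 2 by omega) rfl rfl,
    if_congr (show α - 4 = -1 ↔ α = 3 by omega) rfl rfl]
  split_ifs <;> first | omega | ring

variable {F : Type*} [CommRing F] (e : R →+* F)

/-- The formula of `wFlow_xpow_top` under a ring homomorphism, such as the evaluation at a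
point. -/
theorem map_wFlow_xpow_top {N : ℤ} (hN : 4 ≤ N) : e (wFlow (xpow N x y z t₀ s N) K) =
    e (s 0) * e (wFlow (D N) K) + 2 * e y * e (s 1) * e (wFlow (D 2) K)
      + (e x * e (s 1) * e (wOf K)′ + e (s 1) * e (wOf K))
      + (if N = 5 then 8 * e y ^ 2 * e (s 2) else 0)
      + (if N = 4 then 8 * e x * e y * e (s 2) else 0) := by
  rw [wFlow_xpow_top hK hx hy hs hN]
  split_ifs <;> simp only [map_add, map_mul, map_pow, map_ofNat, map_zero]

theorem map_wFlow_xpow_of_lt {N α : ℤ} (hN : 4 ≤ N) (hα : α < N) :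
    e (wFlow (xpow N x y z t₀ s α) K) =
    e (s 0) * e (wFlow (D α) K) + (if α = N - 1 then 2 * e y * e (s 1) * e (wOf K)′ else 0)
      + (if α = N - 3 then 4 * e y * e (s 1) else 0)
      + (if α = N - 2 then 2 * (e x * e (s 1)) else 0)
      + (if α = N - 1 then 2 * (e t₀ * e (s 1) + (N - 1) * e z * e (s 2)) else 0)
      + (if α = 2 * N - 5 then 8 * e y ^ 2 * e (s 2) else 0) := by
  rw [wFlow_xpow_of_lt hK hx hy hs hN hα]
  split_ifs <;> simp only [map_add, map_sub, map_mul, map_pow, map_ofNat, map_zero, map_one,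
    map_intCast]

theorem map_wFlow_xpowThree {α : ℤ} (hα : α ≤ 3) : e (wFlow (xpowThree x y z t₀ s α) K) =
    e (s 0) * e (wFlow (D α) K) + 2 * e y * e (s 1) * e (wFlow (D (α - 1)) K)
      + (if α = 3 then (e x * e (s 1) + 4 * e y ^ 2 * e (s 2)) * e (wOf K)′ + e (s 1) * e (wOf K) +
          2 * (e x ^ 2 * e (s 2) + 4 * e y * e t₀ * e (s 2) + 12 * e x * e y ^ 2 * e (s 3)
            + 16 * e y ^ 4 * e (s 4) + e y * (12 * e z * e (s 3) + 2 * e (s 2))) else 0)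
      + (if α = 2 then 2 * (e t₀ * e (s 1) + 2 * e z * e (s 2) + 4 * e x * e y * e (s 2)
          + 8 * e y ^ 3 * e (s 3)) else 0)
      + (if α = 1 then 2 * (e x * e (s 1) + 4 * e y ^ 2 * e (s 2)) else 0) := by
  rw [wFlow_xpowThree hK hx hy hs hα]
  split_ifs <;> simp only [map_add, map_mul, map_pow, map_ofNat, map_zero]

end

theorem xpow_mul_D (N p m : ℤ) : xpow N x y z t₀ s p * D m = xpow N x y z t₀ s (p + m) := by
  unfold xpow
  simp only [add_mul, single_mul_D]
  congr! 2 <;> ring_nf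

theorem xpowThree_mul_D (p m : ℤ) :
    xpowThree x y z t₀ s p * D m = xpowThree x y z t₀ s (p + m) := by
  unfold xpowThree
  simp only [add_mul, single_mul_D]
  congr! 2 <;> ring_nf

/-! ### The evolution of `x̂` -/

/-- By the Leibniz rule `[∂ ^ k, x̂] = k ∂ ^ (k - 1)`, which is also the derivative of `x̂` with
respect to the time `t_k`. -/
theorem D_commutator_xop (N : ℤ) (hx : x′ = 1) (hy : y′ = 0) (hz : z′ = 0) (ht₀ : t₀′ = 0) (k : ℤ) :
    D k * xop N x y z t₀ - xop N x y z t₀ * D k = single (k - 1) (k : R) := by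
  have h2 : (2 : R)′ = 0 := deriv_ofNat 2
  have e1 := single_mul_single_of_linear k 0 1 (b := x) (by rw [hx, Derivation.map_one_eq_zero])
  have e2 := single_mul_single_of_const k (N - 1) 1 hz
  have e3 := single_mul_single_of_const k 1 1 (b := 2 * y) (by simp [Derivation.leibniz, hy, h2])
  have e4 := single_mul_single_of_const k (-1) 1 ht₀
  unfold xop
  simp only [add_mul, mul_add, single_mul_D]
  rw [D, e1, e2, e3, e4, hx]
  simp only [one_mul, mul_one, add_comm k, zero_add]
  abel

theorem mapDeriv_xop {S : Type*} [CommRing S] [Algebra S R] (δ : Derivation S R R) (N : ℤ) :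
    (xop N x y z t₀).mapDeriv δ = single (N - 1) (δ z) + single 1 (δ (2 * y)) + single 0 (δ x)
      + single (-1) (δ t₀) := by
  simp only [xop, mapDeriv_add, mapDeriv_single]

end Reduction

end PDO

section Smooth

variable {𝕜 : Type*} [RCLike 𝕜] {U : TopologicalSpace.Opens (Fin 3 → ℝ)}

/-! ### Smooth functions on an open set -/

theorem deriv_eq_pderiv (f : SmoothFun 𝕜 U) : f′ = pderiv 𝕜 U 0 f := rfl

theorem pderiv_apply (i : Fin 3) (f : SmoothFun 𝕜 U) (q : U) :
    (pderiv 𝕜 U i f).1 q = fderiv ℝ (extZero f) q (Pi.single i 1) := rfl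

theorem pderiv_comm (i j : Fin 3) (f : SmoothFun 𝕜 U) :
    pderiv 𝕜 U i (pderiv 𝕜 U j f) = pderiv 𝕜 U j (pderiv 𝕜 U i f) := by
  have key : ∀ (i j : Fin 3) (q : U), (pderiv 𝕜 U i (pderiv 𝕜 U j f)).1 q =
      fderiv ℝ (fderiv ℝ (extZero f)) q (Pi.single i 1) (Pi.single j 1) := by
    rintro i j ⟨p, hp⟩
    have hd : DifferentiableAt ℝ (fderiv ℝ (extZero f)) p :=
      (((contDiffOn_extZero f).contDiffAt (U.isOpen.mem_nhds hp)).fderiv_right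
        (m := 1) (by norm_cast)).differentiableAt (by simp)
    rw [pderiv_apply, fderiv_extZero_congr (g := fun p => fderiv ℝ (extZero f) p (Pi.single j 1))
      _ (fun r hr => by rw [extZero_apply _ hr, pderiv_apply]) hp,
      fderiv_clm_apply hd (differentiableAt_const _)]
    simp
  ext q
  rw [key, key]
  have hs : IsSymmSndFDerivAt ℝ (extZero f) (q : Fin 3 → ℝ) :=
    ((contDiffOn_extZero f).contDiffAt (U.isOpen.mem_nhds q.2)).isSymmSndFDerivAt
      (by simp only [minSmoothness_of_isRCLikeNormedField]; norm_cast)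
  exact hs _ _

theorem pderiv_deriv (i : Fin 3) (f : SmoothFun 𝕜 U) :
    pderiv 𝕜 U i f′ = (pderiv 𝕜 U i f)′ := pderiv_comm i 0 f

theorem pderiv_coord (i j : Fin 3) :
    pderiv 𝕜 U i (coord 𝕜 U j) = if i = j then 1 else 0 := by
  ext ⟨p, hp⟩
  rw [pderiv_apply, fderiv_extZero_congr (g := fun p => RCLike.ofRealCLM (K := 𝕜) (p j)) _
    (fun r hr => by rw [extZero_apply _ hr]; rfl) hp]
  have h : HasFDerivAt (fun p : Fin 3 → ℝ => RCLike.ofRealCLM (K := 𝕜) (p j))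
      ((RCLike.ofRealCLM (K := 𝕜)).comp (ContinuousLinearMap.proj j)) p :=
    ((RCLike.ofRealCLM (K := 𝕜)).comp
      (ContinuousLinearMap.proj (R := ℝ) (φ := fun _ : Fin 3 => ℝ) j)).hasFDerivAt
  rw [h.fderiv]
  by_cases hij : i = j
  · subst hij; simp
  · rw [if_neg hij]; simp [Pi.single_eq_of_ne (Ne.symm hij)]

/-- The coefficient `N t` of the leading term of `x̂`. -/
noncomputable def leadingCoeff (𝕜 : Type*) [RCLike 𝕜] (U : TopologicalSpace.Opens (Fin 3 → ℝ))
    (N : ℕ) : SmoothFun 𝕜 U := (N : SmoothFun 𝕜 U) * coord 𝕜 U 2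

theorem leadingCoeff_apply (N : ℕ) (q : U) :
    (leadingCoeff 𝕜 U N).1 q = N * ((q.1 2 : ℝ) : 𝕜) := rfl

theorem pderiv_leadingCoeff (N : ℕ) (i : Fin 3) :
    pderiv 𝕜 U i (leadingCoeff 𝕜 U N) = if i = 2 then (N : SmoothFun 𝕜 U) else 0 := by
  rw [leadingCoeff, Derivation.leibniz, pderiv_coord, Derivation.map_natCast]
  split_ifs <;> simp

theorem deriv_coord_zero : (coord 𝕜 U 0)′ = 1 := by rw [deriv_eq_pderiv, pderiv_coord]; rfl

theorem deriv_coord_one : (coord 𝕜 U 1)′ = 0 := by rw [deriv_eq_pderiv, pderiv_coord]; rfl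

theorem deriv_leadingCoeff (N : ℕ) : (leadingCoeff 𝕜 U N)′ = 0 := by
  rw [deriv_eq_pderiv, pderiv_leadingCoeff]; rfl

theorem deriv_algebraMap_const (c : 𝕜) : (algebraMap 𝕜 (SmoothFun 𝕜 U) c)′ = 0 :=
  Derivation.map_algebraMap (pderiv 𝕜 U 0) c

theorem frozenXhat_eq {N : ℕ} (hN : 3 ≤ N) (t₀ : 𝕜) : frozenXhat U N t₀ =
    PDO.xop N (coord 𝕜 U 0) (coord 𝕜 U 1) (leadingCoeff 𝕜 U N) (algebraMap 𝕜 _ t₀) := by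
  have h : ∑ k ∈ Finset.Icc 1 N, PDO.single ((k : ℤ) - 1) ((k : SmoothFun 𝕜 U) *
      frozenTimes 𝕜 U N k) = ∑ k ∈ {1, 2, N}, PDO.single ((k : ℤ) - 1) ((k : SmoothFun 𝕜 U) *
      frozenTimes 𝕜 U N k) := by
    refine (Finset.sum_subset (fun k hk => ?_) fun k _ hk => ?_).symm
    · simp only [Finset.mem_insert, Finset.mem_singleton] at hk
      rw [Finset.mem_Icc]; omega
    · simp only [Finset.mem_insert, Finset.mem_singleton, not_or] at hk
      rw [frozenTimes, if_neg hk.1, if_neg hk.2.1, if_neg hk.2.2, mul_zero, PDO.single_zero]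
  have h1 : frozenTimes 𝕜 U N 1 = coord 𝕜 U 0 := rfl
  have h2 : frozenTimes 𝕜 U N 2 = coord 𝕜 U 1 := rfl
  have h3 : frozenTimes 𝕜 U N N = coord 𝕜 U 2 := by
    rw [frozenTimes, if_neg (by omega), if_neg (by omega), if_pos rfl]
  rw [frozenXhat, PDO.xhat, h, Finset.sum_insert (by simp; omega), Finset.sum_insert (by simp; omega),
    Finset.sum_singleton, h1, h2, h3, PDO.xop, leadingCoeff]
  push_cast
  rw [one_mul]
  abel

/-- The operator `x̂` evolves by Lax equations in the times `y` and `t`. -/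
theorem evolvesBy_frozenXhat {N : ℕ} (hN : 3 ≤ N) (t₀ : 𝕜) :
    PDO.EvolvesBy (pderiv 𝕜 U 1) (PDO.D 2) (frozenXhat U N t₀) ∧
      PDO.EvolvesBy (pderiv 𝕜 U 2) (PDO.D N) (frozenXhat U N t₀) := by
  have hx := deriv_coord_zero (𝕜 := 𝕜) (U := U)
  have hy := deriv_coord_one (𝕜 := 𝕜) (U := U)
  have hz := deriv_leadingCoeff (𝕜 := 𝕜) (U := U) N
  have ht := deriv_algebraMap_const (U := U) t₀
  have h2 : ∀ i, pderiv 𝕜 U i 2 = 0 := fun i => Derivation.map_natCast (pderiv 𝕜 U i) 2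
  unfold PDO.EvolvesBy
  rw [frozenXhat_eq hN, PDO.D_commutator_xop _ hx hy hz ht, PDO.D_commutator_xop _ hx hy hz ht,
    PDO.mapDeriv_xop, PDO.mapDeriv_xop, Derivation.map_algebraMap, Derivation.map_algebraMap,
    Derivation.leibniz, Derivation.leibniz, h2, h2, pderiv_leadingCoeff, pderiv_leadingCoeff]
  simp [pderiv_coord]

theorem exists_mul_eq_one {f : SmoothFun 𝕜 U} (hf : ∀ q : U, f.1 q ≠ 0) :
    ∃ u : SmoothFun 𝕜 U, f * u = 1 ∧ ∀ q : U, u.1 q = (f.1 q)⁻¹ := by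
  refine ⟨⟨fun q => (f.1 q)⁻¹, ?_⟩, ?_, fun q => rfl⟩
  · have h := ((contDiffOn_extZero f).inv (fun p hp => by
      rw [extZero_apply _ hp]; exact hf ⟨p, hp⟩))
    exact h.congr fun p hp => by
      rw [extend_coe _ hp, Pi.inv_apply, extZero_apply _ hp]
  · ext q
    exact mul_inv_cancel₀ (hf q)

theorem isUnit_leadingCoeff {N : ℕ} (hN : N ≠ 0)
    (hU : (U : Set (Fin 3 → ℝ)) ⊆ {q | q 2 ≠ 0}) :
    ∃ u : SmoothFun 𝕜 U, leadingCoeff 𝕜 U N * u = 1 ∧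
      ∀ q : U, u.1 q = (N * ((q.1 2 : ℝ) : 𝕜))⁻¹ :=
  exists_mul_eq_one fun q => show (N * ((q.1 2 : ℝ) : 𝕜)) ≠ 0 from
    mul_ne_zero (by exact_mod_cast hN) (by exact_mod_cast hU q.2)

/-- The functions `(n choose k) (N t) ^ (n - k)`, which vanish for `0 ≤ n < k`. They are defined
on all of `U` if `n ≥ 0`, and where `t ≠ 0` otherwise. -/
noncomputable def monomial (𝕜 : Type*) [RCLike 𝕜] (U : TopologicalSpace.Opens (Fin 3 → ℝ))
    (N : ℕ) (n : ℤ) (k : ℕ) : SmoothFun 𝕜 U :=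
  ((Ring.choose n k : ℤ) : SmoothFun 𝕜 U) * if 0 ≤ n then leadingCoeff 𝕜 U N ^ (n - k).toNat
    else Ring.inverse (leadingCoeff 𝕜 U N) ^ (k - n).toNat

theorem choose_eq_zero_of_lt {n : ℤ} {k : ℕ} (h0 : 0 ≤ n) (h : n < k) : Ring.choose n k = 0 := by
  lift n to ℕ using h0
  rw [Ring.choose_natCast, Nat.choose_eq_zero_of_lt (by omega)]; rfl

theorem monomial_apply {N : ℕ} (hN : N ≠ 0) {n : ℤ}
    (hn : 0 ≤ n ∨ (U : Set (Fin 3 → ℝ)) ⊆ {q | q 2 ≠ 0}) (k : ℕ) (q : U) :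
    (monomial 𝕜 U N n k).1 q = (Ring.choose n k : ℤ) * (N * ((q.1 2 : ℝ) : 𝕜)) ^ (n - k) := by
  unfold monomial
  split_ifs with h
  · rcases lt_or_ge n k with hk | hk
    · rw [choose_eq_zero_of_lt h hk]; simp
    · have e : (n - k : ℤ) = ((n - k).toNat : ℤ) := by omega
      conv_rhs => rw [e, zpow_natCast]
      rfl
  · obtain ⟨u, hu, huq⟩ := isUnit_leadingCoeff (𝕜 := 𝕜) hN (hn.resolve_left h)
    have : Ring.inverse (leadingCoeff 𝕜 U N) = u := by
      have := Ring.inverse_unit (⟨_, u, hu, by rw [mul_comm, hu]⟩ : (SmoothFun 𝕜 U)ˣ)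
      exact this
    rw [this]
    have e : (n - k : ℤ) = -((k - n).toNat : ℤ) := by omega
    rw [e, zpow_neg, zpow_natCast, ← inv_pow, ← huq]
    rfl

theorem monomial_deriv (N : ℕ) (hN : N ≠ 0) {n : ℤ}
    (hn : 0 ≤ n ∨ (U : Set (Fin 3 → ℝ)) ⊆ {q | q 2 ≠ 0}) (k : ℕ) : (monomial 𝕜 U N n k)′ = 0 := by
  have hz := deriv_leadingCoeff (𝕜 := 𝕜) (U := U) N
  unfold monomial
  split_ifs with h
  · simp [Derivation.leibniz, Derivation.leibniz_pow, hz]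
  · obtain ⟨u, hu, -⟩ := isUnit_leadingCoeff (𝕜 := 𝕜) hN (hn.resolve_left h)
    have hi : Ring.inverse (leadingCoeff 𝕜 U N) = u :=
      Ring.inverse_unit (⟨_, u, hu, by rw [mul_comm, hu]⟩ : (SmoothFun 𝕜 U)ˣ)
    have hu' := PDO.deriv_inverse_mul hu
    rw [hz, zero_mul, neg_zero] at hu'
    have : u′ = 0 := by linear_combination u * hu' - u′ * hu
    rw [hi]
    simp [Derivation.leibniz, Derivation.leibniz_pow, this]

theorem monomial_zero_left (N : ℕ) (k : ℕ) : monomial 𝕜 U N 0 k = if k = 0 then 1 else 0 := by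
  unfold monomial
  cases k with
  | zero => simp
  | succ k => simp [Ring.choose_zero_succ]

/-- The rule `z z ^ (n - k) = z ^ (n - k + 1)` may fail for `z = 0`, but then `n ≥ 0` and the
exceptional case `n - k + 1 = 0` has `(n choose k) = 0`. -/
theorem choose_mul_zpow {n : ℤ} {k : ℕ} {Z : 𝕜} (h : 0 ≤ n ∨ Z ≠ 0) :
    (Ring.choose n k : ℤ) * (Z * Z ^ (n - k)) = (Ring.choose n k : ℤ) * Z ^ (n - k + 1) := by
  by_cases hk : n - k + 1 = 0
  · rcases h with h | h
    · rw [choose_eq_zero_of_lt h (by omega)]; simp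
    · rw [add_comm, zpow_one_add₀ h]
  · rw [add_comm, zpow_add' (Or.inr (Or.inl (by omega))), zpow_one]

theorem zero_le_or_ne_zero {N : ℕ} (hN : N ≠ 0) {n : ℤ}
    (hn : 0 ≤ n ∨ (U : Set (Fin 3 → ℝ)) ⊆ {q | q 2 ≠ 0}) (q : U) :
    0 ≤ n ∨ N * ((q.1 2 : ℝ) : 𝕜) ≠ 0 :=
  hn.imp_right fun h => mul_ne_zero (by exact_mod_cast hN) (by exact_mod_cast h q.2)

theorem monomial_succ_zero {N : ℕ} (hN : N ≠ 0) {n : ℤ}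
    (hn : 0 ≤ n ∨ (U : Set (Fin 3 → ℝ)) ⊆ {q | q 2 ≠ 0}) :
    monomial 𝕜 U N (n + 1) 0 = leadingCoeff 𝕜 U N * monomial 𝕜 U N n 0 := by
  ext q
  have h : (leadingCoeff 𝕜 U N * monomial 𝕜 U N n 0).1 q =
    (leadingCoeff 𝕜 U N).1 q * (monomial 𝕜 U N n 0).1 q := rfl
  have := choose_mul_zpow (k := 0) (zero_le_or_ne_zero (𝕜 := 𝕜) hN hn q)
  rw [h, monomial_apply hN (hn.imp_left (by omega)), monomial_apply hN hn, leadingCoeff_apply]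
  simp only [Ring.choose_zero_right, Nat.cast_zero, sub_zero, Int.cast_one, one_mul] at this ⊢
  exact this.symm

theorem monomial_succ_succ {N : ℕ} (hN : N ≠ 0) {n : ℤ}
    (hn : 0 ≤ n ∨ (U : Set (Fin 3 → ℝ)) ⊆ {q | q 2 ≠ 0}) (k : ℕ) :
    monomial 𝕜 U N (n + 1) (k + 1) = leadingCoeff 𝕜 U N * monomial 𝕜 U N n (k + 1)
      + monomial 𝕜 U N n k := by
  ext q
  have h : (leadingCoeff 𝕜 U N * monomial 𝕜 U N n (k + 1) + monomial 𝕜 U N n k).1 q =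
    (leadingCoeff 𝕜 U N).1 q * (monomial 𝕜 U N n (k + 1)).1 q + (monomial 𝕜 U N n k).1 q := rfl
  have := choose_mul_zpow (k := k + 1) (zero_le_or_ne_zero (𝕜 := 𝕜) hN hn q)
  rw [h, monomial_apply hN (hn.imp_left (by omega)), monomial_apply hN hn, monomial_apply hN hn,
    leadingCoeff_apply, Ring.choose_succ_succ, mul_left_comm, this]
  rw [show n - ((k + 1 : ℕ) : ℤ) + 1 = n - k by push_cast; ring,
    show n + 1 - ((k + 1 : ℕ) : ℤ) = n - k by push_cast; ring]
  push_cast; ring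

end Smooth

section Flows

variable {𝕜 : Type*} [RCLike 𝕜] {U : TopologicalSpace.Opens (Fin 3 → ℝ)}

/-! ### The flows at the frozen times -/

theorem frozenXhat_inverse {N : ℕ} (hN : 3 ≤ N) (t₀ : 𝕜)
    (hU : (U : Set (Fin 3 → ℝ)) ⊆ {q | q 2 ≠ 0}) :
    IsUnit (frozenXhat U N t₀) ∧
      Ring.inverse (frozenXhat U N t₀) ∈ PDO.orderLE (SmoothFun 𝕜 U) (1 - N) ∧
      leadingCoeff 𝕜 U N * (Ring.inverse (frozenXhat U N t₀)).coeff (1 - N) = 1 := by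
  obtain ⟨u, hu, -⟩ := isUnit_leadingCoeff (𝕜 := 𝕜) (N := N) (by omega) hU
  rw [frozenXhat_eq hN]
  exact PDO.xop_inverse (by omega) hu (deriv_leadingCoeff N)

/-- Only the terms of `x̂ ^ n` at most `N + 1` orders below the top contribute to the flow, since
`α ≤ N`; here `N ≥ 4`. -/
theorem pFlow_eq_of_four_le {N : ℕ} (hN : 4 ≤ N) (t₀ : 𝕜) {m n : ℤ}
    (hn : 0 ≤ n ∨ (U : Set (Fin 3 → ℝ)) ⊆ {q | q 2 ≠ 0}) (hα : m - n + N * n ≤ N)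
    {K : PDO (SmoothFun 𝕜 U)} (hK : K.IsDressing) :
    pFlow N t₀ m n K = PDO.wFlow (PDO.xpow N (coord 𝕜 U 0) (coord 𝕜 U 1) (leadingCoeff 𝕜 U N)
      (algebraMap 𝕜 _ t₀) (monomial 𝕜 U N n) (m - n + N * n)) K := by
  have hX : frozenXhat U N t₀ ∈ PDO.orderLE (SmoothFun 𝕜 U) (N - 1) := by
    rw [frozenXhat_eq (N := N) (by omega)]; exact PDO.xop_mem_orderLE (by omega)
  have h0 : PDO.xpow N (coord 𝕜 U 0) (coord 𝕜 U 1) (leadingCoeff 𝕜 U N)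
      (algebraMap 𝕜 _ t₀) (monomial 𝕜 U N 0) ((N - 1 : ℤ) * 0) = 1 := by
    simp [PDO.xpow, monomial_zero_left, PDO.one_eq_single]
  have key := PDO.zpow_sub_mem hX (d := N + 2) (fun n => PDO.xpow N (coord 𝕜 U 0) (coord 𝕜 U 1)
      (leadingCoeff 𝕜 U N) (algebraMap 𝕜 _ t₀) (monomial 𝕜 U N n) ((N - 1) * n)) h0 n
    (hn.imp_right fun h => by
      have := frozenXhat_inverse (N := N) (by omega) t₀ h
      rw [neg_sub]; exact ⟨this.1, this.2.1⟩) (fun k hk => by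
      have hk' : 0 ≤ k ∨ (U : Set (Fin 3 → ℝ)) ⊆ {q | q 2 ≠ 0} :=
        hk.imp_right fun h => hn.resolve_left (by omega)
      have := PDO.xop_mul_xpow (s := monomial 𝕜 U N k) (s' := monomial 𝕜 U N (k + 1))
        deriv_coord_zero deriv_coord_one (deriv_leadingCoeff N) (deriv_algebraMap_const t₀)
        (monomial_deriv N (by omega) hk') (monomial_succ_zero (by omega) hk')
        (monomial_succ_succ (by omega) hk') (N := N) (by omega) ((N - 1) * k)
      rw [frozenXhat_eq (N := N) (by omega), mul_add_one]
      convert this using 2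
      ring)
  refine PDO.wFlow_congr hK ?_
  have e : m - n + N * n = (N - 1) * n + m := by ring
  rw [e, ← PDO.xpow_mul_D, ← sub_mul]
  exact PDO.mul_mem_orderLE key (PDO.D_mem_orderLE m) (by linarith)

/-- Only the terms of `x̂ ^ n` at most `4` orders below the top contribute to the flow, for
`N = 3`. -/
theorem pFlow_eq_of_three (t₀ : 𝕜) {m n : ℤ}
    (hn : 0 ≤ n ∨ (U : Set (Fin 3 → ℝ)) ⊆ {q | q 2 ≠ 0}) (hα : m - n + 3 * n ≤ 3)
    {K : PDO (SmoothFun 𝕜 U)} (hK : K.IsDressing) :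
    pFlow 3 t₀ m n K = PDO.wFlow (PDO.xpowThree (coord 𝕜 U 0) (coord 𝕜 U 1) (leadingCoeff 𝕜 U 3)
      (algebraMap 𝕜 _ t₀) (monomial 𝕜 U 3 n) (m - n + 3 * n)) K := by
  have hX : frozenXhat U 3 t₀ ∈ PDO.orderLE (SmoothFun 𝕜 U) 2 := by
    rw [frozenXhat_eq (N := 3) le_rfl]; exact PDO.xop_mem_orderLE (N := ((3 : ℕ) : ℤ)) (by norm_num)
  have h0 : PDO.xpowThree (coord 𝕜 U 0) (coord 𝕜 U 1) (leadingCoeff 𝕜 U 3)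
      (algebraMap 𝕜 _ t₀) (monomial 𝕜 U 3 0) ((2 : ℤ) * 0) = 1 := by
    simp [PDO.xpowThree, monomial_zero_left, PDO.one_eq_single]
  have key := PDO.zpow_sub_mem hX (d := 5) (fun n => PDO.xpowThree (coord 𝕜 U 0) (coord 𝕜 U 1)
      (leadingCoeff 𝕜 U 3) (algebraMap 𝕜 _ t₀) (monomial 𝕜 U 3 n) (2 * n)) h0 n
    (hn.imp_right fun h => by
      have := frozenXhat_inverse (N := 3) le_rfl t₀ h
      exact ⟨this.1, this.2.1⟩) (fun k hk => by
      have hk' : 0 ≤ k ∨ (U : Set (Fin 3 → ℝ)) ⊆ {q | q 2 ≠ 0} :=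
        hk.imp_right fun h => hn.resolve_left (by omega)
      have := PDO.xop_mul_xpowThree (s := monomial 𝕜 U 3 k) (s' := monomial 𝕜 U 3 (k + 1))
        deriv_coord_zero deriv_coord_one (deriv_leadingCoeff 3) (deriv_algebraMap_const t₀)
        (monomial_deriv 3 (by omega) hk') (monomial_succ_zero (by omega) hk')
        (monomial_succ_succ (by omega) hk') (2 * k)
      rw [frozenXhat_eq (N := 3) le_rfl, mul_add_one]
      convert this using 2 <;> first | rfl | ring)
  refine PDO.wFlow_congr hK ?_
  have e : m - n + 3 * n = 2 * n + m := by ring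
  rw [e, ← PDO.xpowThree_mul_D, ← sub_mul]
  exact PDO.mul_mem_orderLE key (PDO.D_mem_orderLE m) (by linarith)

theorem mapDeriv_wOf (i : Fin 3) (K : PDO (SmoothFun 𝕜 U)) :
    PDO.wOf (K.mapDeriv (pderiv 𝕜 U i)) = pderiv 𝕜 U i (PDO.wOf K) := by
  have h : pderiv 𝕜 U i (-2) = 0 := by
    have := Derivation.map_intCast (pderiv 𝕜 U i) (-2)
    simpa using this
  rw [PDO.wOf, PDO.wOf, Derivation.leibniz, h, PDO.coeff_mapDeriv]
  simp

variable {N : ℕ} {K : PDO (SmoothFun 𝕜 U)}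

theorem IsKPSolution.wFlow_two (hK : IsKPSolution N K) :
    PDO.wFlow (PDO.D 2) K = pderiv 𝕜 U 1 (PDO.wOf K) := by
  rw [PDO.wFlow, ← hK.flow_y, mapDeriv_wOf]

theorem IsKPSolution.wFlow_last (hK : IsKPSolution N K) :
    PDO.wFlow (PDO.D N) K = pderiv 𝕜 U 2 (PDO.wOf K) := by
  rw [PDO.wFlow, ← hK.flow_t, mapDeriv_wOf]

theorem IsKPSolution.wFlow_one (hK : IsKPSolution N K) :
    PDO.wFlow (PDO.D 1) K = pderiv 𝕜 U 0 (PDO.wOf K) := PDO.wFlow_D_one hK.dressing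

theorem wFlow_D_zero (hK : K.IsDressing) : PDO.wFlow (PDO.D 0) K = 0 :=
  PDO.wFlow_single_zero hK 1

theorem wFlow_D_neg_one (hK : K.IsDressing) : PDO.wFlow (PDO.D (-1)) K = 2 := by
  rw [PDO.D, PDO.wFlow_single_neg_one hK, mul_one]

theorem wFlow_D_of_lt (hK : K.IsDressing) {i : ℤ} (hi : i < -1) : PDO.wFlow (PDO.D i) K = 0 :=
  PDO.wFlow_eq_zero hK (PDO.single_mem_orderLE (by omega) 1)

/-- The vector field `V_{mn} K` solves the equations linearized at `K`: the flow commutes with the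
flows in `y` and `t`. -/
theorem IsKPSolution.linearized (hN : 3 ≤ N) (hK : IsKPSolution N K) (t₀ : 𝕜) (m n : ℤ)
    (hn : 0 ≤ n ∨ (U : Set (Fin 3 → ℝ)) ⊆ {q | q 2 ≠ 0}) :
    let Λ := PDO.field ((frozenXhat U N t₀).zpow n * PDO.D m) K
    Λ.mapDeriv (pderiv 𝕜 U 1) = PDO.linField (PDO.D 2) K Λ ∧
      Λ.mapDeriv (pderiv 𝕜 U 2) = PDO.linField (PDO.D N) K Λ := by
  obtain ⟨h1, h2⟩ := evolvesBy_frozenXhat (U := U) hN t₀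
  have hu : 0 ≤ n ∨ IsUnit (frozenXhat U N t₀) :=
    hn.imp_right fun h => (frozenXhat_inverse hN t₀ h).1
  exact ⟨PDO.mapDeriv_field (pderiv_deriv 1) hK.dressing
      ((h1.zpow (pderiv_deriv 1) n hu).mul (pderiv_deriv 1) (PDO.EvolvesBy.D _ m)) hK.flow_y,
    PDO.mapDeriv_field (pderiv_deriv 2) hK.dressing
      ((h2.zpow (pderiv_deriv 2) n hu).mul (pderiv_deriv 2) (PDO.EvolvesBy.D _ m)) hK.flow_t⟩

/-- The operator `Λ`, of negative order, solves the equations linearized at `K`. -/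
def IsLinSolution (N : ℕ) (K Λ : PDO (SmoothFun 𝕜 U)) : Prop :=
  (∀ i, 0 ≤ i → Λ.coeff i = 0) ∧ Λ.mapDeriv (pderiv 𝕜 U 1) = PDO.linField (PDO.D 2) K Λ ∧
    Λ.mapDeriv (pderiv 𝕜 U 2) = PDO.linField (PDO.D N) K Λ

theorem linField_add (A K Λ Λ' : PDO (SmoothFun 𝕜 U)) :
    PDO.linField A K (Λ + Λ') = PDO.linField A K Λ + PDO.linField A K Λ' := by
  unfold PDO.linField
  have : (Λ + Λ') * A * Ring.inverse K - K * A * Ring.inverse K * (Λ + Λ') * Ring.inverse K =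
      (Λ * A * Ring.inverse K - K * A * Ring.inverse K * Λ * Ring.inverse K) +
      (Λ' * A * Ring.inverse K - K * A * Ring.inverse K * Λ' * Ring.inverse K) := by noncomm_ring
  rw [this, PDO.minus_add]; noncomm_ring

theorem minus_single_zero_mul (a : SmoothFun 𝕜 U) (P : PDO (SmoothFun 𝕜 U)) :
    PDO.minus (PDO.single 0 a * P) = PDO.single 0 a * PDO.minus P := by
  ext1 i
  rw [PDO.coeff_minus, PDO.coeff_single_zero_mul, PDO.coeff_single_zero_mul, PDO.coeff_minus]
  split_ifs <;> simp

theorem linField_smul {a : SmoothFun 𝕜 U} (ha : a′ = 0) (A K Λ : PDO (SmoothFun 𝕜 U)) :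
    PDO.linField A K (PDO.single 0 a * Λ) = PDO.single 0 a * PDO.linField A K Λ := by
  have hc := fun P => (PDO.commute_single_zero ha P).eq
  unfold PDO.linField
  have e : PDO.single 0 a * Λ * A * Ring.inverse K
      - K * A * Ring.inverse K * (PDO.single 0 a * Λ) * Ring.inverse K = PDO.single 0 a *
        (Λ * A * Ring.inverse K - K * A * Ring.inverse K * Λ * Ring.inverse K) := by
    rw [← mul_assoc (K * A * Ring.inverse K), ← hc (K * A * Ring.inverse K)]; noncomm_ring
  rw [e, minus_single_zero_mul, ← mul_assoc (PDO.minus (K * A * Ring.inverse K)), ← hc (PDO.minus _)]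
  noncomm_ring

theorem IsLinSolution.zero : IsLinSolution N K 0 := by
  have h : ∀ A, PDO.linField A K (0 : PDO (SmoothFun 𝕜 U)) = 0 := fun A => by
    have := linField_add A K 0 0
    rw [add_zero] at this
    exact left_eq_add.mp this
  refine ⟨fun _ _ => rfl, ?_, ?_⟩ <;>
  · rw [h]; ext1 i; rw [PDO.coeff_mapDeriv, PDO.coeff_zero, map_zero]

theorem IsLinSolution.add {Λ Λ' : PDO (SmoothFun 𝕜 U)} (h : IsLinSolution N K Λ)
    (h' : IsLinSolution N K Λ') : IsLinSolution N K (Λ + Λ') :=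
  ⟨fun i hi => by rw [PDO.coeff_add, h.1 i hi, h'.1 i hi, add_zero],
    by rw [PDO.mapDeriv_add, linField_add, h.2.1, h'.2.1],
    by rw [PDO.mapDeriv_add, linField_add, h.2.2, h'.2.2]⟩

theorem IsLinSolution.const_mul {Λ : PDO (SmoothFun 𝕜 U)} (h : IsLinSolution N K Λ) (c : 𝕜) :
    IsLinSolution N K (PDO.single 0 (algebraMap 𝕜 _ c) * Λ) := by
  have hm : ∀ i, (PDO.single 0 (algebraMap 𝕜 (SmoothFun 𝕜 U) c) * Λ).mapDeriv (pderiv 𝕜 U i) =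
      PDO.single 0 (algebraMap 𝕜 (SmoothFun 𝕜 U) c) * Λ.mapDeriv (pderiv 𝕜 U i) := fun i => by
    rw [PDO.mapDeriv_mul (pderiv_deriv i), PDO.mapDeriv_single, Derivation.map_algebraMap,
      PDO.single_zero, zero_mul, zero_add]
  exact ⟨fun i hi => by rw [PDO.coeff_single_zero_mul, h.1 i hi, mul_zero],
    by rw [hm, linField_smul (deriv_algebraMap_const c), h.2.1],
    by rw [hm, linField_smul (deriv_algebraMap_const c), h.2.2]⟩

theorem field_coeff_of_nonneg (hK : K.IsDressing) (A : PDO (SmoothFun 𝕜 U)) (i : ℤ) (hi : 0 ≤ i) :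
    (PDO.field A K).coeff i = 0 :=
  PDO.mul_mem_orderLE (PDO.neg_mem_orderLE (PDO.minus_mem_orderLE _)) hK.mem le_rfl i (by omega)

/-- Finite linear combinations of the flows of `w` come from solutions of the linearized
equations. -/
theorem exists_isLinSolution (hN : 3 ≤ N) (hK : IsKPSolution N K) (t₀ : 𝕜) (c : ℤ × ℤ →₀ 𝕜)
    (hc : ∀ a ∈ c.support, 0 ≤ a.2 ∨ (U : Set (Fin 3 → ℝ)) ⊆ {q | q 2 ≠ 0}) :
    ∃ Λ, IsLinSolution N K Λ ∧
      ∀ q : U, (PDO.wOf Λ).1 q = c.sum fun a z => z * (pFlow N t₀ a.1 a.2 K).1 q := by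
  have key : ∀ s ⊆ c.support, ∃ Λ, IsLinSolution N K Λ ∧
      ∀ q : U, (PDO.wOf Λ).1 q = ∑ a ∈ s, c a * (pFlow N t₀ a.1 a.2 K).1 q := by
    intro s
    induction s using Finset.induction_on with
    | empty => exact fun _ => ⟨0, .zero, fun q => by simp [PDO.wOf]⟩
    | insert a s ha ih =>
      intro hs
      obtain ⟨Λ, h1, h2⟩ := ih fun b hb => hs (Finset.mem_insert_of_mem hb)
      have h3 : IsLinSolution N K (PDO.field ((frozenXhat U N t₀).zpow a.2 * PDO.D a.1) K) :=
        ⟨field_coeff_of_nonneg hK.dressing _,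
          hK.linearized hN t₀ a.1 a.2 (hc a (hs (Finset.mem_insert_self a s)))⟩
      refine ⟨_, (h3.const_mul (c a)).add h1, fun q => ?_⟩
      have e : PDO.wOf (PDO.single 0 (algebraMap 𝕜 _ (c a)) *
          PDO.field ((frozenXhat U N t₀).zpow a.2 * PDO.D a.1) K + Λ) =
          algebraMap 𝕜 _ (c a) * pFlow N t₀ a.1 a.2 K + PDO.wOf Λ := by
        simp only [pFlow, PDO.wFlow, PDO.wOf, PDO.coeff_add, PDO.coeff_single_zero_mul]; ring
      rw [Finset.sum_insert ha, ← h2, e]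
      rfl
  exact key c.support subset_rfl

end Flows

section Solutions

open scoped ContDiff

variable {𝕜 : Type*} [RCLike 𝕜]

/-! ### Solutions with prescribed first derivatives at a point -/

/-- The exponential `exp (a (x - x₀) + a ^ 2 (y - y₀) + a ^ N (t - t_*))`, where
`(x₀, y₀, t_*) = q`. -/
noncomputable def planeWave (𝕜 : Type*) [RCLike 𝕜] (U : TopologicalSpace.Opens (Fin 3 → ℝ)) (N : ℕ)
    (q : Fin 3 → ℝ) (a : ℝ) : SmoothFun 𝕜 U :=
  ⟨fun p => ((Real.exp (a * (p.1 0 - q 0) + a ^ 2 * (p.1 1 - q 1) + a ^ N * (p.1 2 - q 2)) : ℝ) : 𝕜),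
    by
    have h : ContDiff ℝ ∞ (fun p : Fin 3 → ℝ => RCLike.ofRealCLM (K := 𝕜)
        (Real.exp (a * (p 0 - q 0) + a ^ 2 * (p 1 - q 1) + a ^ N * (p 2 - q 2)))) := by
      refine (RCLike.ofRealCLM (K := 𝕜)).contDiff.comp (Real.contDiff_exp.comp ?_)
      fun_prop
    exact h.contDiffOn.congr fun p hp => extend_coe _ hp⟩

theorem planeWave_self {U : TopologicalSpace.Opens (Fin 3 → ℝ)} (N : ℕ) (q : U) (a : ℝ) :
    (planeWave 𝕜 U N q a).1 q = 1 := by simp [planeWave]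

theorem pderiv_planeWave {U : TopologicalSpace.Opens (Fin 3 → ℝ)} (N : ℕ) (q : Fin 3 → ℝ) (a : ℝ)
    (i : Fin 3) : pderiv 𝕜 U i (planeWave 𝕜 U N q a) =
      (((![a, a ^ 2, a ^ N] i : ℝ) : 𝕜)) • planeWave 𝕜 U N q a := by
  ext ⟨p, hp⟩
  rw [pderiv_apply, fderiv_extZero_congr (g := fun p => RCLike.ofRealCLM (K := 𝕜)
        (Real.exp (a * (p 0 - q 0) + a ^ 2 * (p 1 - q 1) + a ^ N * (p 2 - q 2)))) _
    (fun r hr => by rw [extZero_apply _ hr]; rfl) hp]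
  have hpr : ∀ j : Fin 3, HasFDerivAt (fun p : Fin 3 → ℝ => p j - q j)
      (ContinuousLinearMap.proj (R := ℝ) (φ := fun _ : Fin 3 => ℝ) j) p := fun j =>
    ((ContinuousLinearMap.proj (R := ℝ) (φ := fun _ : Fin 3 => ℝ) j).hasFDerivAt).sub_const (q j)
  have h := (RCLike.ofRealCLM (K := 𝕜)).hasFDerivAt.comp p
    ((((hpr 0).const_mul a).add ((hpr 1).const_mul (a ^ 2))).add ((hpr 2).const_mul (a ^ N))).exp
  have h' : fderiv ℝ (fun p : Fin 3 → ℝ => RCLike.ofRealCLM (K := 𝕜)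
        (Real.exp (a * (p 0 - q 0) + a ^ 2 * (p 1 - q 1) + a ^ N * (p 2 - q 2)))) p = _ := h.fderiv
  rw [h']
  have e : ((((![a, a ^ 2, a ^ N] i : ℝ) : 𝕜)) • planeWave 𝕜 U N q a).1 ⟨p, hp⟩ =
    ((![a, a ^ 2, a ^ N] i : ℝ) : 𝕜) * ((Real.exp (a * (p 0 - q 0) + a ^ 2 * (p 1 - q 1)
      + a ^ N * (p 2 - q 2)) : ℝ) : 𝕜) := rfl
  rw [e]
  fin_cases i <;> simp [RCLike.real_smul_eq_coe_mul] <;> ring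

/-- Moments of a combination of point masses at `0, …, n - 1` can be prescribed, by the
invertibility of the Vandermonde matrix. -/
theorem exists_moments (n : ℕ) (β : ℕ → 𝕜) :
    ∃ c : Fin n → 𝕜, ∀ j < n, ∑ i, c i * (((i : ℕ) : ℝ) : 𝕜) ^ j = β j := by
  classical
  let V := Matrix.vandermonde fun i : Fin n => ((((i : ℕ) : ℝ)) : 𝕜)
  have hV : IsUnit V.det := by
    rw [isUnit_iff_ne_zero]
    refine Matrix.det_vandermonde_ne_zero_iff.mpr fun i j h => ?_
    have : ((i : ℕ) : ℝ) = (j : ℕ) := by exact_mod_cast h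
    exact Fin.ext (by exact_mod_cast this)
  refine ⟨Matrix.vecMul (fun j : Fin n => β j) V⁻¹, fun j hj => ?_⟩
  have h : Matrix.vecMul (Matrix.vecMul (fun j : Fin n => β j) V⁻¹) V = fun j : Fin n => β j := by
    rw [Matrix.vecMul_vecMul, Matrix.nonsing_inv_mul V hV, Matrix.vecMul_one]
  exact congrFun h ⟨j, hj⟩

/-- At any point there are solutions for which `w` and its derivatives with respect to the first
`N` times have prescribed values. -/
theorem exists_solution (N : ℕ) {Ω : Set (Fin 3 → ℝ)} (hΩ : IsOpen Ω) {q : Fin 3 → ℝ} (hq : q ∈ Ω)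
    (w₀ : 𝕜) (b : ℕ → 𝕜) :
    ∃ (U : TopologicalSpace.Opens (Fin 3 → ℝ)) (_ : (U : Set (Fin 3 → ℝ)) ⊆ Ω) (hqU : q ∈ U)
      (K : PDO (SmoothFun 𝕜 U)), IsKPSolution N K ∧ (PDO.wOf K).1 ⟨q, hqU⟩ = w₀ ∧
        ∀ k : ℕ, 1 ≤ k → k ≤ N → (PDO.wFlow (PDO.D k) K).1 ⟨q, hqU⟩ = b k := by
  -- `φ` is a combination of plane waves with `φ = 1`, `φ' = 0` and `(k + 1)`-st derivative
  -- `b k / 2` at `q`, so that `w = -2 c` and `w_{t_k} = b k` at `q` for the dressing operator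
  -- `(∂ - φ'/φ) ∂⁻¹ (1 + c ∂⁻¹)`
  obtain ⟨c, hc⟩ := exists_moments (N + 2)
    (fun j => if j = 0 then (1 : 𝕜) else if j = 1 then 0 else b (j - 1) / 2)
  let φ : ∀ U : TopologicalSpace.Opens (Fin 3 → ℝ), SmoothFun 𝕜 U := fun U =>
    ∑ i, c i • planeWave 𝕜 U N q (i : ℕ)
  let Φ : (Fin 3 → ℝ) → 𝕜 := extZero (φ ⊤)
  have hΦ : Continuous Φ := by
    have h : ContDiffOn ℝ ∞ Φ Set.univ := contDiffOn_extZero (φ ⊤)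
    exact (contDiffOn_univ.mp h).continuous
  have hsum : ∀ (U : TopologicalSpace.Opens (Fin 3 → ℝ)) (f : Fin (N + 2) → SmoothFun 𝕜 U) (p : U),
      (∑ i, f i).1 p = ∑ i, (f i).1 p := fun U f p => by
    rw [AddSubmonoidClass.coe_finsetSum, Finset.sum_apply]
  have hφΦ : ∀ (U : TopologicalSpace.Opens (Fin 3 → ℝ)) (p : U), (φ U).1 p = Φ p := by
    intro U p
    have : Φ p = (φ ⊤).1 ⟨p, trivial⟩ := extZero_apply _ _
    rw [this, hsum, hsum]
    rfl
  let U : TopologicalSpace.Opens (Fin 3 → ℝ) :=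
    ⟨Ω ∩ {p | Φ p ≠ 0}, hΩ.inter (isOpen_ne_fun hΦ continuous_const)⟩
  -- the derivatives of `φ`
  have hder : ∀ (U : TopologicalSpace.Opens (Fin 3 → ℝ)) (k : ℕ),
      (Differential.deriv (R := SmoothFun 𝕜 U))^[k] (φ U) =
      ∑ i, (c i * (((i : ℕ) : ℝ) : 𝕜) ^ k) • planeWave 𝕜 U N q (i : ℕ) := by
    intro U k
    induction k with
    | zero => simp [φ]
    | succ k ih =>
      rw [Function.iterate_succ_apply', ih, deriv_eq_pderiv, map_sum]
      refine Finset.sum_congr rfl fun i _ => ?_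
      rw [Derivation.map_smul, pderiv_planeWave, smul_smul]
      congr 1
      simp; ring
  have hflow : ∀ (U : TopologicalSpace.Opens (Fin 3 → ℝ)) (j : Fin 3) (k : ℕ),
      (∀ a : ℝ, ![a, a ^ 2, a ^ N] j = a ^ k) →
      pderiv 𝕜 U j (φ U) = (Differential.deriv (R := SmoothFun 𝕜 U))^[k] (φ U) := by
    intro U j k hjk
    rw [hder, map_sum]
    refine Finset.sum_congr rfl fun i _ => ?_
    rw [Derivation.map_smul, pderiv_planeWave, smul_smul, hjk]
    simp
  have hval : ∀ (U : TopologicalSpace.Opens (Fin 3 → ℝ)) (hqU : q ∈ U) (k : ℕ), k < N + 2 →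
      ((Differential.deriv (R := SmoothFun 𝕜 U))^[k] (φ U)).1 ⟨q, hqU⟩ =
      if k = 0 then (1 : 𝕜) else if k = 1 then 0 else b (k - 1) / 2 := by
    intro U hqU k hk
    rw [hder, hsum, ← hc k hk]
    refine Finset.sum_congr rfl fun i _ => ?_
    have : (planeWave 𝕜 U N q (i : ℕ)).1 ⟨q, hqU⟩ = 1 := planeWave_self N ⟨q, hqU⟩ _
    exact (congrArg (fun r => c i * (((i : ℕ) : ℝ) : 𝕜) ^ k * r) this).trans (mul_one _)
  have hqU : q ∈ U := by
    refine ⟨hq, ?_⟩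
    have h1 := hval ⊤ trivial 0 (by omega)
    have h2 := hφΦ ⊤ ⟨q, trivial⟩
    simp only [Function.iterate_zero, id_eq, if_true] at h1
    rw [Set.mem_ofPred_eq, ← h2, h1]
    exact one_ne_zero
  obtain ⟨v, hv, hvq⟩ := exists_mul_eq_one (f := φ U) fun p => by rw [hφΦ]; exact p.2.2
  have hC := Derivation.map_algebraMap (pderiv 𝕜 U 0) (-w₀ / 2)
  refine ⟨U, Set.inter_subset_left, hqU, PDO.rankOne (φ U) v (algebraMap 𝕜 _ (-w₀ / 2)),
    ⟨PDO.rankOne_isDressing, ?_, ?_⟩, ?_, ?_⟩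
  · exact PDO.mapDeriv_rankOne hv hC (pderiv_deriv 1) (hflow U 1 2 fun a => rfl)
      (Derivation.map_algebraMap (pderiv 𝕜 U 1) _)
  · exact PDO.mapDeriv_rankOne hv hC (pderiv_deriv 2) (hflow U 2 N fun a => rfl)
      (Derivation.map_algebraMap (pderiv 𝕜 U 2) _)
  · rw [PDO.wOf_rankOne]
    have h1 := hval U hqU 1 (by omega)
    have e : (2 * ((φ U)′ * v) - 2 * algebraMap 𝕜 (SmoothFun 𝕜 U) (-w₀ / 2)).1 ⟨q, hqU⟩ =
      2 * (((Differential.deriv (R := SmoothFun 𝕜 U))^[1] (φ U)).1 ⟨q, hqU⟩ * v.1 ⟨q, hqU⟩)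
        - 2 * (-w₀ / 2) := rfl
    rw [e, h1]
    simp
    ring
  · intro k hk hkN
    rw [PDO.wFlow_rankOne hv hC, Derivation.leibniz]
    have hv' := PDO.deriv_inverse_mul hv
    have h0 := hval U hqU 0 (by omega)
    have h1 := hval U hqU 1 (by omega)
    have h2 := hval U hqU (k + 1) (by omega)
    have hv'q : (v′).1 ⟨q, hqU⟩ = 0 := by
      have e := congrArg (fun f => f.1 ⟨q, hqU⟩) hv'
      have e' : (φ U).1 ⟨q, hqU⟩ * (v′).1 ⟨q, hqU⟩ =
        -(((Differential.deriv (R := SmoothFun 𝕜 U))^[1] (φ U)).1 ⟨q, hqU⟩ * v.1 ⟨q, hqU⟩) := e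
      rw [h1] at e'
      simp only [Function.iterate_zero, id_eq, if_true] at h0
      rw [h0] at e'
      simpa using e'
    have hvq1 : v.1 ⟨q, hqU⟩ = 1 := by
      rw [hvq]
      simp only [Function.iterate_zero, id_eq, if_true] at h0
      rw [h0, inv_one]
    rw [← Function.iterate_succ_apply' (f := Differential.deriv)]
    have e : (2 * (v • (Differential.deriv (R := SmoothFun 𝕜 U))^[k + 1] (φ U) +
        (Differential.deriv (R := SmoothFun 𝕜 U))^[k] (φ U) • v′)).1 ⟨q, hqU⟩ =
      2 * (v.1 ⟨q, hqU⟩ * ((Differential.deriv (R := SmoothFun 𝕜 U))^[k + 1] (φ U)).1 ⟨q, hqU⟩ +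
        ((Differential.deriv (R := SmoothFun 𝕜 U))^[k] (φ U)).1 ⟨q, hqU⟩ * (v′).1 ⟨q, hqU⟩) := rfl
    rw [e, h2, hv'q, hvq1, if_neg (by omega), if_neg (by omega)]
    simp
    ring

end Solutions

section Evaluation

variable {𝕜 : Type*} [RCLike 𝕜] {U : TopologicalSpace.Opens (Fin 3 → ℝ)}

/-! ### Derivatives of powers of `t` -/

/-- Successive derivatives on an open set are the iterated derivatives. -/
theorem iteratedDeriv_eq_of_hasDerivAt {O : Set ℝ} (hO : IsOpen O) {f : ℕ → ℝ → 𝕜}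
    (hf : ∀ k, ∀ t ∈ O, HasDerivAt (f k) (f (k + 1) t) t) (k : ℕ) :
    ∀ t ∈ O, iteratedDeriv k (f 0) t = f k t := by
  induction k with
  | zero => intro t _; rw [iteratedDeriv_zero]
  | succ k ih =>
    intro t ht
    rw [iteratedDeriv_succ, Filter.EventuallyEq.deriv_eq
      (Filter.eventually_of_mem (hO.mem_nhds ht) ih), (hf k t ht).deriv]

theorem choose_mul_sub (n : ℤ) (k : ℕ) :
    ((k : ℤ) + 1) * Ring.choose n (k + 1) = Ring.choose n k * (n - k) := by
  have h := Ring.choose_smul_choose n (Nat.le_succ k)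
  rw [Nat.succ_eq_add_one, Nat.choose_succ_self_right, Nat.add_sub_cancel_left,
    Ring.choose_one_right, nsmul_eq_mul] at h
  exact_mod_cast h

theorem hasDerivAt_const_mul_zpow {a : 𝕜} (ha : a ≠ 0) {j : ℤ} (k : ℕ) {t : ℝ}
    (h : 0 ≤ j ∨ t ≠ 0) (c : 𝕜) :
    HasDerivAt (fun t : ℝ => c * a ^ k * (k.factorial * (Ring.choose j k : ℤ)) *
        (a * (t : 𝕜)) ^ (j - k))
      (c * a ^ (k + 1) * ((k + 1).factorial * (Ring.choose j (k + 1) : ℤ)) *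
        (a * (t : 𝕜)) ^ (j - (k + 1 : ℕ))) t := by
  by_cases hk : 0 ≤ j ∧ j < k
  · rw [choose_eq_zero_of_lt hk.1 hk.2, choose_eq_zero_of_lt hk.1 (by push_cast; omega)]
    simpa using hasDerivAt_const t (0 : 𝕜)
  have h1 : HasDerivAt (fun t : ℝ => a * (t : 𝕜)) a t := by
    simpa using ((RCLike.ofRealCLM (K := 𝕜)).hasDerivAt (x := t)).const_mul a
  have h2 : a * (t : 𝕜) ≠ 0 ∨ 0 ≤ j - k := by
    rcases h with h | h
    · right; omega
    · left; exact mul_ne_zero ha (by exact_mod_cast h)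
  have h3 := ((hasDerivAt_zpow (j - k) (a * (t : 𝕜)) h2).scomp t h1).const_mul
    (c * a ^ k * (k.factorial * (Ring.choose j k : ℤ)))
  refine h3.congr_deriv ?_
  have e : ((k : 𝕜) + 1) * (Ring.choose j (k + 1) : ℤ) = (Ring.choose j k : ℤ) * (j - k) := by
    exact_mod_cast congrArg (Int.cast : ℤ → 𝕜) (choose_mul_sub j k)
  rw [show j - ((k + 1 : ℕ) : ℤ) = j - k - 1 by push_cast; ring, Nat.factorial_succ, smul_eq_mul]
  push_cast
  linear_combination (-c * a ^ (k + 1) * k.factorial * (a * (t : 𝕜)) ^ (j - k - 1 : ℤ)) * e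

/-- At `t = 0` the exponent `j - k` may be negative for `j ≥ 0`, but then `(j choose k) = 0`. -/
theorem iteratedDeriv_const_mul_zpow {a : 𝕜} (ha : a ≠ 0) {j : ℤ} (k : ℕ) {t : ℝ}
    (h : 0 ≤ j ∨ t ≠ 0) (c : 𝕜) :
    iteratedDeriv k (fun t : ℝ => c * (a * (t : 𝕜)) ^ j) t =
      c * a ^ k * (k.factorial * (Ring.choose j k : ℤ)) * (a * (t : 𝕜)) ^ (j - k) := by
  have hO : IsOpen {t : ℝ | 0 ≤ j ∨ t ≠ 0} := by
    by_cases hj : 0 ≤ j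
    · simp [hj]
    · simpa [hj] using isOpen_ne
  have := iteratedDeriv_eq_of_hasDerivAt hO (fun k t ht => hasDerivAt_const_mul_zpow ha k ht c) k t h
  rw [← this]
  congr 1
  ext t
  simp

/-- Evaluation at a point of `U`, as a ring homomorphism. -/
def evalHom (q : U) : SmoothFun 𝕜 U →+* 𝕜 :=
  (Pi.evalRingHom (fun _ : U => 𝕜) q).comp (SmoothFun 𝕜 U).val.toRingHom

theorem evalHom_apply (q : U) (f : SmoothFun 𝕜 U) : evalHom q f = f.1 q := rfl

theorem iteratedDeriv_pow_eq_monomial {N : ℕ} (hN : N ≠ 0) {n : ℤ}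
    (hn : 0 ≤ n ∨ (U : Set (Fin 3 → ℝ)) ⊆ {q | q 2 ≠ 0}) (q : U) (k : ℕ) :
    iteratedDeriv k (fun t : ℝ => (N * (t : 𝕜)) ^ n) (q.1 2) =
      N ^ k * k.factorial * evalHom q (monomial 𝕜 U N n k) := by
  have h := iteratedDeriv_const_mul_zpow (a := (N : 𝕜)) (by exact_mod_cast hN) k
    (hn.imp_right fun h => h q.2) 1
  simp only [one_mul] at h
  rw [h, evalHom_apply, monomial_apply hN hn]
  ring

theorem iteratedDeriv_zero_fun (k : ℕ) (t : ℝ) : iteratedDeriv k (0 : ℝ → 𝕜) t = 0 := by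
  have := iteratedDeriv_eq_of_hasDerivAt (𝕜 := 𝕜) isOpen_univ (f := fun _ _ => 0)
    (fun k t _ => hasDerivAt_const t 0) k t trivial
  exact this

/-! ### The evolution defined by a point field -/

/-- The evolution defined by the field of the functions `h_α`, as a linear expression in their
derivatives. -/
theorem lieField_char (N : ℕ) (t₀ : 𝕜) (hh : ℤ → ℝ → 𝕜) (w : SmoothFun 𝕜 U) (q : U) :
    (liePointField N t₀ hh).char w q =
      evalHom q (pderiv 𝕜 U 0 w) * (1 / N * evalHom q (coord 𝕜 U 0) * iteratedDeriv 1 (hh N) (q.1 2)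
        + iteratedDeriv 0 (hh 1) (q.1 2) + (if N = 3 then
          2 / 9 * evalHom q (coord 𝕜 U 1) ^ 2 * iteratedDeriv 2 (hh N) (q.1 2)
          + 2 / 3 * evalHom q (coord 𝕜 U 1) * iteratedDeriv 1 (hh 2) (q.1 2) else 0))
      + evalHom q (pderiv 𝕜 U 1 w) * (2 / N * evalHom q (coord 𝕜 U 1) *
        iteratedDeriv 1 (hh N) (q.1 2) + iteratedDeriv 0 (hh 2) (q.1 2))
      + evalHom q (pderiv 𝕜 U 2 w) * iteratedDeriv 0 (hh N) (q.1 2)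
      + 1 / N * evalHom q w * iteratedDeriv 1 (hh N) (q.1 2)
      + 2 * iteratedDeriv 0 (hh (-1)) (q.1 2)
      + (if N = 3 then
        1 / 9 * (evalHom q (coord 𝕜 U 0) ^ 2 + 4 * evalHom q (coord 𝕜 U 1) * t₀) *
            iteratedDeriv 2 (hh N) (q.1 2)
          + 4 / 27 * evalHom q (coord 𝕜 U 0) * evalHom q (coord 𝕜 U 1) ^ 2 *
            iteratedDeriv 3 (hh N) (q.1 2)
          + 4 / 243 * evalHom q (coord 𝕜 U 1) ^ 4 * iteratedDeriv 4 (hh N) (q.1 2)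
          + 2 / 3 * t₀ * iteratedDeriv 1 (hh 2) (q.1 2)
          + 4 / 9 * evalHom q (coord 𝕜 U 0) * evalHom q (coord 𝕜 U 1) *
            iteratedDeriv 2 (hh 2) (q.1 2)
          + 8 / 81 * evalHom q (coord 𝕜 U 1) ^ 3 * iteratedDeriv 3 (hh 2) (q.1 2)
          + 2 / 3 * evalHom q (coord 𝕜 U 0) * iteratedDeriv 1 (hh 1) (q.1 2)
          + 4 / 9 * evalHom q (coord 𝕜 U 1) ^ 2 * iteratedDeriv 2 (hh 1) (q.1 2)
          + 4 / 3 * evalHom q (coord 𝕜 U 1) * iteratedDeriv 1 (hh 0) (q.1 2)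
      else if N = 4 then
        1 / 4 * evalHom q (coord 𝕜 U 0) * evalHom q (coord 𝕜 U 1) * iteratedDeriv 2 (hh N) (q.1 2)
          + 1 / 2 * evalHom q (coord 𝕜 U 0) * iteratedDeriv 1 (hh 2) (q.1 2)
          + evalHom q (coord 𝕜 U 1) * iteratedDeriv 1 (hh 1) (q.1 2)
      else if N = 5 then
        4 / 25 * evalHom q (coord 𝕜 U 1) ^ 2 * iteratedDeriv 2 (hh N) (q.1 2)
          + 4 / 5 * evalHom q (coord 𝕜 U 1) * iteratedDeriv 1 (hh 2) (q.1 2)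
      else 0) := by
  have hx : evalHom q (coord 𝕜 U 0) = ((q.1 0 : ℝ) : 𝕜) := rfl
  have hy : evalHom q (coord 𝕜 U 1) = ((q.1 1 : ℝ) : 𝕜) := rfl
  simp only [hx, hy, liePointField, PointField.char, evalHom_apply]
  ring

end Evaluation

section Evaluation

variable {𝕜 : Type*} [RCLike 𝕜] {U : TopologicalSpace.Opens (Fin 3 → ℝ)}

/-! ### The flows with `α = N` or `α ≤ 2` at a point -/

theorem eval_wFlow_xpow_top {N : ℕ} (hN : 4 ≤ N) (t₀ : 𝕜) {n : ℤ}
    (hn : 0 ≤ n ∨ (U : Set (Fin 3 → ℝ)) ⊆ {q | q 2 ≠ 0})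
    {K : PDO (SmoothFun 𝕜 U)} (hK : IsKPSolution N K) (q : U) :
    evalHom q (PDO.wFlow (PDO.xpow N (coord 𝕜 U 0) (coord 𝕜 U 1) (leadingCoeff 𝕜 U N)
      (algebraMap 𝕜 _ t₀) (monomial 𝕜 U N n) N) K) = (liePointField N t₀
      (Pi.single (N : ℤ) (fun t : ℝ => (N * (t : 𝕜)) ^ n))).char (PDO.wOf K) q := by
  have hN0 : (N : 𝕜) ≠ 0 := by exact_mod_cast (by omega : N ≠ 0)
  have hs := monomial_deriv (𝕜 := 𝕜) N (by omega) hn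
  have hJ := iteratedDeriv_pow_eq_monomial (𝕜 := 𝕜) (N := N) (by omega) hn q
  have hN3 : N ≠ 3 := by omega
  rw [lieField_char, PDO.map_wFlow_xpow_top hK.dressing deriv_coord_zero deriv_coord_one hs _ (by omega),
    hK.wFlow_last, hK.wFlow_two,
    Pi.single_eq_same, Pi.single_eq_of_ne (by omega), Pi.single_eq_of_ne (by omega),
    Pi.single_eq_of_ne (by omega), Pi.single_eq_of_ne (by omega)]
  simp only [hJ, iteratedDeriv_zero_fun, if_neg hN3, deriv_eq_pderiv]
  obtain rfl | rfl | h6 : N = 4 ∨ N = 5 ∨ 6 ≤ N := by omega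
  · norm_num [Nat.factorial]
    ring
  · norm_num [Nat.factorial]
    ring
  · rw [if_neg (by omega), if_neg (by omega), if_neg (by omega), if_neg (by omega)]
    norm_num [Nat.factorial]
    field_simp
    ring

theorem eval_wFlow_xpow_of_le_two {N : ℕ} (hN : 4 ≤ N) (t₀ : 𝕜) {n α : ℤ}
    (hn : 0 ≤ n ∨ (U : Set (Fin 3 → ℝ)) ⊆ {q | q 2 ≠ 0}) (hα : α ≤ 2)
    {K : PDO (SmoothFun 𝕜 U)} (hK : IsKPSolution N K) (q : U) :
    evalHom q (PDO.wFlow (PDO.xpow N (coord 𝕜 U 0) (coord 𝕜 U 1) (leadingCoeff 𝕜 U N)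
      (algebraMap 𝕜 _ t₀) (monomial 𝕜 U N n) α) K) = (liePointField N t₀
      (Pi.single α (fun t : ℝ => (N * (t : 𝕜)) ^ n))).char (PDO.wOf K) q := by
  have hs := monomial_deriv (𝕜 := 𝕜) N (by omega) hn
  have hJ := iteratedDeriv_pow_eq_monomial (𝕜 := 𝕜) (N := N) (by omega) hn q
  have hN3 : N ≠ 3 := by omega
  rw [lieField_char,
    PDO.map_wFlow_xpow_of_lt hK.dressing deriv_coord_zero deriv_coord_one hs _ (by omega) (by omega),
    if_neg (by omega : ¬ α = N - 1), if_neg (by omega : ¬ α = N - 1),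
    if_neg (by omega : ¬ α = 2 * N - 5), Pi.single_eq_of_ne (show (N : ℤ) ≠ α by omega)]
  simp only [iteratedDeriv_zero_fun, if_neg hN3]
  obtain rfl | rfl | rfl | rfl | h : α = 2 ∨ α = 1 ∨ α = 0 ∨ α = -1 ∨ α < -1 := by omega
  · rw [hK.wFlow_two, Pi.single_eq_same (2 : ℤ),
      Pi.single_eq_of_ne (show (1 : ℤ) ≠ 2 by decide),
      Pi.single_eq_of_ne (show (-1 : ℤ) ≠ 2 by decide)]
    simp only [hJ, iteratedDeriv_zero_fun]
    obtain rfl | rfl | h6 : N = 4 ∨ N = 5 ∨ 6 ≤ N := by omega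
    · norm_num [Nat.factorial]
      ring
    · norm_num [Nat.factorial]
      ring
    · rw [if_neg (by omega), if_neg (by omega), if_neg (by omega), if_neg (by omega)]
      norm_num
      ring
  · rw [hK.wFlow_one, Pi.single_eq_same (1 : ℤ),
      Pi.single_eq_of_ne (show (2 : ℤ) ≠ 1 by decide),
      Pi.single_eq_of_ne (show (-1 : ℤ) ≠ 1 by decide)]
    simp only [hJ, iteratedDeriv_zero_fun]
    obtain rfl | h5 : N = 4 ∨ 5 ≤ N := by omega
    · norm_num [Nat.factorial, deriv_eq_pderiv]
      ring
    · rw [if_neg (by omega), if_neg (by omega), if_neg (by omega)]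
      norm_num
      ring
  · rw [wFlow_D_zero hK.dressing,
      Pi.single_eq_of_ne (show (2 : ℤ) ≠ 0 by decide),
      Pi.single_eq_of_ne (show (1 : ℤ) ≠ 0 by decide),
      Pi.single_eq_of_ne (show (-1 : ℤ) ≠ 0 by decide)]
    rw [if_neg (by omega), if_neg (by omega)]
    simp
  · rw [wFlow_D_neg_one hK.dressing, Pi.single_eq_same (-1 : ℤ),
      Pi.single_eq_of_ne (show (2 : ℤ) ≠ -1 by decide),
      Pi.single_eq_of_ne (show (1 : ℤ) ≠ -1 by decide)]
    rw [if_neg (by omega), if_neg (by omega)]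
    simp only [hJ, iteratedDeriv_zero_fun, map_ofNat]
    norm_num
    ring
  · rw [wFlow_D_of_lt hK.dressing h, if_neg (by omega), if_neg (by omega),
      Pi.single_eq_of_ne (show (2 : ℤ) ≠ α by omega),
      Pi.single_eq_of_ne (show (1 : ℤ) ≠ α by omega),
      Pi.single_eq_of_ne (show (-1 : ℤ) ≠ α by omega)]
    simp

/-- For `N ≥ 4` there is no secondary term. -/
theorem pFlow_apply_of_four_le {N : ℕ} (hN : 4 ≤ N) (t₀ : 𝕜) {m n : ℤ}
    (hn : 0 ≤ n ∨ (U : Set (Fin 3 → ℝ)) ⊆ {q | q 2 ≠ 0}) (hα : m - n + N * n ≤ N)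
    (hα' : ¬ (2 < m - n + N * n ∧ m - n + N * n < N))
    {K : PDO (SmoothFun 𝕜 U)} (hK : IsKPSolution N K) (q : U) :
    (pFlow N t₀ m n K).1 q = (liePointField N t₀
      (Pi.single (m - n + N * n) (fun t : ℝ => (N * (t : 𝕜)) ^ n))).char (PDO.wOf K) q := by
  rw [← evalHom_apply, pFlow_eq_of_four_le hN t₀ hn hα hK.dressing]
  generalize m - n + N * n = α at *
  obtain rfl | h : α = N ∨ α ≤ 2 := by omega
  · exact eval_wFlow_xpow_top hN t₀ hn hK q
  · exact eval_wFlow_xpow_of_le_two hN t₀ hn h hK q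

/-- The constant `c` of the secondary term `V^3(α - 3, c t ^ (n - 1))` of the flows for `N = 3`. It
collects the terms of `x̂ ^ n` that arise from `∂ x = x ∂ + 1`. -/
noncomputable def secondaryCoeff (𝕜 : Type*) [RCLike 𝕜] (α n : ℤ) : 𝕜 :=
  if α = 3 then 3 / 2 * (2 * n - 3) * n * 3 ^ (n - 2) else if α = 2 then n * (n - 1) * 3 ^ (n - 1)
  else 0

theorem iteratedDeriv_const_mul_pow_pred {n : ℤ} {t : ℝ} (hn : 0 ≤ n ∨ t ≠ 0) {c : 𝕜}
    (hc : n = 0 → c = 0) (k : ℕ) :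
    iteratedDeriv k (fun t : ℝ => c * (t : 𝕜) ^ (n - 1)) t =
      c * (k.factorial * (Ring.choose (n - 1) k : ℤ)) * (t : 𝕜) ^ (n - 1 - k) := by
  by_cases h0 : n = 0
  · rw [hc h0]
    simp
  · have := iteratedDeriv_const_mul_zpow (a := (1 : 𝕜)) one_ne_zero (j := n - 1) k (t := t)
      (hn.imp_left fun h => by omega) c
    simpa only [one_mul, one_pow, mul_one] using this

theorem secondaryCoeff_zero (α : ℤ) : secondaryCoeff 𝕜 α 0 = 0 := by
  unfold secondaryCoeff; split_ifs <;> simp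

theorem two_mul_choose_two (n : ℤ) : (2 : 𝕜) * (Ring.choose n 2 : ℤ) = n * (n - 1) := by
  have := choose_mul_sub n 1
  rw [Ring.choose_one_right] at this
  have := congrArg (Int.cast : ℤ → 𝕜) this
  push_cast at this
  linear_combination this

theorem six_mul_choose_three (n : ℤ) :
    (6 : 𝕜) * (Ring.choose n 3 : ℤ) = n * (n - 1) * (n - 2) := by
  have := congrArg (Int.cast : ℤ → 𝕜) (choose_mul_sub n 2)
  push_cast at this
  linear_combination 2 * this + (n - 2 : 𝕜) * two_mul_choose_two (𝕜 := 𝕜) n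

/-- The part of the flow with `α = 3`, `N = 3` of the form `y` times a function of `t` and free of
`t₀` is that of `V^3(0, c t ^ (n - 1))`. -/
theorem secondary_top {n : ℤ} {t : ℝ} (hn : 0 ≤ n ∨ t ≠ 0) :
    2 / 3 * (secondaryCoeff 𝕜 3 n * (n - 1) * (t : 𝕜) ^ (n - 2)) =
      12 * (3 * (t : 𝕜)) * ((Ring.choose n 3 : ℤ) * (3 * (t : 𝕜)) ^ (n - 3)) +
        2 * ((Ring.choose n 2 : ℤ) * (3 * (t : 𝕜)) ^ (n - 2)) := by
  have h := choose_mul_zpow (n := n) (k := 3) (Z := 3 * (t : 𝕜)) (hn.imp_right fun h =>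
    mul_ne_zero (by norm_num) (by exact_mod_cast h))
  rw [show n - ((3 : ℕ) : ℤ) + 1 = n - 2 by push_cast; ring, Nat.cast_ofNat] at h
  have h3 := six_mul_choose_three (𝕜 := 𝕜) n
  have h2 := two_mul_choose_two (𝕜 := 𝕜) n
  have h4 : secondaryCoeff 𝕜 3 n = 3 / 2 * (2 * n - 3) * n * 3 ^ (n - 2) := if_pos rfl
  have h5 := mul_zpow (3 : 𝕜) (t : 𝕜) (n - 2)
  rw [h4]
  linear_combination (-12 : 𝕜) * h - (3 * (t : 𝕜)) ^ (n - 2) * (2 * h3 + h2) -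
    (2 * n - 3 : 𝕜) * n * (n - 1) * h5

/-- The part of the flow with `α = 2`, `N = 3` that depends on `t` alone and is free of `t₀` is that
of `V^3(-1, c t ^ (n - 1))`. -/
theorem secondary_two {n : ℤ} {t : ℝ} (hn : 0 ≤ n ∨ t ≠ 0) :
    secondaryCoeff 𝕜 2 n * (t : 𝕜) ^ (n - 1) =
      2 * (3 * (t : 𝕜)) * ((Ring.choose n 2 : ℤ) * (3 * (t : 𝕜)) ^ (n - 2)) := by
  have h := choose_mul_zpow (n := n) (k := 2) (Z := 3 * (t : 𝕜)) (hn.imp_right fun h =>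
    mul_ne_zero (by norm_num) (by exact_mod_cast h))
  rw [show n - ((2 : ℕ) : ℤ) + 1 = n - 1 by push_cast; ring, Nat.cast_ofNat] at h
  have h2 := two_mul_choose_two (𝕜 := 𝕜) n
  have h4 : secondaryCoeff 𝕜 2 n = n * (n - 1) * 3 ^ (n - 1) := by norm_num [secondaryCoeff]
  have h5 := mul_zpow (3 : 𝕜) (t : 𝕜) (n - 1)
  rw [h4]
  linear_combination (-2 : 𝕜) * h - (3 * (t : 𝕜)) ^ (n - 1) * h2 - (n : 𝕜) * (n - 1) * h5

theorem eval_wFlow_xpowThree (t₀ : 𝕜) {n α : ℤ}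
    (hn : 0 ≤ n ∨ (U : Set (Fin 3 → ℝ)) ⊆ {q | q 2 ≠ 0}) (hα : α ≤ 3)
    {K : PDO (SmoothFun 𝕜 U)} (hK : IsKPSolution 3 K) (q : U) :
    evalHom q (PDO.wFlow (PDO.xpowThree (coord 𝕜 U 0) (coord 𝕜 U 1) (leadingCoeff 𝕜 U 3)
      (algebraMap 𝕜 _ t₀) (monomial 𝕜 U 3 n) α) K) = (liePointField 3 t₀
      (Pi.single α (fun t : ℝ => ((3 : ℕ) * (t : 𝕜)) ^ n) +
        Pi.single (α - 3) (fun t : ℝ =>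
          secondaryCoeff 𝕜 α n * (t : 𝕜) ^ (n - 1)))).char (PDO.wOf K) q := by
  have hs := monomial_deriv (𝕜 := 𝕜) 3 (by omega) hn
  have hJ := iteratedDeriv_pow_eq_monomial (𝕜 := 𝕜) (N := 3) (by omega) hn q
  have hq : 0 ≤ n ∨ q.1 2 ≠ 0 := hn.imp_right fun h => h q.2
  have hS : ∀ k, evalHom q (monomial 𝕜 U 3 n k) =
      (Ring.choose n k : ℤ) * (3 * ((q.1 2 : ℝ) : 𝕜)) ^ (n - k) := fun k => by
    rw [evalHom_apply, monomial_apply (by norm_num) hn]; norm_num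
  have hz : evalHom q (leadingCoeff 𝕜 U 3) = 3 * ((q.1 2 : ℝ) : 𝕜) := leadingCoeff_apply 3 q
  have ht0 : evalHom q (algebraMap 𝕜 (SmoothFun 𝕜 U) t₀) = t₀ := rfl
  have hJ' := fun α => iteratedDeriv_const_mul_pow_pred hq (c := secondaryCoeff 𝕜 α n)
    (fun h => by rw [h, secondaryCoeff_zero])
  have hw3 : (PDO.D 3).wFlow K = pderiv 𝕜 U 2 (PDO.wOf K) := hK.wFlow_last
  rw [lieField_char, PDO.map_wFlow_xpowThree hK.dressing deriv_coord_zero deriv_coord_one hs _ hα]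
  simp only [Nat.cast_ofNat, Pi.add_apply, Pi.single_apply, deriv_eq_pderiv, ht0] at hJ ⊢
  obtain rfl | rfl | rfl | rfl | rfl | h : α = 3 ∨ α = 2 ∨ α = 1 ∨ α = 0 ∨ α = -1 ∨ α < -1 := by
    omega
  · simp only [Int.reduceEq, Int.reduceSub, Int.reduceNeg, reduceIte, add_zero, zero_add, hJ, hJ',
      iteratedDeriv_zero_fun, hK.wFlow_two, hw3, hz, Nat.factorial, Ring.choose_one_right]
    have h := secondary_top (𝕜 := 𝕜) hq
    rw [show n - 2 = n - 1 - (1 : ℕ) by push_cast; ring] at h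
    have e2 := hS 2
    have e3 := hS 3
    rw [show n - ((2 : ℕ) : ℤ) = n - 1 - (1 : ℕ) by push_cast; ring] at e2
    rw [Nat.cast_ofNat] at e3
    push_cast
    linear_combination (2 * evalHom q (coord 𝕜 U 1)) * (12 * (3 * ((q.1 2 : ℝ) : 𝕜)) * e3
      + 2 * e2 - h)
  · simp only [Int.reduceEq, Int.reduceSub, Int.reduceNeg, reduceIte, add_zero, zero_add, hJ, hJ',
      iteratedDeriv_zero_fun, hK.wFlow_two, hK.wFlow_one, hz, Nat.factorial,
      Ring.choose_zero_right]
    have h := secondary_two (𝕜 := 𝕜) hq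
    have e2 := hS 2
    rw [Nat.cast_ofNat] at e2
    push_cast
    rw [sub_zero]
    linear_combination 4 * (3 * ((q.1 2 : ℝ) : 𝕜)) * e2 - 2 * h
  · simp only [Int.reduceEq, Int.reduceSub, Int.reduceNeg, reduceIte, add_zero, hJ,
      iteratedDeriv_zero_fun, hK.wFlow_one, wFlow_D_zero hK.dressing, map_zero, Nat.factorial]
    push_cast
    ring
  · simp only [Int.reduceEq, Int.reduceSub, Int.reduceNeg, reduceIte, add_zero, hJ,
      iteratedDeriv_zero_fun, wFlow_D_zero hK.dressing, wFlow_D_neg_one hK.dressing, map_zero,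
      map_ofNat, Nat.factorial]
    push_cast
    ring
  · simp only [Int.reduceEq, Int.reduceSub, Int.reduceNeg, reduceIte, add_zero, hJ,
      iteratedDeriv_zero_fun, wFlow_D_neg_one hK.dressing, map_zero,
      wFlow_D_of_lt hK.dressing (show (-2 : ℤ) < -1 by decide), map_ofNat, Nat.factorial]
    push_cast
    ring
  · rw [wFlow_D_of_lt hK.dressing h, wFlow_D_of_lt hK.dressing (show α - 1 < -1 by omega)]
    simp only [show ¬ (3 : ℤ) = α by omega, show ¬ (2 : ℤ) = α by omega,
      show ¬ (1 : ℤ) = α by omega, show ¬ (0 : ℤ) = α by omega, show ¬ (-1 : ℤ) = α by omega,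
      show ¬ (3 : ℤ) = α - 3 by omega, show ¬ (2 : ℤ) = α - 3 by omega,
      show ¬ (1 : ℤ) = α - 3 by omega, show ¬ (0 : ℤ) = α - 3 by omega,
      show ¬ (-1 : ℤ) = α - 3 by omega, show ¬ α = 3 by omega, show ¬ α = 2 by omega,
      show ¬ α = 1 by omega, reduceIte, add_zero, iteratedDeriv_zero_fun, map_zero]
    ring

theorem pFlow_apply_of_three (t₀ : 𝕜) {m n : ℤ}
    (hn : 0 ≤ n ∨ (U : Set (Fin 3 → ℝ)) ⊆ {q | q 2 ≠ 0}) (hα : m - n + (3 : ℕ) * n ≤ (3 : ℕ))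
    {K : PDO (SmoothFun 𝕜 U)} (hK : IsKPSolution 3 K) (q : U) :
    (pFlow 3 t₀ m n K).1 q = (liePointField 3 t₀
      (Pi.single (m - n + (3 : ℕ) * n) (fun t : ℝ => ((3 : ℕ) * (t : 𝕜)) ^ n) +
        Pi.single (m - n + (3 : ℕ) * n - (3 : ℕ)) (fun t : ℝ =>
          secondaryCoeff 𝕜 (m - n + (3 : ℕ) * n) n * (t : 𝕜) ^ (n - 1)))).char (PDO.wOf K) q := by
  rw [← evalHom_apply, pFlow_eq_of_three t₀ hn hα hK.dressing]
  exact eval_wFlow_xpowThree t₀ hn hα hK q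

end Evaluation

section Fields

variable {𝕜 : Type*} [RCLike 𝕜]

/-! ### Linearity of the point fields in the functions of `t` -/

theorem liePointField_char_add {U : TopologicalSpace.Opens (Fin 3 → ℝ)} (N : ℕ) (t₀ : 𝕜)
    {hh hh' : ℤ → ℝ → 𝕜} (w : SmoothFun 𝕜 U) (q : U)
    (h : ∀ α, ∀ k : ℕ, ContDiffAt ℝ k (hh α) (q.1 2))
    (h' : ∀ α, ∀ k : ℕ, ContDiffAt ℝ k (hh' α) (q.1 2)) :
    (liePointField N t₀ (hh + hh')).char w q =
      (liePointField N t₀ hh).char w q + (liePointField N t₀ hh').char w q := by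
  have e : ∀ α (k : ℕ), iteratedDeriv k ((hh + hh') α) (q.1 2) =
      iteratedDeriv k (hh α) (q.1 2) + iteratedDeriv k (hh' α) (q.1 2) := fun α k =>
    iteratedDeriv_add (h α k) (h' α k)
  simp only [lieField_char, e]
  split_ifs <;> ring

theorem liePointField_char_smul {U : TopologicalSpace.Opens (Fin 3 → ℝ)} (N : ℕ) (t₀ : 𝕜)
    (c : 𝕜) (hh : ℤ → ℝ → 𝕜) (w : SmoothFun 𝕜 U) (q : U) :
    (liePointField N t₀ (c • hh)).char w q = c * (liePointField N t₀ hh).char w q := by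
  have e : ∀ α (k : ℕ), iteratedDeriv k ((c • hh) α) (q.1 2) =
      c * iteratedDeriv k (hh α) (q.1 2) := fun α k => iteratedDeriv_const_smul_field c (hh α)
  simp only [lieField_char, e]
  split_ifs <;> ring

/-- Only the functions `h_α` with `α = N, 2, 1, 0, -1` enter the point field. -/
theorem liePointField_char_congr {U : TopologicalSpace.Opens (Fin 3 → ℝ)} {N : ℕ} (t₀ : 𝕜)
    {hh hh' : ℤ → ℝ → 𝕜} (w : SmoothFun 𝕜 U) (q : U)
    (h : ∀ α : ℤ, α = N ∨ α = 2 ∨ α = 1 ∨ α = 0 ∨ α = -1 → hh α = hh' α) :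
    (liePointField N t₀ hh).char w q = (liePointField N t₀ hh').char w q := by
  simp only [liePointField, h N (by simp), h 2 (by simp), h 1 (by simp), h 0 (by simp),
    h (-1) (by simp)]

theorem liePointField_char_zero {U : TopologicalSpace.Opens (Fin 3 → ℝ)} (N : ℕ) (t₀ : 𝕜)
    (w : SmoothFun 𝕜 U) (q : U) : (liePointField N t₀ 0).char w q = 0 := by
  have := liePointField_char_smul N t₀ 0 0 w q
  rwa [smul_zero, zero_mul] at this

theorem PointField.AgreeOn.char_eq {Ω : Set (Fin 3 → ℝ)} {V V' : PointField 𝕜}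
    (h : V.AgreeOn Ω V') {U : TopologicalSpace.Opens (Fin 3 → ℝ)}
    (hU : (U : Set (Fin 3 → ℝ)) ⊆ Ω) (w : SmoothFun 𝕜 U) (q : U) : V.char w q = V'.char w q := by
  obtain ⟨h1, h2, h3, h4⟩ := h q (hU q.2) (w.1 q)
  simp only [PointField.char, h1, h2, h3, h4]

/-- A point field is determined by the evolutions it defines on all solutions, since `w` and its
first derivatives take arbitrary values. -/
theorem PointField.agreeOn_of_char_eq {N : ℕ} (hN : 3 ≤ N) {Ω : Set (Fin 3 → ℝ)} (hΩ : IsOpen Ω)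
    {V V' : PointField 𝕜}
    (h : ∀ U : TopologicalSpace.Opens (Fin 3 → ℝ), (U : Set (Fin 3 → ℝ)) ⊆ Ω →
      ∀ K : PDO (SmoothFun 𝕜 U), IsKPSolution N K → ∀ q : U,
        V.char (PDO.wOf K) q = V'.char (PDO.wOf K) q) : V.AgreeOn Ω V' := by
  intro q hq w
  have key : ∀ b : ℕ → 𝕜, V.vx q w * b 1 + V.vy q w * b 2 + V.vt q w * b N - V.p q w =
      V'.vx q w * b 1 + V'.vy q w * b 2 + V'.vt q w * b N - V'.p q w := by
    intro b
    obtain ⟨U, hU, hqU, K, hK, hw, hb⟩ := exists_solution N hΩ hq w b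
    have := h U hU K hK ⟨q, hqU⟩
    have h1 : (pderiv 𝕜 U 0 (PDO.wOf K)).1 ⟨q, hqU⟩ = b 1 := by
      rw [← hK.wFlow_one]; exact hb 1 le_rfl (by omega)
    have h2 : (pderiv 𝕜 U 1 (PDO.wOf K)).1 ⟨q, hqU⟩ = b 2 := by
      rw [← hK.wFlow_two]; exact hb 2 (by omega) (by omega)
    have h3 : (pderiv 𝕜 U 2 (PDO.wOf K)).1 ⟨q, hqU⟩ = b N := by
      rw [← hK.wFlow_last]; exact hb N (by omega) le_rfl
    simpa only [PointField.char, h1, h2, h3, hw] using this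
  have hN1 : N ≠ 1 := by omega
  have hN2 : N ≠ 2 := by omega
  have k0 := key 0
  have k1 := key (Pi.single 1 1)
  have k2 := key (Pi.single 2 1)
  have k3 := key (Pi.single N 1)
  simp [hN1, hN2, hN1.symm, hN2.symm] at k0 k1 k2 k3
  rw [k0] at k1 k2 k3
  exact ⟨sub_left_injective k1, sub_left_injective k2, sub_left_injective k3, k0⟩

/-! ### Laurent polynomials in `t` -/

theorem isLaurent_iff {I : Set ℤ} {φ : ℝ → 𝕜} : IsLaurent I φ ↔
    φ ∈ Submodule.span 𝕜 ((fun (j : ℤ) (t : ℝ) => (t : 𝕜) ^ j) '' I) := by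
  rw [Finsupp.mem_span_image_iff_linearCombination]
  refine exists_congr fun c => ?_
  rw [Finsupp.mem_supported, Set.subset_def, Finsupp.linearCombination_apply, eq_comm,
    funext_iff (f := φ)]
  refine and_congr Iff.rfl (forall_congr' fun t => ?_)
  simp only [Finsupp.sum, Finset.sum_apply, Pi.smul_apply, smul_eq_mul]

theorem IsLaurent.zero (I : Set ℤ) : IsLaurent I (0 : ℝ → 𝕜) := isLaurent_iff.2 (zero_mem _)

theorem IsLaurent.add {I : Set ℤ} {φ ψ : ℝ → 𝕜} (h : IsLaurent I φ) (h' : IsLaurent I ψ) :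
    IsLaurent I (φ + ψ) := isLaurent_iff.2 (add_mem (isLaurent_iff.1 h) (isLaurent_iff.1 h'))

theorem IsLaurent.smul {I : Set ℤ} {φ : ℝ → 𝕜} (h : IsLaurent I φ) (c : 𝕜) :
    IsLaurent I (c • φ) := isLaurent_iff.2 (Submodule.smul_mem _ _ (isLaurent_iff.1 h))

theorem IsLaurent.zpow {I : Set ℤ} {j : ℤ} (hj : j ∈ I) :
    IsLaurent I (fun t : ℝ => (t : 𝕜) ^ j) :=
  isLaurent_iff.2 (Submodule.subset_span ⟨j, hj, rfl⟩)

theorem IsLaurent.natCast_mul_zpow {I : Set ℤ} {j : ℤ} (hj : j ∈ I) (N : ℕ) :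
    IsLaurent I (fun t : ℝ => (N * (t : 𝕜)) ^ j) := by
  have e : (fun t : ℝ => (N * (t : 𝕜)) ^ j) = (N : 𝕜) ^ j • fun t : ℝ => (t : 𝕜) ^ j := by
    ext t; simp [mul_zpow]
  exact e ▸ (IsLaurent.zpow hj).smul _

theorem IsLaurent.const_mul_zpow {I : Set ℤ} {j : ℤ} {c : 𝕜} (h : j ∉ I → c = 0) :
    IsLaurent I (fun t : ℝ => c * (t : 𝕜) ^ j) := by
  by_cases hj : j ∈ I
  · exact (IsLaurent.zpow hj).smul c
  · have e : (fun t : ℝ => c * (t : 𝕜) ^ j) = 0 := by ext; simp [h hj]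
    exact e ▸ .zero I

theorem IsLaurent.single {I : Set ℤ} {φ : ℝ → 𝕜} (h : IsLaurent I φ) (α β : ℤ) :
    IsLaurent I ((Pi.single α φ : ℤ → ℝ → 𝕜) β) := by
  rw [Pi.single_apply]
  split_ifs
  · exact h
  · exact .zero I

theorem contDiffAt_zpow {j : ℤ} {t : ℝ} (h : 0 ≤ j ∨ t ≠ 0) (k : ℕ) :
    ContDiffAt ℝ k (fun t : ℝ => (t : 𝕜) ^ j) t := by
  have ho : ContDiffAt ℝ k (fun t : ℝ => (t : 𝕜)) t :=
    (RCLike.ofRealCLM (K := 𝕜)).contDiff.contDiffAt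
  obtain ⟨n, rfl | rfl⟩ := j.eq_nat_or_neg
  · simpa using ho.pow n
  · simp only [zpow_neg, zpow_natCast]
    rcases h with h | h
    · obtain rfl : n = 0 := by omega
      simpa using contDiffAt_const
    · exact (ho.pow n).inv (pow_ne_zero _ (by exact_mod_cast h))

theorem IsLaurent.contDiffAt {I : Set ℤ} {φ : ℝ → 𝕜} (h : IsLaurent I φ) {t : ℝ}
    (hI : (∀ n ∈ I, 0 ≤ n) ∨ t ≠ 0) (k : ℕ) : ContDiffAt ℝ k φ t := by
  induction isLaurent_iff.1 h using Submodule.span_induction with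
  | mem φ hφ =>
    obtain ⟨j, hj, rfl⟩ := hφ
    exact contDiffAt_zpow (hI.imp_left fun h => h j hj) k
  | zero => exact contDiffAt_const
  | add φ ψ _ _ h1 h2 => exact (h1 (isLaurent_iff.2 ‹_›)).add (h2 (isLaurent_iff.2 ‹_›))
  | smul c φ _ h1 => exact contDiffAt_const.smul (h1 (isLaurent_iff.2 ‹_›))

/-- The powers of `t` are linearly independent on `t ≠ 0`. -/
theorem eq_zero_of_sum_zpow_eq_zero (s : Finset ℤ) (c : ℤ → 𝕜)
    (h : ∀ t : ℝ, t ≠ 0 → ∑ n ∈ s, c n * (t : 𝕜) ^ n = 0) : ∀ n ∈ s, c n = 0 := by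
  let χ : ℤ → (ℝˣ →* 𝕜) := fun n => (Units.coeHom 𝕜).comp
    ((zpowGroupHom n).comp (Units.map (algebraMap ℝ 𝕜 : ℝ →* 𝕜)))
  have hχ : ∀ n (t : ℝˣ), χ n t = ((t : ℝ) : 𝕜) ^ n := fun n t => by simp [χ]
  have hinj : Function.Injective χ := by
    intro m n e
    have := DFunLike.congr_fun e (Units.mk0 (2 : ℝ) two_ne_zero)
    rw [hχ, hχ] at this
    simp only [Units.val_mk0] at this
    have h2 : ((2 : ℝ)) ^ m = 2 ^ n := by exact_mod_cast this
    exact zpow_right_injective₀ two_pos (by norm_num) h2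
  have := (linearIndependent_monoidHom ℝˣ 𝕜).comp χ hinj
  rw [linearIndependent_iff'] at this
  refine this s c ?_
  ext t
  simpa [hχ] using h t t.ne_zero

end Fields

section Reduction

variable {𝕜 : Type*} [RCLike 𝕜]

/-! ### The flows with `2 < α < N` -/

/-- For `2 < α < N` the leading term `(N t) ^ n ∂ ^ α` of `x̂ ^ n ∂ ^ m` gives the derivative with
respect to `t_α`, and all other terms have order at most `1`. -/
theorem exists_pointField_frozen {N : ℕ} (t₀ : 𝕜) {m n : ℤ} (h2 : 2 < m - n + N * n)
    (hN : m - n + N * n < N) :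
    ∃ V : PointField 𝕜, ∀ U : TopologicalSpace.Opens (Fin 3 → ℝ),
      (0 ≤ n ∨ (U : Set (Fin 3 → ℝ)) ⊆ {q | q 2 ≠ 0}) →
      ∀ K : PDO (SmoothFun 𝕜 U), IsKPSolution N K → ∀ q : U,
        (pFlow N t₀ m n K).1 q = (N * ((q.1 2 : ℝ) : 𝕜)) ^ n *
          (PDO.wFlow (PDO.D (m - n + N * n)) K).1 q + V.char (PDO.wOf K) q := by
  have hN4 : 4 ≤ N := by omega
  let σ : ℕ → (Fin 3 → ℝ) → 𝕜 := fun k q =>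
    (Ring.choose n k : ℤ) * (N * ((q 2 : ℝ) : 𝕜)) ^ (n - k)
  refine ⟨⟨fun q _ => if m - n + N * n = N - 1 then 2 * ((q 1 : ℝ) : 𝕜) * σ 1 q else 0,
    fun _ _ => 0, fun _ _ => 0, fun q _ => -(
      (if m - n + N * n = N - 3 then 4 * ((q 1 : ℝ) : 𝕜) * σ 1 q else 0)
      + (if m - n + N * n = N - 2 then 2 * (((q 0 : ℝ) : 𝕜) * σ 1 q) else 0)
      + (if m - n + N * n = N - 1 then
          2 * (t₀ * σ 1 q + (N - 1) * (N * ((q 2 : ℝ) : 𝕜)) * σ 2 q) else 0)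
      + (if m - n + N * n = 2 * N - 5 then 8 * ((q 1 : ℝ) : 𝕜) ^ 2 * σ 2 q else 0))⟩, ?_⟩
  intro U hn K hK q
  have hσ : ∀ k, evalHom q (monomial 𝕜 U N n k) = σ k q.1 := fun k =>
    monomial_apply (by omega) hn k q
  have h0 : σ 0 q.1 = (N * ((q.1 2 : ℝ) : 𝕜)) ^ n := by simp [σ]
  have hx : evalHom q (coord 𝕜 U 0) = ((q.1 0 : ℝ) : 𝕜) := rfl
  have hy : evalHom q (coord 𝕜 U 1) = ((q.1 1 : ℝ) : 𝕜) := rfl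
  have hz : evalHom q (leadingCoeff 𝕜 U N) = N * ((q.1 2 : ℝ) : 𝕜) := leadingCoeff_apply N q
  have ht0 : evalHom q (algebraMap 𝕜 (SmoothFun 𝕜 U) t₀) = t₀ := rfl
  rw [← evalHom_apply, pFlow_eq_of_four_le hN4 t₀ hn hN.le hK.dressing,
    PDO.map_wFlow_xpow_of_lt hK.dressing deriv_coord_zero deriv_coord_one
      (monomial_deriv N (by omega) hn) _ (by omega) hN]
  simp only [hσ, hx, hy, hz, ht0, h0, PointField.char, deriv_eq_pderiv, ← evalHom_apply]
  push_cast
  split_ifs <;> ring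

/-! ### The flows with `α = N` or `α ≤ 2` -/

variable {N : ℕ} {I : Set ℤ} {Ω : Set (Fin 3 → ℝ)}

/-- The secondary term is absent for `N ≥ 4`, and for `n = 0`. -/
theorem exists_flow_eq (hN : 3 ≤ N) (t₀ : 𝕜)
    (hI : ∀ n ∈ I, n - 1 ∉ I → n = 0) (hΩ : (∀ n ∈ I, 0 ≤ n) ∨ Ω ⊆ {q | q 2 ≠ 0}) {m n : ℤ}
    (hn : n ∈ I) (hα : m - n + N * n ≤ N) (hα' : ¬ (2 < m - n + N * n ∧ m - n + N * n < N)) :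
    ∃ c : 𝕜, (n - 1 ∉ I → c = 0) ∧
      ∀ U : TopologicalSpace.Opens (Fin 3 → ℝ), (U : Set (Fin 3 → ℝ)) ⊆ Ω →
      ∀ K : PDO (SmoothFun 𝕜 U), IsKPSolution N K → ∀ q : U,
        (pFlow N t₀ m n K).1 q = (liePointField N t₀
          (Pi.single (m - n + N * n) (fun t : ℝ => (N * (t : 𝕜)) ^ n) +
            Pi.single (m - n + N * n - N) (fun t : ℝ => c * (t : 𝕜) ^ (n - 1)))).char
          (PDO.wOf K) q := by
  have hU : ∀ U : TopologicalSpace.Opens (Fin 3 → ℝ), (U : Set (Fin 3 → ℝ)) ⊆ Ω →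
      0 ≤ n ∨ (U : Set (Fin 3 → ℝ)) ⊆ {q | q 2 ≠ 0} := fun U hU =>
    hΩ.imp (fun h => h n hn) fun h => hU.trans h
  obtain rfl | h4 : N = 3 ∨ 4 ≤ N := by omega
  · refine ⟨secondaryCoeff 𝕜 (m - n + (3 : ℕ) * n) n, fun h => ?_, fun U h K hK q =>
      pFlow_apply_of_three t₀ (hU U h) hα hK q⟩
    rw [hI n hn h, secondaryCoeff_zero]
  · refine ⟨0, fun _ => rfl, fun U h K hK q => ?_⟩
    have e : (fun t : ℝ => (0 : 𝕜) * (t : 𝕜) ^ (n - 1)) = 0 := by ext; simp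
    rw [e, Pi.single_zero, add_zero]
    exact pFlow_apply_of_four_le h4 t₀ (hU U h) hα hα' hK q

/-! ### Linear combinations of flows -/

/-- The evolution defined by `V` is a finite linear combination of the flows `∂w/∂t_{mn}` with
`n ∈ I` and `α ≤ N`, on all solutions over `Ω`. -/
def IsFlowCombination (N : ℕ) (t₀ : 𝕜) (I : Set ℤ) (Ω : Set (Fin 3 → ℝ)) (V : PointField 𝕜) :
    Prop :=
  ∃ c : ℤ × ℤ →₀ 𝕜, (∀ a ∈ c.support, a.2 ∈ I ∧ a.1 - a.2 ≤ N * (1 - a.2)) ∧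
    ∀ U : TopologicalSpace.Opens (Fin 3 → ℝ), (U : Set (Fin 3 → ℝ)) ⊆ Ω →
    ∀ K : PDO (SmoothFun 𝕜 U), IsKPSolution N K → ∀ q : U,
      (c.sum fun a z => z * (pFlow N t₀ a.1 a.2 K).1 q) = V.char (PDO.wOf K) q

namespace IsFlowCombination

variable {t₀ : 𝕜} {V V₁ V₂ : PointField 𝕜}

theorem zero (h : ∀ U : TopologicalSpace.Opens (Fin 3 → ℝ), (U : Set (Fin 3 → ℝ)) ⊆ Ω →
      ∀ w : SmoothFun 𝕜 U, ∀ q : U, V.char w q = 0) : IsFlowCombination N t₀ I Ω V :=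
  ⟨0, by simp, fun U hU K _ q => by rw [h U hU]; simp⟩

theorem add (h₁ : IsFlowCombination N t₀ I Ω V₁) (h₂ : IsFlowCombination N t₀ I Ω V₂)
    (h : ∀ U : TopologicalSpace.Opens (Fin 3 → ℝ), (U : Set (Fin 3 → ℝ)) ⊆ Ω →
      ∀ w : SmoothFun 𝕜 U, ∀ q : U, V.char w q = V₁.char w q + V₂.char w q) :
    IsFlowCombination N t₀ I Ω V := by
  obtain ⟨c₁, hc₁, e₁⟩ := h₁
  obtain ⟨c₂, hc₂, e₂⟩ := h₂
  classical
  refine ⟨c₁ + c₂, fun a ha => ?_, fun U hU K hK q => ?_⟩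
  · rcases Finset.mem_union.1 (Finsupp.support_add ha) with h | h
    exacts [hc₁ a h, hc₂ a h]
  · rw [Finsupp.sum_add_index' (by simp) (fun _ _ _ => add_mul _ _ _), h U hU, e₁ U hU K hK,
      e₂ U hU K hK]

theorem smul (b : 𝕜) (h₁ : IsFlowCombination N t₀ I Ω V₁)
    (h : ∀ U : TopologicalSpace.Opens (Fin 3 → ℝ), (U : Set (Fin 3 → ℝ)) ⊆ Ω →
      ∀ w : SmoothFun 𝕜 U, ∀ q : U, V.char w q = b * V₁.char w q) :
    IsFlowCombination N t₀ I Ω V := by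
  obtain ⟨c₁, hc₁, e₁⟩ := h₁
  refine ⟨b • c₁, fun a ha => hc₁ a (Finsupp.support_smul ha), fun U hU K hK q => ?_⟩
  rw [Finsupp.sum_smul_index (by simp), h U hU, ← e₁ U hU K hK, Finsupp.mul_sum]
  simp only [mul_assoc]

end IsFlowCombination

/-- The field `V^N(α, t ^ j)` is a combination of flows, provided that the secondary term of the
flow with leading term `V^N(α, (N t) ^ j)` is. -/
theorem isFlowCombination_single_zpow_of_secondary (hN : 3 ≤ N) (t₀ : 𝕜)
    (hI : ∀ n ∈ I, n - 1 ∉ I → n = 0) (hΩ : (∀ n ∈ I, 0 ≤ n) ∨ Ω ⊆ {q | q 2 ≠ 0})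
    {α j : ℤ} (hj : j ∈ I)
    (hα : α ≤ N) (hα' : ¬ (2 < α ∧ α < N))
    (hs : j - 1 ∈ I → IsFlowCombination N t₀ I Ω
      (liePointField N t₀ (Pi.single (α - N) (fun t : ℝ => (t : 𝕜) ^ (j - 1))))) :
    IsFlowCombination N t₀ I Ω
      (liePointField N t₀ (Pi.single α (fun t : ℝ => (t : 𝕜) ^ j))) := by
  obtain ⟨m, rfl⟩ : ∃ m, α = m - j + N * j := ⟨α + j - N * j, by ring⟩
  obtain ⟨c, hc, hflow⟩ := exists_flow_eq hN t₀ hI hΩ hj hα hα'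
  have hN0 : (N : 𝕜) ^ j ≠ 0 := zpow_ne_zero _ (by exact_mod_cast (by omega : N ≠ 0))
  have hflow' : IsFlowCombination N t₀ I Ω (liePointField N t₀
      (Pi.single (m - j + N * j) (fun t : ℝ => (N * (t : 𝕜)) ^ j) +
        Pi.single (m - j + N * j - N) (fun t : ℝ => c * (t : 𝕜) ^ (j - 1)))) := by
    refine ⟨Finsupp.single (m, j) 1, fun a ha => ?_, fun U hU K hK q => ?_⟩
    · obtain rfl := Finset.mem_singleton.1 (Finsupp.support_single_subset ha)
      exact ⟨hj, by dsimp only; linarith⟩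
    · rw [Finsupp.sum_single_index (by simp), one_mul]
      exact hflow U hU K hK q
  have hsec : IsFlowCombination N t₀ I Ω (liePointField N t₀
      (Pi.single (m - j + N * j - N) (fun t : ℝ => c * (t : 𝕜) ^ (j - 1)))) := by
    by_cases h : j - 1 ∈ I
    · refine (hs h).smul c fun U hU w q => ?_
      rw [← liePointField_char_smul, ← Pi.single_smul]
      rfl
    · refine .zero fun U hU w q => ?_
      have e : (fun t : ℝ => c * (t : 𝕜) ^ (j - 1)) = 0 := by ext; simp [hc h]
      rw [e, Pi.single_zero, liePointField_char_zero]
  have hz : ∀ q ∈ Ω, (∀ n ∈ I, 0 ≤ n) ∨ q 2 ≠ 0 := fun q hq => hΩ.imp_right fun h => h hq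
  have e1 : (fun t : ℝ => (N * (t : 𝕜)) ^ j) = (N : 𝕜) ^ j • fun t : ℝ => (t : 𝕜) ^ j := by
    ext t; simp [mul_zpow]
  have hl1 : IsLaurent I (fun t : ℝ => (N * (t : 𝕜)) ^ j) := .natCast_mul_zpow hj N
  have hl2 : IsLaurent I (fun t : ℝ => c * (t : 𝕜) ^ (j - 1)) := .const_mul_zpow hc
  have hmain : IsFlowCombination N t₀ I Ω (liePointField N t₀
      (Pi.single (m - j + N * j) (fun t : ℝ => (N * (t : 𝕜)) ^ j))) := by
    refine hflow'.add (hsec.smul (-1) fun U hU w q => (liePointField_char_smul N t₀ (-1) _ w q))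
      fun U hU w q => ?_
    rw [liePointField_char_add, liePointField_char_smul]
    · ring
    · exact fun α => (hl1.single _ α).contDiffAt (hz _ (hU q.2))
    · exact fun α => (hl2.single _ α).contDiffAt (hz _ (hU q.2))
  refine hmain.smul ((N : 𝕜) ^ j)⁻¹ fun U hU w q => ?_
  rw [e1, Pi.single_smul, liePointField_char_smul, inv_mul_cancel_left₀ hN0]

theorem isFlowCombination_single_zpow (hN : 3 ≤ N) (t₀ : 𝕜)
    (hI : ∀ n ∈ I, n - 1 ∉ I → n = 0) (hΩ : (∀ n ∈ I, 0 ≤ n) ∨ Ω ⊆ {q | q 2 ≠ 0})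
    {α j : ℤ} (hj : j ∈ I) (hα : α ≤ N)
    (hα' : ¬ (2 < α ∧ α < N)) : IsFlowCombination N t₀ I Ω
      (liePointField N t₀ (Pi.single α (fun t : ℝ => (t : 𝕜) ^ j))) := by
  refine isFlowCombination_single_zpow_of_secondary hN t₀ hI hΩ hj hα hα' fun hj' =>
    isFlowCombination_single_zpow_of_secondary hN t₀ hI hΩ hj' (by omega) (by omega) fun _ => ?_
  -- the secondary term of the secondary term has index at most `-N`, hence vanishes
  refine .zero fun U hU w q => ?_
  rw [liePointField_char_congr (hh' := 0), liePointField_char_zero]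
  exact fun β hβ => Pi.single_eq_of_ne (by omega) _

theorem isFlowCombination_single (hN : 3 ≤ N) (t₀ : 𝕜)
    (hI : ∀ n ∈ I, n - 1 ∉ I → n = 0) (hΩ : (∀ n ∈ I, 0 ≤ n) ∨ Ω ⊆ {q | q 2 ≠ 0})
    {α : ℤ} (hα : α ≤ N) (hα' : ¬ (2 < α ∧ α < N)) {φ : ℝ → 𝕜}
    (hφ : IsLaurent I φ) : IsFlowCombination N t₀ I Ω (liePointField N t₀ (Pi.single α φ)) := by
  have hz : ∀ q ∈ Ω, (∀ n ∈ I, 0 ≤ n) ∨ q 2 ≠ 0 := fun q hq => hΩ.imp_right fun h => h hq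
  induction isLaurent_iff.1 hφ using Submodule.span_induction with
  | mem φ h =>
    obtain ⟨j, hj, rfl⟩ := h
    exact isFlowCombination_single_zpow hN t₀ hI hΩ hj hα hα'
  | zero => exact .zero fun U hU w q => by rw [Pi.single_zero, liePointField_char_zero]
  | add φ ψ hl hl' h1 h2 =>
    refine (h1 (isLaurent_iff.2 hl)).add (h2 (isLaurent_iff.2 hl')) fun U hU w q => ?_
    rw [Pi.single_add, liePointField_char_add]
    · exact fun α => ((isLaurent_iff.2 hl).single _ α).contDiffAt (hz _ (hU q.2))
    · exact fun α => ((isLaurent_iff.2 hl').single _ α).contDiffAt (hz _ (hU q.2))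
  | smul c φ hl h1 =>
    refine (h1 (isLaurent_iff.2 hl)).smul c fun U hU w q => ?_
    rw [Pi.single_smul, liePointField_char_smul]

/-- Every field of the `I`-part is a linear combination of flows. -/
theorem isFlowCombination_liePointField (hN : 3 ≤ N) (t₀ : 𝕜)
    (hI : ∀ n ∈ I, n - 1 ∉ I → n = 0) (hΩ : (∀ n ∈ I, 0 ≤ n) ∨ Ω ⊆ {q | q 2 ≠ 0})
    {hh : ℤ → ℝ → 𝕜} (hh' : ∀ α, IsLaurent I (hh α)) :
    IsFlowCombination N t₀ I Ω (liePointField N t₀ hh) := by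
  have hz : ∀ q ∈ Ω, (∀ n ∈ I, 0 ≤ n) ∨ q 2 ≠ 0 := fun q hq => hΩ.imp_right fun h => h hq
  have key : ∀ s : Finset ℤ, (∀ α ∈ s, α ≤ N ∧ ¬ (2 < α ∧ α < N)) →
      (∀ α, IsLaurent I ((∑ β ∈ s, (Pi.single β (hh β) : ℤ → ℝ → 𝕜)) α)) ∧
      IsFlowCombination N t₀ I Ω (liePointField N t₀ (∑ β ∈ s, Pi.single β (hh β))) := by
    intro s
    induction s using Finset.induction_on with
    | empty =>
      exact fun _ => ⟨fun _ => .zero I, .zero fun U hU w q => liePointField_char_zero N t₀ w q⟩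
    | insert β s hβ ih =>
      intro hs
      obtain ⟨h1, h2⟩ := ih fun α hα => hs α (Finset.mem_insert_of_mem hα)
      obtain ⟨h3, h4⟩ := hs β (Finset.mem_insert_self _ _)
      rw [Finset.sum_insert hβ]
      refine ⟨fun α => ((hh' β).single β α).add (h1 α),
        (isFlowCombination_single hN t₀ hI hΩ h3 h4 (hh' β)).add h2 fun U hU w q =>
        liePointField_char_add N t₀ w q ?_ ?_⟩
      · exact fun α => ((hh' β).single _ α).contDiffAt (hz _ (hU q.2))
      · exact fun α => (h1 α).contDiffAt (hz _ (hU q.2))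
  obtain ⟨c, hc, h⟩ := (key {(N : ℤ), 2, 1, 0, -1} (by simp; omega)).2
  refine ⟨c, hc, fun U hU K hK q => (h U hU K hK q).trans ?_⟩
  refine liePointField_char_congr t₀ _ q fun α hα => ?_
  rw [Finset.sum_apply, Finset.sum_pi_single, if_pos (by simpa using hα)]

end Reduction

section Reduction

variable {𝕜 : Type*} [RCLike 𝕜] {N : ℕ} {I : Set ℤ} {Ω : Set (Fin 3 → ℝ)}

/-! ### Combinations of flows that are point fields -/

/-- Every flow with `α ≤ N` is a point field, plus the derivative with respect to the frozen time
`t_α` if `2 < α < N`. -/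
theorem exists_pFlow_eq_add_char (hN : 3 ≤ N) (t₀ : 𝕜) (hI : ∀ n ∈ I, n - 1 ∉ I → n = 0)
    (hΩ : (∀ n ∈ I, 0 ≤ n) ∨ Ω ⊆ {q | q 2 ≠ 0}) {m n : ℤ} (hn : n ∈ I)
    (hα : m - n + N * n ≤ N) :
    ∃ V : PointField 𝕜, ∀ U : TopologicalSpace.Opens (Fin 3 → ℝ), (U : Set (Fin 3 → ℝ)) ⊆ Ω →
      ∀ K : PDO (SmoothFun 𝕜 U), IsKPSolution N K → ∀ q : U,
        (pFlow N t₀ m n K).1 q = (if 2 < m - n + N * n ∧ m - n + N * n < N then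
          (N * ((q.1 2 : ℝ) : 𝕜)) ^ n * (PDO.wFlow (PDO.D (m - n + N * n)) K).1 q else 0) +
            V.char (PDO.wOf K) q := by
  by_cases h : 2 < m - n + N * n ∧ m - n + N * n < N
  · obtain ⟨V, hV⟩ := exists_pointField_frozen t₀ h.1 h.2
    refine ⟨V, fun U hU K hK q => ?_⟩
    rw [if_pos h]
    exact hV U (hΩ.imp (fun h => h n hn) fun h => hU.trans h) K hK q
  · obtain ⟨c, -, hc⟩ := exists_flow_eq hN t₀ hI hΩ hn hα h
    refine ⟨liePointField N t₀ (Pi.single (m - n + N * n) (fun t : ℝ => (N * (t : 𝕜)) ^ n) +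
      Pi.single (m - n + N * n - N) (fun t : ℝ => c * (t : 𝕜) ^ (n - 1))), fun U hU K hK q => ?_⟩
    rw [if_neg h, zero_add]
    exact hc U hU K hK q

/-- The derivatives with respect to frozen times do not cancel: only flows that are themselves
point fields occur in a combination of flows that is a point field. -/
theorem not_frozen_of_mem_support (hN : 3 ≤ N) {t₀ : 𝕜} (hI : ∀ n ∈ I, n - 1 ∉ I → n = 0)
    (hΩ : (∀ n ∈ I, 0 ≤ n) ∨ Ω ⊆ {q | q 2 ≠ 0}) (hΩo : IsOpen Ω) (hΩt : {q | q 2 ≠ 0} ⊆ Ω)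
    {V : PointField 𝕜} {c : ℤ × ℤ →₀ 𝕜}
    (hc : ∀ a ∈ c.support, a.2 ∈ I ∧ a.1 - a.2 ≤ N * (1 - a.2))
    (hV : ∀ U : TopologicalSpace.Opens (Fin 3 → ℝ), (U : Set (Fin 3 → ℝ)) ⊆ Ω →
      ∀ K : PDO (SmoothFun 𝕜 U), IsKPSolution N K → ∀ q : U,
      (c.sum fun a z => z * (pFlow N t₀ a.1 a.2 K).1 q) = V.char (PDO.wOf K) q)
    {a : ℤ × ℤ} (ha : a ∈ c.support) : ¬ (2 < a.1 - a.2 + N * a.2 ∧ a.1 - a.2 + N * a.2 < N) := by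
  intro hfr
  obtain ⟨k, hk⟩ : ∃ k : ℕ, (k : ℤ) = a.1 - a.2 + N * a.2 :=
    ⟨(a.1 - a.2 + N * a.2).toNat, Int.toNat_of_nonneg (by omega)⟩
  have hex : ∀ b : ℤ × ℤ, ∃ W : PointField 𝕜, b ∈ c.support →
      ∀ U : TopologicalSpace.Opens (Fin 3 → ℝ), (U : Set (Fin 3 → ℝ)) ⊆ Ω →
      ∀ K : PDO (SmoothFun 𝕜 U), IsKPSolution N K → ∀ q : U,
        (pFlow N t₀ b.1 b.2 K).1 q = (if 2 < b.1 - b.2 + N * b.2 ∧ b.1 - b.2 + N * b.2 < N then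
          (N * ((q.1 2 : ℝ) : 𝕜)) ^ b.2 * (PDO.wFlow (PDO.D (b.1 - b.2 + N * b.2)) K).1 q else 0) +
            W.char (PDO.wOf K) q := by
    intro b
    by_cases hb : b ∈ c.support
    · obtain ⟨W, hW⟩ := exists_pFlow_eq_add_char hN t₀ hI hΩ (hc b hb).1
        (m := b.1) (by have := (hc b hb).2; linarith)
      exact ⟨W, fun _ => hW⟩
    · exact ⟨V, fun h => absurd h hb⟩
  choose W hW using hex
  let s := c.support.filter fun b => b.1 - b.2 + N * b.2 = (k : ℤ)
  have hs : Set.InjOn Prod.snd (s : Set (ℤ × ℤ)) := by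
    rintro ⟨m, n⟩ h ⟨m', n'⟩ h' rfl
    have h1 := (Finset.mem_filter.1 h).2
    have h2 := (Finset.mem_filter.1 h').2
    simp only [Prod.mk.injEq, and_true] at h1 h2 ⊢
    linarith
  have key : ∀ t : ℝ, t ≠ 0 → ∑ n ∈ s.image Prod.snd,
      (c (k + n - N * n, n) * (N : 𝕜) ^ n) * (t : 𝕜) ^ n = 0 := by
    intro t ht
    rw [Finset.sum_image hs]
    -- two solutions with the same `w` and `w_x = w_y = w_t = 0` at a point, differing in `w_{t_k}`
    have hq : (![0, 0, t] : Fin 3 → ℝ) ∈ Ω := hΩt ht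
    obtain ⟨U, hU, hqU, K, hK, hw, hb⟩ := exists_solution N hΩo hq (0 : 𝕜) 0
    obtain ⟨U', hU', hqU', K', hK', hw', hb'⟩ := exists_solution N hΩo hq (0 : 𝕜) (Pi.single k 1)
    have h1 : (pderiv 𝕜 U 0 (PDO.wOf K)).1 ⟨_, hqU⟩ = 0 := by
      rw [← hK.wFlow_one]; exact hb 1 le_rfl (by omega)
    have h2 : (pderiv 𝕜 U 1 (PDO.wOf K)).1 ⟨_, hqU⟩ = 0 := by
      rw [← hK.wFlow_two]; exact hb 2 (by omega) (by omega)
    have h3 : (pderiv 𝕜 U 2 (PDO.wOf K)).1 ⟨_, hqU⟩ = 0 := by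
      rw [← hK.wFlow_last]; exact hb N (by omega) le_rfl
    have h1' : (pderiv 𝕜 U' 0 (PDO.wOf K')).1 ⟨_, hqU'⟩ = 0 := by
      rw [← hK'.wFlow_one]
      exact (hb' 1 le_rfl (by omega)).trans (Pi.single_eq_of_ne (by omega) _)
    have h2' : (pderiv 𝕜 U' 1 (PDO.wOf K')).1 ⟨_, hqU'⟩ = 0 := by
      rw [← hK'.wFlow_two]
      exact (hb' 2 (by omega) (by omega)).trans (Pi.single_eq_of_ne (by omega) _)
    have h3' : (pderiv 𝕜 U' 2 (PDO.wOf K')).1 ⟨_, hqU'⟩ = 0 := by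
      rw [← hK'.wFlow_last]
      exact (hb' N (by omega) le_rfl).trans (Pi.single_eq_of_ne (by omega) _)
    have hchar : ∀ X : PointField 𝕜, X.char (PDO.wOf K') ⟨_, hqU'⟩ = X.char (PDO.wOf K) ⟨_, hqU⟩ :=
      fun X => by simp only [PointField.char, h1, h2, h3, h1', h2', h3', hw, hw']
    have e := (hV U' hU' K' hK' ⟨_, hqU'⟩).trans
      ((hchar V).trans (hV U hU K hK ⟨_, hqU⟩).symm)
    rw [Finsupp.sum, Finsupp.sum, ← sub_eq_zero, ← Finset.sum_sub_distrib] at e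
    rw [Finset.sum_filter]
    refine Eq.trans (Finset.sum_congr rfl fun b hb0 => ?_) e
    rw [hW b hb0 U hU K hK, hW b hb0 U' hU' K' hK', hchar]
    split_ifs with h4 h5 h5
    · have e1 := hb k (by omega) (by omega)
      have e2 := hb' k (by omega) (by omega)
      rw [Pi.single_eq_same] at e2
      rw [h4, e1, e2, ← h4, show b.1 - b.2 + N * b.2 + b.2 - N * b.2 = b.1 by ring, mul_zpow]
      simp
      ring
    · omega
    · obtain ⟨j, hj⟩ : ∃ j : ℕ, (j : ℤ) = b.1 - b.2 + N * b.2 :=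
        ⟨(b.1 - b.2 + N * b.2).toNat, Int.toNat_of_nonneg (by omega)⟩
      have e1 := hb j (by omega) (by omega)
      have e2 := hb' j (by omega) (by omega)
      rw [Pi.single_eq_of_ne (by omega)] at e2
      rw [← hj, e1, e2]
      simp
    · simp
  have := eq_zero_of_sum_zpow_eq_zero _ _ key a.2
    (Finset.mem_image_of_mem _ (Finset.mem_filter.2 ⟨ha, hk.symm⟩))
  rw [hk, show a.1 - a.2 + N * a.2 + a.2 - N * a.2 = a.1 by ring] at this
  exact mul_ne_zero (Finsupp.mem_support_iff.1 ha)
    (zpow_ne_zero _ (by exact_mod_cast (by omega : N ≠ 0))) this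

/-- A combination of flows that is a point field belongs to the `I`-part. -/
theorem exists_isLaurent_of_isFlowCombination (hN : 3 ≤ N) {t₀ : 𝕜}
    (hI : ∀ n ∈ I, n - 1 ∉ I → n = 0) (hΩ : (∀ n ∈ I, 0 ≤ n) ∨ Ω ⊆ {q | q 2 ≠ 0})
    (hΩo : IsOpen Ω) (hΩt : {q | q 2 ≠ 0} ⊆ Ω) {V : PointField 𝕜}
    (h : IsFlowCombination N t₀ I Ω V) :
    ∃ hh : ℤ → ℝ → 𝕜, (∀ α, IsLaurent I (hh α)) ∧ V.AgreeOn Ω (liePointField N t₀ hh) := by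
  obtain ⟨c, hc, hV⟩ := h
  have hz : ∀ q ∈ Ω, (∀ n ∈ I, 0 ≤ n) ∨ q 2 ≠ 0 := fun q hq => hΩ.imp_right fun h => h hq
  have key : ∀ s ⊆ c.support, ∃ hh : ℤ → ℝ → 𝕜, (∀ α, IsLaurent I (hh α)) ∧
      ∀ U : TopologicalSpace.Opens (Fin 3 → ℝ), (U : Set (Fin 3 → ℝ)) ⊆ Ω →
      ∀ K : PDO (SmoothFun 𝕜 U), IsKPSolution N K → ∀ q : U,
      (∑ a ∈ s, c a * (pFlow N t₀ a.1 a.2 K).1 q) =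
        (liePointField N t₀ hh).char (PDO.wOf K) q := by
    intro s
    induction s using Finset.induction_on with
    | empty =>
      exact fun _ => ⟨0, fun _ => .zero I, fun U hU K hK q => by
        rw [liePointField_char_zero, Finset.sum_empty]⟩
    | insert a s ha ih =>
      intro hs
      obtain ⟨hh, h1, h2⟩ := ih fun b hb => hs (Finset.mem_insert_of_mem hb)
      have has : a ∈ c.support := hs (Finset.mem_insert_self _ _)
      obtain ⟨d, hd, hflow⟩ := exists_flow_eq hN t₀ hI hΩ (hc a has).1 (m := a.1)
        (by have := (hc a has).2; linarith) (not_frozen_of_mem_support hN hI hΩ hΩo hΩt hc hV has)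
      have hl1 : IsLaurent I (fun t : ℝ => (N * (t : 𝕜)) ^ a.2) :=
        .natCast_mul_zpow (hc a has).1 N
      have hl2 : IsLaurent I (fun t : ℝ => d * (t : 𝕜) ^ (a.2 - 1)) := .const_mul_zpow hd
      have hl : ∀ α, IsLaurent I ((c a • (Pi.single (a.1 - a.2 + N * a.2)
          (fun t : ℝ => (N * (t : 𝕜)) ^ a.2) + Pi.single (a.1 - a.2 + N * a.2 - N)
            (fun t : ℝ => d * (t : 𝕜) ^ (a.2 - 1))) : ℤ → ℝ → 𝕜) α) := fun α =>
        ((hl1.single _ α).add (hl2.single _ α)).smul _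
      refine ⟨c a • (Pi.single (a.1 - a.2 + N * a.2) (fun t : ℝ => (N * (t : 𝕜)) ^ a.2) +
        Pi.single (a.1 - a.2 + N * a.2 - N) (fun t : ℝ => d * (t : 𝕜) ^ (a.2 - 1))) + hh,
        fun α => (hl α).add (h1 α), fun U hU K hK q => ?_⟩
      rw [Finset.sum_insert ha, liePointField_char_add, liePointField_char_smul, h2 U hU K hK,
        hflow U hU K hK]
      · exact fun α => (hl α).contDiffAt (hz _ (hU q.2))
      · exact fun α => (h1 α).contDiffAt (hz _ (hU q.2))
  obtain ⟨hh, h1, h2⟩ := key c.support subset_rfl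
  refine ⟨hh, h1, PointField.agreeOn_of_char_eq hN hΩo fun U hU K hK q => ?_⟩
  rw [← hV U hU K hK q, ← h2 U hU K hK q, Finsupp.sum]

/-- The reduction for any set `I` of exponents that is closed under `n ↦ n - 1` except at `n = 0`,
where the secondary terms vanish, and any open `Ω ⊇ {t ≠ 0}` on which the powers `t ^ n`, `n ∈ I`,
are smooth. -/
theorem reducesToPointSymmetries (hN : 3 ≤ N) (t₀ : 𝕜)
    (hI : ∀ n ∈ I, n - 1 ∉ I → n = 0) (hΩ : (∀ n ∈ I, 0 ≤ n) ∨ Ω ⊆ {q | q 2 ≠ 0})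
    (hΩo : IsOpen Ω) (hΩt : {q | q 2 ≠ 0} ⊆ Ω) : ReducesToPointSymmetries N t₀ I Ω where
  flow_eq m n hn h hα := exists_flow_eq hN t₀ hI hΩ hn (by linarith) hα
  flow_eq_frozen m n hn h2 hN := by
    obtain ⟨V, hV⟩ := exists_pointField_frozen t₀ h2 hN
    exact ⟨V, fun U hU => hV U (hΩ.imp (fun h => h n hn) fun h => hU.trans h)⟩
  span_iff V := by
    refine ⟨exists_isLaurent_of_isFlowCombination hN hI hΩ hΩo hΩt, ?_⟩
    rintro ⟨hh, hh', hV⟩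
    obtain ⟨c, hc, h⟩ := isFlowCombination_liePointField hN t₀ hI hΩ hh'
    exact ⟨c, hc, fun U hU K hK q => (h U hU K hK q).trans (hV.char_eq hU _ q).symm⟩
  symmetry hh hh' U hU K hK := by
    obtain ⟨c, hc, h⟩ := isFlowCombination_liePointField hN t₀ hI hΩ hh'
    obtain ⟨Λ, ⟨h1, h2, h3⟩, h4⟩ := exists_isLinSolution hN hK t₀ c fun a ha =>
      hΩ.imp (fun h => h _ (hc a ha).1) fun h => hU.trans h
    exact ⟨Λ, h1, h2, h3, fun q => (h4 q).trans (h U hU K hK q)⟩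

end Reduction

theorem theorem3 {𝕜 : Type*} [RCLike 𝕜] (N : ℕ) (hN : 3 ≤ N) (t₀ : 𝕜) :
    ReducesToPointSymmetries N t₀ (Set.Ici 0) Set.univ ∧
    (∀ U : TopologicalSpace.Opens (Fin 3 → ℝ), (U : Set (Fin 3 → ℝ)) ⊆ {q | q 2 ≠ 0} →
      IsUnit (frozenXhat U N t₀) ∧
      (N : SmoothFun 𝕜 U) * coord 𝕜 U 2 * (Ring.inverse (frozenXhat U N t₀)).coeff (1 - N) = 1 ∧
      ∀ i : ℤ, 1 - N < i → (Ring.inverse (frozenXhat U N t₀)).coeff i = 0) ∧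
    ReducesToPointSymmetries N t₀ (Set.Iio 0) {q | q 2 ≠ 0} ∧
    ReducesToPointSymmetries N t₀ (Set.Iic 0) {q | q 2 ≠ 0} := by
  have ho : IsOpen {q : Fin 3 → ℝ | q 2 ≠ 0} := isOpen_ne_fun (continuous_apply 2) continuous_const
  refine ⟨?_, fun U hU => ?_, ?_, ?_⟩
  · exact reducesToPointSymmetries hN t₀
      (fun n hn hn' => by simp only [Set.mem_Ici] at hn hn'; omega) (Or.inl fun n hn => hn)
      isOpen_univ (Set.subset_univ _)
  · obtain ⟨h1, h2, h3⟩ := frozenXhat_inverse hN t₀ hU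
    exact ⟨h1, h3, h2⟩
  · exact reducesToPointSymmetries hN t₀
      (fun n hn hn' => by simp only [Set.mem_Iio] at hn hn'; omega) (Or.inr subset_rfl) ho subset_rfl
  · exact reducesToPointSymmetries hN t₀
      (fun n hn hn' => by simp only [Set.mem_Iic] at hn hn'; omega) (Or.inr subset_rfl) ho subset_rfl
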